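/- **Definitions.** A $p=1$ QAOA circuit $C$ on $n$ qubits consists of a $Z$-basis unitary $C_Z$, which is a product of one- and two-qubit gates diagonal in the computational basis, and of angles $\beta_1,\dots,\beta_n$. It prepares the state $\exp\big(i\sum_k\beta_k\sigma^x_k\big)\,C_Z\,|+\rangle^{\otimes n}$, and $p(C)=\big|\langle 0^n|\exp\big(i\sum_k\beta_k\sigma^x_k\big)C_Z|+\rangle^{\otimes n}\big|^2$ is the probability of the outcome $0^n$ of a measurement in the computational basis. For any diagonal unitary $C_Z$ on $n$ qubits the same formula defines $p$. A language $L\subseteq\{0,1\}^*$ is in $\mathsf{coC_=P}$ if there are a polynomial $q$ and a polynomial-time computable function $f$ with values in $\{-1,1\}$ such that, for all $x$, $x\in L$ if and only if $\sum_{y\in\{0,1\}^{q(|x|)}}f(x,y)\neq 0$. Polynomial time refers to deterministic Turing machines. **Theorem.** 1. (Phase oracle.) For every $n$ and every $\tilde f:\{0,1\}^n\to\{-1,1\}$, let $C_Z$ be the diagonal unitary $|z\rangle\mapsto(-i)^{|z|}\tilde f(z)|z\rangle$, where $|z|$ is the Hamming weight, and let $\beta_k=\pi/4$ for all $k$. Then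 the probability of the outcome $0^n$ is $2^{-2n}\big(\sum_z\tilde f(z)\big)^2$. So it is $0$ if $\sum_z\tilde f(z)=0$, and at least $2^{-2n}$ otherwise. 2. (Hardness.) Consider the family $\mathcal F$ of all $p=1$ QAOA circuits in which $C_Z$ is a finite sequence of gates $T=\mathrm{diag}(1,e^{i\pi/4})$ and $CZ=\mathrm{diag}(1,1,1,-1)$ and all $\beta_k=\pi/4$. A circuit is given by its number of qubits $n$ and its list of gates. For every $n_0$ the following two problems, restricted to the circuits $C\in\mathcal F$ on $n\ge n_0$ qubits, are $\mathsf{coC_=P}$-hard. (a) Approximate $p(C)$ to within additive error $2^{-(2n+1)}$: given $C$, output a binary fraction $s$ with $|s-p(C)|\le 2^{-(2n+1)}$. Here hardness means that for every $L\in\mathsf{coC_=P}$ there are polynomial-time computable $r$ and $g$ such that $r(x)\in\mathcal F$ is a circuit on at least $n_0$ qubits for every $x$, and for every binary fraction $s$ that solves the problem for $r(x)$, $g(x,s)$ decides whether $x\in L$. (b) Decide whether $p(C)\ge 2^{-2n}$ or $p(C)=0$, under the promise that one of the two holds. Here hardness means that for every $L\in\mathsf{coC_=P}$ there is a polynomial-time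 computable $r$ such that for every $x$, $r(x)\in\mathcal F$ is a circuit on $n\ge n_0$ qubits, with $p(r(x))\ge 2^{-2n}$ if $x\in L$ and $p(r(x))=0$ if $x\notin L$. -/

import Mathlib

open scoped Matrix

/-! ## Polynomial time and the class coC₌P -/

/-- `f` is computable in polynomial time by a deterministic (multi-stack) Turing machine, relative
to the encodings `ea` of the input and `eb` of the output as strings over finite alphabets. -/
def PolyTimeComputable {α β αΓ βΓ : Type} (ea : α → List αΓ) (eb : β → List βΓ) (f : α → β) :
    Prop :=
  Nonempty (Turing.TM2ComputableInPolyTime ea eb f)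

/-- A binary string is encoded by itself. -/
def encodeString (x : List Bool) : List Bool := x

/-- A pair of binary strings is encoded as `x # y`, where `#` is the symbol `none`. -/
def encodePair (p : List Bool × List Bool) : List (Option Bool) :=
  p.1.map some ++ none :: p.2.map some

/-- A bit is encoded as the corresponding string of length one. -/
def encodeBit (b : Bool) : List Bool := [b]

/-- An element of `{1, -1}` is encoded as a string of length one. -/
def encodeSign (u : ℤˣ) : List Bool := [decide (u = 1)]

/-- The class coC₌P: languages `L` for which there are a polynomial `q` and a polynomial-time
computable `f` with values in `{1, -1}` such that `x ∈ L` if and only if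
`∑ y ∈ {0,1}^{q(|x|)}, f (x, y) ≠ 0`. -/
def coCeqP : Set (Set (List Bool)) :=
  {L | ∃ (q : Polynomial ℕ) (f : List Bool × List Bool → ℤˣ),
      PolyTimeComputable encodePair encodeSign f ∧
      ∀ x : List Bool, x ∈ L ↔
        (∑ y : Fin (q.eval x.length) → Bool, ((f (x, List.ofFn y) : ℤˣ) : ℤ)) ≠ 0}

/-- The promise problem "decide whether an instance is in `yes` or in `no`" is coC₌P-hard: every
language in coC₌P reduces to it by a polynomial-time many-one reduction. -/
def PromiseHard {α Γ : Type} (enc : α → List Γ) (yes no : Set α) : Prop :=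
  ∀ L ∈ coCeqP, ∃ r : List Bool → α, PolyTimeComputable encodeString enc r ∧
    (∀ x ∈ L, r x ∈ yes) ∧ (∀ x ∉ L, r x ∈ no)

/-- The problem "given an instance `a ∈ dom`, output a binary string `s` with `Sol a s`" is
coC₌P-hard: every language in coC₌P reduces to it by a polynomial-time reduction with one query.
The reduction maps the input `x` to an instance `r x ∈ dom`, and from `x` and an arbitrary solution
`s` for that instance it decides in polynomial time whether `x ∈ L`. -/
def SearchHard {α Γ : Type} (enc : α → List Γ) (dom : Set α) (Sol : α → List Bool → Prop) : Prop :=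
  ∀ L ∈ coCeqP, ∃ (r : List Bool → α) (g : List Bool × List Bool → Bool),
    PolyTimeComputable encodeString enc r ∧ PolyTimeComputable encodePair encodeBit g ∧
    (∀ x, r x ∈ dom) ∧ ∀ x s, Sol (r x) s → (g (x, s) = true ↔ x ∈ L)

/-! ## QAOA circuits with one stage -/

/-- Bit strings of length `n`; they label the computational basis of `n` qubits. -/
abbrev Bits (n : ℕ) : Type := Fin n → Bool

/-- The Pauli operator `σˣ` acting on the qubit `k`. -/
def sigmaX {n : ℕ} (k : Fin n) : Matrix (Bits n) (Bits n) ℂ :=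
  Matrix.of fun z w => if z = Function.update w k (!w k) then 1 else 0

/-- The X-basis unitary `exp(i ∑ₖ βₖ σˣₖ)`. -/
noncomputable def mixer {n : ℕ} (β : Fin n → ℝ) : Matrix (Bits n) (Bits n) ℂ :=
  NormedSpace.exp (∑ k, (Complex.I * (β k : ℂ)) • sigmaX k)

/-- The uniform superposition `|+⟩^{⊗ n}`. -/
noncomputable def plusState (n : ℕ) : Bits n → ℂ :=
  fun _ => (1 / (Real.sqrt 2 : ℂ)) ^ n

/-- The state `exp(i ∑ₖ βₖ σˣₖ) C_Z |+⟩^{⊗ n}` prepared by one stage of QAOA. -/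
noncomputable def qaoaState {n : ℕ} (CZ : Matrix (Bits n) (Bits n) ℂ) (β : Fin n → ℝ) :
    Bits n → ℂ :=
  (mixer β * CZ) *ᵥ plusState n

/-- The probability of the outcome `0ⁿ` when `qaoaState CZ β` is measured in the computational
basis. -/
noncomputable def qaoaProbZero {n : ℕ} (CZ : Matrix (Bits n) (Bits n) ℂ) (β : Fin n → ℝ) : ℝ :=
  ‖qaoaState CZ β (fun _ => false)‖ ^ 2

/-- A gate on one or two qubits that is diagonal in the Z basis, given by its phases. -/
inductive ZGate (n : ℕ) : Type
  | one (j : Fin n) (φ : Bool → ℝ) : ZGate n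
  | two (j k : Fin n) (hjk : j ≠ k) (φ : Bool → Bool → ℝ) : ZGate n

/-- The unitary of a diagonal gate, acting as the identity on the other qubits. -/
noncomputable def ZGate.toMatrix {n : ℕ} : ZGate n → Matrix (Bits n) (Bits n) ℂ
  | .one j φ => Matrix.diagonal fun z => Complex.exp (Complex.I * (φ (z j) : ℂ))
  | .two j k _ φ => Matrix.diagonal fun z => Complex.exp (Complex.I * (φ (z j) (z k) : ℂ))

/-- A `p = 1` QAOA circuit on `n` qubits: a sequence of diagonal one- and two-qubit gates applied
to `|+⟩^{⊗ n}`, followed by one layer of X-rotations. -/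
structure QAOACircuit (n : ℕ) : Type where
  zGates : List (ZGate n)
  β : Fin n → ℝ

/-- The Z-basis unitary of a circuit (its gates commute). -/
noncomputable def QAOACircuit.zUnitary {n : ℕ} (C : QAOACircuit n) :
    Matrix (Bits n) (Bits n) ℂ :=
  (C.zGates.map ZGate.toMatrix).prod

/-- The probability `p(C)` of the outcome `0ⁿ`. -/
noncomputable def QAOACircuit.probZero {n : ℕ} (C : QAOACircuit n) : ℝ :=
  qaoaProbZero C.zUnitary C.β

/-! ## Phase oracles -/

/-- The Hamming weight of a bit string. -/
def hammingWeight {n : ℕ} (z : Bits n) : ℕ :=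
  (Finset.univ.filter fun k => z k = true).card

/-- The diagonal unitary `|z⟩ ↦ (-i)^{|z|} f(z) |z⟩`. -/
noncomputable def phaseOracle {n : ℕ} (f : Bits n → ℤˣ) : Matrix (Bits n) (Bits n) ℂ :=
  Matrix.diagonal fun z => (-Complex.I) ^ hammingWeight z * (((f z : ℤˣ) : ℤ) : ℂ)

/-! ## A finitely described family of QAOA circuits -/

/-- The gates `T = diag(1, e^{iπ/4})` and `CZ = diag(1, 1, 1, -1)`. -/
inductive TCZGate (n : ℕ) : Type
  | T (j : Fin n) : TCZGate n
  | CZ (j k : Fin n) (hjk : j ≠ k) : TCZGate n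

noncomputable def TCZGate.toZGate {n : ℕ} : TCZGate n → ZGate n
  | .T j => .one j fun b => if b then Real.pi / 4 else 0
  | .CZ j k hjk => .two j k hjk fun b c => if b && c then Real.pi else 0

/-- The description of a circuit of the family: the number of qubits and the list of gates. -/
structure TCZCircuit : Type where
  n : ℕ
  gates : List (TCZGate n)

/-- The QAOA circuit described: all X-rotations have the angle `β = π/4`. -/
noncomputable def TCZCircuit.toQAOA (C : TCZCircuit) : QAOACircuit C.n where
  zGates := C.gates.map TCZGate.toZGate
  β := fun _ => Real.pi / 4

/-- The probability `p(C)` of the outcome `0ⁿ`. -/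
noncomputable def TCZCircuit.probZero (C : TCZCircuit) : ℝ := C.toQAOA.probZero

/-- The alphabet in which circuits are written. -/
inductive CircuitSymbol : Type
  | tally | sep | gateT | gateCZ

/-- A number in unary, followed by a separator. -/
def encodeUnary (k : ℕ) : List CircuitSymbol :=
  List.replicate k CircuitSymbol.tally ++ [CircuitSymbol.sep]

def TCZGate.encode {n : ℕ} : TCZGate n → List CircuitSymbol
  | .T j => CircuitSymbol.gateT :: encodeUnary j
  | .CZ j k _ => CircuitSymbol.gateCZ :: (encodeUnary j ++ encodeUnary k)

/-- A circuit is written as its number of qubits, followed by its gates in order. -/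
def encodeCircuit (C : TCZCircuit) : List CircuitSymbol :=
  encodeUnary C.n ++ C.gates.flatMap TCZGate.encode

/-! ## Approximation -/

/-- The value `∑ᵢ sᵢ 2⁻ⁱ` of a binary fraction `s₀.s₁s₂…`. -/
noncomputable def binaryFraction : List Bool → ℝ
  | [] => 0
  | b :: s => (if b then 1 else 0) + binaryFraction s / 2

/-- The binary fraction `s` approximates the probability of the outcome `0ⁿ` of the circuit `C` on
`n` qubits to within the additive error `2^{-(2n+1)}`. -/
def ApproximatesProbZero (C : TCZCircuit) (s : List Bool) : Prop :=
  |binaryFraction s - C.probZero| ≤ 1 / 2 ^ (2 * C.n + 1)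

/-! At the angle π/4 the first row of the X-basis unitary is 2^{-n/2} i^{|z|}, so for a diagonal
unitary with entries d(z) the amplitude of 0ⁿ is 2^{-n} ∑_z i^{|z|} d(z) (`qaoaProbZero_diagonal`).
The phase oracle cancels i^{|z|}, which is the first part.

For hardness, six T gates on every qubit also cancel i^{|z|}, and the other gates have to turn the
sum over z into a positive integer multiple C of ∑_y f(x,y). A sum over basis states imposes
constraints: a qubit u that contributes s^u with a sign s gives 1 + s, which vanishes unless s = 1.
Such check qubits force the remaining qubits to describe the computation of f(x,y), with only y
free, and a final sign -1 for the output -1 leaves f(x,y) for each y.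

The computation is brought into a uniform shape first. `exists_delay_sequence` unrolls the tableau
of the machine, row after row, into a sequence over a finite alphabet in which c_p = F(c_{p-1},
c_{p-D}) from p = D on; the verdict is read from the term D² - 1. Each term becomes a block of a
fixed number of qubits, with one indicator qubit per letter. The rule F becomes a sign that contains
the cubic terms (-1)^{uxy}; these are made from T gates on the parities of u, x and y, and the
parities are held by qubits that check qubits force to the right value (`cubic_phase`, `sum_parity`,
`exists_sum_aux`). The solutions of all checks correspond exactly to the strings y (`sum_checks`),
so that p = (C ∑_y f(x,y))² / 4ⁿ.

The reduction must itself run in polynomial time. The blocks follow finitely many templates, and a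
small language with counters, compiled to stack machines, writes them in loops (`exists_generator`,
`polyTimeComputable_of_runs`).

Finally C ≥ 2, so p is 0 or at least 4 · 2^{-2n}. This margin lets the first 2n bits of an
approximation decide membership (`ApproximatesProbZero.any_take_iff`). -/

/-! ## A small programming language for polynomial-time computations -/

/-- Programs with an input stack over `α`, an output stack over `β` and counters indexed by `ι`. -/
inductive Prog (α β ι : Type) : Type
  | skip : Prog α β ι
  | inc (c : ι) : Prog α β ι
  | out (b : β) : Prog α β ι
  | seq (p q : Prog α β ι) : Prog α β ι
  | ifz (c : ι) (p q : Prog α β ι) : Prog α β ι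
  | whileDec (c : ι) (p : Prog α β ι) : Prog α β ι
  | forInput (body : α → Prog α β ι) : Prog α β ι

/-- The memory of a program. -/
@[ext] structure Store (α β ι : Type) : Type where
  inp : List α
  ctr : ι → ℕ
  out : List β

namespace Store

variable {α β ι : Type} [DecidableEq ι]

/-- Write the value `v` to the counter `c`. -/
def set (s : Store α β ι) (c : ι) (v : ℕ) : Store α β ι :=
  { s with ctr := Function.update s.ctr c v }

@[simp] theorem inp_set (s : Store α β ι) (c : ι) (v : ℕ) : (s.set c v).inp = s.inp := rfl

@[simp] theorem out_set (s : Store α β ι) (c : ι) (v : ℕ) : (s.set c v).out = s.out := rfl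

theorem ctr_set (s : Store α β ι) (c d : ι) (v : ℕ) :
    (s.set c v).ctr d = if d = c then v else s.ctr d := by
  simp [set, Function.update_apply]

end Store

/-- `Exec p s s' t`: started in `s`, the program `p` terminates in `s'` after `t` steps. -/
inductive Exec {α β ι : Type} [DecidableEq ι] :
    Prog α β ι → Store α β ι → Store α β ι → ℕ → Prop
  | skip (s) : Exec .skip s s 1
  | inc (c s) : Exec (.inc c) s (s.set c (s.ctr c + 1)) 1
  | out (b) (s : Store α β ι) : Exec (.out b) s { s with out := b :: s.out } 1
  | seq {p q s s' s'' t t'} : Exec p s s' t → Exec q s' s'' t' → Exec (.seq p q) s s'' (t + t')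
  | ifz_zero {c p q s s' t} : s.ctr c = 0 → Exec p s s' t → Exec (.ifz c p q) s s' (t + 1)
  | ifz_succ {c p q s s' t n} : s.ctr c = n + 1 → Exec q (s.set c n) s' t →
      Exec (.ifz c p q) s s' (t + 1)
  | while_zero {c p s} : s.ctr c = 0 → Exec (.whileDec c p) s s 1
  | while_succ {c p s s' s'' t t' n} : s.ctr c = n + 1 → Exec p (s.set c n) s' t →
      Exec (.whileDec c p) s' s'' t' → Exec (.whileDec c p) s s'' (t + t' + 1)
  | input_nil {b s} : s.inp = [] → Exec (.forInput b) s s 1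
  | input_cons {b s s' s'' t t' a l} : s.inp = a :: l → Exec (b a) { s with inp := l } s' t →
      Exec (.forInput b) s' s'' t' → Exec (.forInput b) s s'' (t + t' + 1)

/-! ### Compilation to a Turing machine -/

namespace Prog

variable {α β ι : Type}

/-- The control points of a program. -/
def Lab : Prog α β ι → Type
  | skip => Unit
  | inc _ => Unit
  | out _ => Unit
  | seq p q => Lab p ⊕ Lab q
  | ifz _ p q => Option (Lab p ⊕ Lab q)
  | whileDec _ p => Option (Lab p)
  | forInput b => Option (Σ a, Lab (b a))

/-- The first control point of a program. -/
def entry : (p : Prog α β ι) → Lab p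
  | skip => ()
  | inc _ => ()
  | out _ => ()
  | seq p _ => Sum.inl (entry p)
  | ifz _ _ _ => none
  | whileDec _ _ => none
  | forInput _ => none

theorem finite_lab [Finite α] : ∀ p : Prog α β ι, Finite (Lab p)
  | skip => inferInstanceAs (Finite Unit)
  | inc _ => inferInstanceAs (Finite Unit)
  | out _ => inferInstanceAs (Finite Unit)
  | seq p q =>
    have := finite_lab p
    have := finite_lab q
    inferInstanceAs (Finite (Lab p ⊕ Lab q))
  | ifz _ p q =>
    have := finite_lab p
    have := finite_lab q
    inferInstanceAs (Finite (Option (Lab p ⊕ Lab q)))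
  | whileDec _ p =>
    have := finite_lab p
    inferInstanceAs (Finite (Option (Lab p)))
  | forInput b =>
    have := fun a => finite_lab (b a)
    inferInstanceAs (Finite (Option (Σ a, Lab (b a))))

/-- The stack alphabets of the compiled machine: `Sum.inr false` is the input stack, `Sum.inr true`
the output stack, and the other stacks hold the counters in unary. -/
def StackAlphabet (α β ι : Type) : ι ⊕ Bool → Type
  | Sum.inl _ => Unit
  | Sum.inr false => α
  | Sum.inr true => β

/-- The internal states of the compiled machine. -/
abbrev Reg (α : Type) : Type := Bool × Option α

/-- Pop a counter and record whether it was nonzero. -/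
def popCounter {Λ : Type} (c : ι) (q : Turing.TM2.Stmt (StackAlphabet α β ι) Λ (Reg α)) :
    Turing.TM2.Stmt (StackAlphabet α β ι) Λ (Reg α) :=
  .pop (Sum.inl c) (fun v o => (o.isSome, v.2)) q

/-- The code of a program embedded in a machine with labels `Λ`, continuing at `ex`. -/
def code {Λ : Type} : (p : Prog α β ι) → (Lab p → Λ) → Λ → Lab p →
    Turing.TM2.Stmt (StackAlphabet α β ι) Λ (Reg α)
  | skip, _, ex, _ => .goto fun _ => ex
  | inc c, _, ex, _ => .push (Sum.inl c) (fun _ => ()) (.goto fun _ => ex)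
  | out b, _, ex, _ => .push (Sum.inr true) (fun _ => b) (.goto fun _ => ex)
  | seq p q, emb, _, Sum.inl l => code p (fun l => emb (Sum.inl l)) (emb (Sum.inr (entry q))) l
  | seq _ q, emb, ex, Sum.inr l => code q (fun l => emb (Sum.inr l)) ex l
  | ifz c p q, emb, _, none => popCounter c (.goto fun v =>
      if v.1 then emb (some (Sum.inr (entry q))) else emb (some (Sum.inl (entry p))))
  | ifz _ p _, emb, ex, some (Sum.inl l) => code p (fun l => emb (some (Sum.inl l))) ex l
  | ifz _ _ q, emb, ex, some (Sum.inr l) => code q (fun l => emb (some (Sum.inr l))) ex l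
  | whileDec c p, emb, ex, none => popCounter c (.goto fun v =>
      if v.1 then emb (some (entry p)) else ex)
  | whileDec _ p, emb, _, some l => code p (fun l => emb (some l)) (emb none) l
  | forInput b, emb, ex, none => .pop (Sum.inr false) (fun v o => (v.1, o)) (.goto fun v =>
      match v.2 with
      | some a => emb (some ⟨a, entry (b a)⟩)
      | none => ex)
  | forInput b, emb, _, some ⟨a, l⟩ => code (b a) (fun l => emb (some ⟨a, l⟩)) (emb none) l

end Prog

namespace Store

variable {α β ι : Type}

/-- The stacks that represent a memory. -/
def stk (s : Store α β ι) : ∀ k, List (Prog.StackAlphabet α β ι k)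
  | Sum.inl c => List.replicate (s.ctr c) ()
  | Sum.inr false => s.inp
  | Sum.inr true => s.out

variable [DecidableEq ι]

theorem update_stk_counter (s : Store α β ι) (c : ι) (n : ℕ) :
    Function.update s.stk (Sum.inl c) (List.replicate n () : List Unit) = (s.set c n).stk := by
  refine Function.update_eq_iff.2 ⟨?_, fun k hk => ?_⟩
  · change List.replicate n () = List.replicate ((s.set c n).ctr c) ()
    rw [ctr_set, if_pos rfl]
  · rcases k with d | _ | _
    · have hd : d ≠ c := fun h => hk (h ▸ rfl)
      change List.replicate (s.ctr d) () = List.replicate ((s.set c n).ctr d) ()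
      rw [ctr_set, if_neg hd]
    · rfl
    · rfl

theorem update_stk_input (s : Store α β ι) (l : List α) :
    Function.update s.stk (Sum.inr false) l = ({ s with inp := l } : Store α β ι).stk := by
  refine Function.update_eq_iff.2 ⟨rfl, fun k hk => ?_⟩
  rcases k with d | _ | _
  exacts [rfl, (hk rfl).elim, rfl]

theorem update_stk_output (s : Store α β ι) (l : List β) :
    Function.update s.stk (Sum.inr true) l = ({ s with out := l } : Store α β ι).stk := by
  refine Function.update_eq_iff.2 ⟨rfl, fun k hk => ?_⟩
  rcases k with d | _ | _
  exacts [rfl, rfl, (hk rfl).elim]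

end Store

/-- The machine `M` reaches the configuration `c'` from `c` in exactly `n` steps. -/
def ReachesIn {K : Type} [DecidableEq K] {Γ : K → Type} {Λ σ : Type}
    (M : Λ → Turing.TM2.Stmt Γ Λ σ) (c c' : Turing.TM2.Cfg Γ Λ σ) (n : ℕ) : Prop :=
  (flip bind (Turing.TM2.step M))^[n] (some c) = some c'

theorem ReachesIn.trans {K : Type} [DecidableEq K] {Γ : K → Type} {Λ σ : Type}
    {M : Λ → Turing.TM2.Stmt Γ Λ σ} {c c' c'' : Turing.TM2.Cfg Γ Λ σ} {n n' : ℕ}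
    (h : ReachesIn M c c' n) (h' : ReachesIn M c' c'' n') : ReachesIn M c c'' (n + n') := by
  unfold ReachesIn at *
  rw [add_comm, Function.iterate_add_apply, h, h']

theorem ReachesIn.single {K : Type} [DecidableEq K] {Γ : K → Type} {Λ σ : Type}
    {M : Λ → Turing.TM2.Stmt Γ Λ σ} {l : Λ} {v : σ} {S : ∀ k, List (Γ k)}
    {c' : Turing.TM2.Cfg Γ Λ σ} (h : Turing.TM2.stepAux (M l) v S = c') :
    ReachesIn M ⟨some l, v, S⟩ c' 1 := by
  subst h
  rfl

namespace Exec

variable {α β ι : Type} [DecidableEq ι]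

theorem stepAux_popCounter {Λ : Type} (s : Store α β ι) (c : ι) (v : Prog.Reg α)
    (f : Prog.Reg α → Λ) :
    Turing.TM2.stepAux (Prog.popCounter (β := β) c (.goto f)) v s.stk =
      ⟨some (f (decide (s.ctr c ≠ 0), v.2)), (decide (s.ctr c ≠ 0), v.2),
        (s.set c (s.ctr c - 1)).stk⟩ := by
  have h1 : (s.stk (Sum.inl c)).tail = List.replicate (s.ctr c - 1) () :=
    List.tail_replicate
  have h2 : (s.stk (Sum.inl c)).head?.isSome = decide (s.ctr c ≠ 0) := by
    change (List.replicate (s.ctr c) ()).head?.isSome = _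
    rcases s.ctr c with _ | n <;> simp [List.replicate_succ]
  simp only [Prog.popCounter, Turing.TM2.stepAux, h1, h2]
  rw [← Store.update_stk_counter]

theorem stepAux_popCounter_zero {Λ : Type} {s : Store α β ι} {c : ι} (h : s.ctr c = 0)
    (v : Prog.Reg α) (f : Prog.Reg α → Λ) :
    Turing.TM2.stepAux (Prog.popCounter (β := β) c (.goto f)) v s.stk =
      ⟨some (f (false, v.2)), (false, v.2), s.stk⟩ := by
  have : s.set c 0 = s := by
    ext1
    · rfl
    · simp [Store.set, ← h]
    · rfl
  simp [stepAux_popCounter, h, this]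

theorem stepAux_popCounter_succ {Λ : Type} {s : Store α β ι} {c : ι} {n : ℕ}
    (h : s.ctr c = n + 1) (v : Prog.Reg α) (f : Prog.Reg α → Λ) :
    Turing.TM2.stepAux (Prog.popCounter (β := β) c (.goto f)) v s.stk =
      ⟨some (f (true, v.2)), (true, v.2), (s.set c n).stk⟩ := by
  simp [stepAux_popCounter, h]

/-- Each control point is compiled to a statement that the machine executes in one step, so the step
counts agree exactly. The embedding and the exit label are arbitrary because the code of a
subprogram sits inside a larger machine. The register is arbitrary because every branch on it is
preceded by a pop that overwrites the part tested. -/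
theorem reachesIn {p : Prog α β ι} {s s' : Store α β ι} {t : ℕ} (h : Exec p s s' t) :
    ∀ {Λ : Type} (M : Λ → Turing.TM2.Stmt (Prog.StackAlphabet α β ι) Λ (Prog.Reg α))
      (emb : p.Lab → Λ) (ex : Λ), (∀ l, M (emb l) = p.code emb ex l) →
      ∀ v, ∃ v', ReachesIn M ⟨some (emb p.entry), v, s.stk⟩ ⟨some ex, v', s'.stk⟩ t := by
  induction h with
  | skip s =>
    intro Λ M emb ex hM v
    exact ⟨v, .single (by rw [hM]; rfl)⟩
  | inc c s =>
    intro Λ M emb ex hM v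
    refine ⟨v, .single ?_⟩
    rw [hM]
    simp only [Prog.code, Turing.TM2.stepAux]
    rw [← Store.update_stk_counter]
    rfl
  | out b s =>
    intro Λ M emb ex hM v
    refine ⟨v, .single ?_⟩
    rw [hM]
    simp only [Prog.code, Turing.TM2.stepAux]
    exact congrArg _ (Store.update_stk_output s (b :: s.out))
  | @seq p q s s' s'' t t' _ _ ih ih' =>
    intro Λ M emb ex hM v
    obtain ⟨v₁, h₁⟩ := ih M (fun l => emb (Sum.inl l)) (emb (Sum.inr q.entry))
      (fun l => hM (Sum.inl l)) v
    obtain ⟨v₂, h₂⟩ := ih' M (fun l => emb (Sum.inr l)) ex (fun l => hM (Sum.inr l)) v₁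
    exact ⟨v₂, h₁.trans h₂⟩
  | @ifz_zero c p q s s' t h0 _ ih =>
    intro Λ M emb ex hM v
    obtain ⟨v₁, h₁⟩ := ih M (fun l => emb (some (Sum.inl l))) ex
      (fun l => hM (some (Sum.inl l))) (false, v.2)
    refine ⟨v₁, add_comm 1 t ▸ ReachesIn.trans (.single ?_) h₁⟩
    rw [hM]
    exact stepAux_popCounter_zero h0 _ _
  | @ifz_succ c p q s s' t n h0 _ ih =>
    intro Λ M emb ex hM v
    obtain ⟨v₁, h₁⟩ := ih M (fun l => emb (some (Sum.inr l))) ex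
      (fun l => hM (some (Sum.inr l))) (true, v.2)
    refine ⟨v₁, add_comm 1 t ▸ ReachesIn.trans (.single ?_) h₁⟩
    rw [hM]
    exact stepAux_popCounter_succ h0 _ _
  | @while_zero c p s h0 =>
    intro Λ M emb ex hM v
    refine ⟨(false, v.2), .single ?_⟩
    rw [hM]
    exact stepAux_popCounter_zero h0 _ _
  | @while_succ c p s s' s'' t t' n h0 _ _ ih ih' =>
    intro Λ M emb ex hM v
    obtain ⟨v₁, h₁⟩ := ih M (fun l => emb (some l)) (emb none) (fun l => hM (some l)) (true, v.2)
    obtain ⟨v₂, h₂⟩ := ih' M emb ex hM v₁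
    refine ⟨v₂, add_comm 1 (t + t') ▸ ReachesIn.trans (.single ?_) (h₁.trans h₂)⟩
    rw [hM]
    exact stepAux_popCounter_succ h0 _ _
  | @input_nil b s h0 =>
    intro Λ M emb ex hM v
    refine ⟨(v.1, none), .single ?_⟩
    rw [hM]
    have h1 : s.stk (Sum.inr false) = ([] : List α) := h0
    have h2 : Function.update s.stk (Sum.inr false) ([] : List α) = s.stk := by
      rw [Store.update_stk_input, ← h0]
    simp only [Prog.entry, Prog.code, Turing.TM2.stepAux, h1]
    exact congrArg _ h2
  | @input_cons b s s' s'' t t' a l h0 _ _ ih ih' =>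
    intro Λ M emb ex hM v
    obtain ⟨v₁, h₁⟩ := ih M (fun l => emb (some ⟨a, l⟩)) (emb none) (fun l => hM (some ⟨a, l⟩))
      (v.1, some a)
    obtain ⟨v₂, h₂⟩ := ih' M emb ex hM v₁
    refine ⟨v₂, add_comm 1 (t + t') ▸ ReachesIn.trans (.single ?_) (h₁.trans h₂)⟩
    rw [hM]
    have h1 : s.stk (Sum.inr false) = a :: l := h0
    simp only [Prog.entry, Prog.code, Turing.TM2.stepAux, h1]
    exact congrArg _ (Store.update_stk_input s l)

end Exec

/-! ### Upper bounds for running times and rules for loops -/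

/-- `Runs p s s' T`: started in `s`, the program `p` terminates in `s'` after at most `T` steps. -/
def Runs {α β ι : Type} [DecidableEq ι] (p : Prog α β ι) (s s' : Store α β ι) (T : ℕ) : Prop :=
  ∃ t ≤ T, Exec p s s' t

namespace Runs

variable {α β ι : Type} [DecidableEq ι] {p q : Prog α β ι} {s s' s'' : Store α β ι} {c : ι}
  {T T' n : ℕ}

theorem mono (h : Runs p s s' T) (hT : T ≤ T') : Runs p s s' T' :=
  let ⟨t, ht, hx⟩ := h
  ⟨t, ht.trans hT, hx⟩

theorem of_eq {r r' : Store α β ι} (h : Runs p s s' T) (hs : s = r) (hs' : s' = r')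
    (hT : T ≤ T') : Runs p r r' T' := hs ▸ hs' ▸ h.mono hT

theorem skip (s : Store α β ι) : Runs .skip s s 1 := ⟨1, le_rfl, .skip s⟩

theorem inc (c : ι) (s : Store α β ι) : Runs (.inc c) s (s.set c (s.ctr c + 1)) 1 :=
  ⟨1, le_rfl, .inc c s⟩

theorem out (b : β) (s : Store α β ι) : Runs (.out b) s { s with out := b :: s.out } 1 :=
  ⟨1, le_rfl, .out b s⟩

theorem seq (h : Runs p s s' T) (h' : Runs q s' s'' T') : Runs (.seq p q) s s'' (T + T') :=
  let ⟨t, ht, hx⟩ := h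
  let ⟨t', ht', hx'⟩ := h'
  ⟨t + t', add_le_add ht ht', .seq hx hx'⟩

theorem ifz_zero (h0 : s.ctr c = 0) (h : Runs p s s' T) : Runs (.ifz c p q) s s' (T + 1) :=
  let ⟨t, ht, hx⟩ := h
  ⟨t + 1, by omega, .ifz_zero h0 hx⟩

theorem ifz_succ (h0 : s.ctr c = n + 1) (h : Runs q (s.set c n) s' T) :
    Runs (.ifz c p q) s s' (T + 1) :=
  let ⟨t, ht, hx⟩ := h
  ⟨t + 1, by omega, .ifz_succ h0 hx⟩

/-- A loop that counts `c` down from `n`, passing through the memories `S 0, …, S n`. -/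
theorem whileDec (n : ℕ) (S : ℕ → Store α β ι) (hS : ∀ i ≤ n, (S i).ctr c = n - i)
    (h : ∀ i < n, Runs p ((S i).set c (n - i - 1)) (S (i + 1)) T) :
    Runs (.whileDec c p) (S 0) (S n) (n * (T + 1) + 1) := by
  suffices H : ∀ k ≤ n, Runs (.whileDec c p) (S (n - k)) (S n) (k * (T + 1) + 1) by
    simpa using H n le_rfl
  intro k
  induction k with
  | zero =>
    intro _
    exact ⟨1, by omega, .while_zero (by simpa using hS n le_rfl)⟩
  | succ k ih =>
    intro hk
    obtain ⟨t', ht', hx'⟩ := ih (by omega)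
    have e : n - (k + 1) + 1 = n - k := by omega
    obtain ⟨t, ht, hx⟩ := h (n - (k + 1)) (by omega)
    rw [e] at hx
    refine ⟨t + t' + 1, ?_, .while_succ ?_ hx hx'⟩
    · rw [Nat.succ_mul]; omega
    · rw [hS _ (by omega)]; omega

/-- A loop over the input `l`, passing through the memories `S 0, S 1, …`. -/
theorem forInput {b : α → Prog α β ι} (l : List α) (S : ℕ → Store α β ι)
    (hS : ∀ i ≤ l.length, (S i).inp = l.drop i)
    (h : ∀ i (hi : i < l.length),
      Runs (b l[i]) { S i with inp := l.drop (i + 1) } (S (i + 1)) T) :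
    Runs (.forInput b) (S 0) (S l.length) (l.length * (T + 1) + 1) := by
  suffices H : ∀ k ≤ l.length,
      Runs (.forInput b) (S (l.length - k)) (S l.length) (k * (T + 1) + 1) by
    simpa using H l.length le_rfl
  intro k
  induction k with
  | zero =>
    intro _
    exact ⟨1, by omega, .input_nil (by simpa using hS l.length le_rfl)⟩
  | succ k ih =>
    intro hk
    obtain ⟨t', ht', hx'⟩ := ih (by omega)
    have e : l.length - (k + 1) + 1 = l.length - k := by omega
    have hlt : l.length - (k + 1) < l.length := by omega
    obtain ⟨t, ht, hx⟩ := h (l.length - (k + 1)) hlt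
    rw [e] at hx
    refine ⟨t + t' + 1, ?_, .input_cons (a := l[l.length - (k + 1)]) ?_ hx hx'⟩
    · rw [Nat.succ_mul]; omega
    · rw [hS _ (by omega), List.drop_eq_getElem_cons hlt, e]

end Runs

/-! ### Bounds for the memory, and the machine that cleans up and halts -/

namespace Exec

variable {α β ι : Type} [DecidableEq ι]

theorem inp_length_le {p : Prog α β ι} {s s' : Store α β ι} {t : ℕ} (h : Exec p s s' t) :
    s'.inp.length ≤ s.inp.length := by
  induction h with
  | input_cons h0 _ _ ih ih' => rw [h0]; simp only [List.length_cons] at *; omega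
  | seq _ _ ih ih' => exact ih'.trans ih
  | while_succ _ _ _ ih ih' => exact ih'.trans ih
  | ifz_zero _ _ ih => exact ih
  | ifz_succ _ _ ih => exact ih
  | _ => exact le_rfl

/-- A step raises at most one counter, and by one. The running time therefore bounds the cost of
emptying the counters at the end. -/
theorem sum_ctr_le [Fintype ι] {p : Prog α β ι} {s s' : Store α β ι} {t : ℕ}
    (h : Exec p s s' t) : ∑ c, s'.ctr c ≤ ∑ c, s.ctr c + t := by
  have key : ∀ (s : Store α β ι) (c : ι) (v : ℕ),
      ∑ d, (s.set c v).ctr d + s.ctr c = ∑ d, s.ctr d + v := by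
    intro s c v
    rw [← Finset.add_sum_erase _ _ (Finset.mem_univ c),
      ← Finset.add_sum_erase _ s.ctr (Finset.mem_univ c),
      Finset.sum_congr rfl (g := s.ctr)]
    · simp [Store.ctr_set]; ring
    · intro d hd
      simp [Store.ctr_set, Finset.ne_of_mem_erase hd]
  induction h with
  | inc c s => have := key s c (s.ctr c + 1); omega
  | @ifz_succ c _ _ s _ _ n _ _ _ => have := key s c n; omega
  | @while_succ c _ s _ _ _ _ n _ _ _ _ _ => have := key s c n; omega
  | seq _ _ ih ih' => omega
  | ifz_zero _ _ ih => omega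
  | input_cons _ _ _ ih ih' => simp only at ih; omega
  | _ => exact Nat.le_add_right _ _

end Exec

namespace Prog

variable {α β ι : Type} [DecidableEq ι]

/-- Empty the given counters. -/
def clearCounters : List ι → Prog α β ι
  | [] => skip
  | c :: l => seq (whileDec c skip) (clearCounters l)

theorem runs_clear (c : ι) (s : Store α β ι) :
    Runs (whileDec c skip) s (s.set c 0) (s.ctr c * 2 + 1) := by
  have h := Runs.whileDec (c := c) (p := skip) (T := 1) (s.ctr c)
    (fun i => s.set c (s.ctr c - i)) (by intro i _; simp [Store.ctr_set])
    (by
      intro i _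
      convert Runs.skip (α := α) (β := β) (ι := ι) _ using 1
      simp [Store.set, Nat.sub_sub])
  simpa [Store.set] using h

theorem runs_clearCounters [Fintype ι] (l : List ι) (s : Store α β ι) :
    Runs (clearCounters l) s { s with ctr := fun c => if c ∈ l then 0 else s.ctr c }
      (l.length * (2 * (∑ c, s.ctr c) + 1) + 1) := by
  induction l generalizing s with
  | nil => exact ⟨1, by simp, by simpa [clearCounters] using Exec.skip s⟩
  | cons c l ih =>
    have h := (runs_clear c s).seq (ih (s.set c 0))
    have h1 : s.ctr c ≤ ∑ d, s.ctr d :=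
      Finset.single_le_sum (f := s.ctr) (fun _ _ => Nat.zero_le _) (Finset.mem_univ c)
    have h2 : ∑ d, (s.set c 0).ctr d ≤ ∑ d, s.ctr d :=
      Finset.sum_le_sum fun d _ => by rw [Store.ctr_set]; split_ifs <;> simp
    have h3 : (⟨s.inp, fun d => if d ∈ l then 0 else (s.set c 0).ctr d, s.out⟩ : Store α β ι) =
        { s with ctr := fun d => if d ∈ c :: l then 0 else s.ctr d } := by
      ext1
      · rfl
      · funext d
        by_cases hd : d = c <;> simp [Store.ctr_set, hd]
      · rfl
    refine h3 ▸ h.mono ?_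
    · rw [List.length_cons, add_mul l.length 1]
      have := Nat.mul_le_mul_left l.length (Nat.add_le_add_right (Nat.mul_le_mul_left 2 h2) 1)
      omega

theorem runs_drain (s : Store α β ι) :
    Runs (forInput fun _ => skip) s { s with inp := [] } (s.inp.length * 2 + 1) := by
  have h := Runs.forInput (b := fun _ => skip) (T := 1) s.inp
    (fun i => { s with inp := s.inp.drop i }) (fun _ _ => rfl) (fun _ _ => Runs.skip _)
  simpa using h

/-- The machine that runs a program and halts. -/
noncomputable def toFinTM2 [Fintype α] [Fintype ι] (p : Prog α β ι) : Turing.FinTM2 where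
  K := ι ⊕ Bool
  k₀ := Sum.inr false
  k₁ := Sum.inr true
  Γ := StackAlphabet α β ι
  Λ := Option p.Lab
  main := some p.entry
  ΛFin := have := p.finite_lab; Fintype.ofFinite _
  σ := Reg α
  initialState := (false, none)
  Γk₀Fin := inferInstanceAs (Fintype α)
  m := fun l => match l with
    | some l => p.code some none l
    | none => .load (fun _ => (false, none)) .halt

end Prog

/-- A function computed by a program in polynomial time is computable in polynomial time. -/
theorem polyTimeComputable_of_runs {α β ι X Y : Type} [Fintype α] [Fintype ι] [DecidableEq ι]
    (ea : X → List α) (eb : Y → List β) (f : X → Y) (p : Prog α β ι) (Q : Polynomial ℕ)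
    (h : ∀ a, ∃ s', Runs p ⟨ea a, fun _ => 0, []⟩ s' (Q.eval (ea a).length) ∧
      s'.out = eb (f a)) : PolyTimeComputable ea eb f := by
  classical
  set l : List ι := Finset.univ.toList with hl
  -- A halting configuration must have all stacks empty except the output, so the rest of the input
  -- and the counters are discarded.
  set p' := Prog.seq p (Prog.seq (.forInput fun _ => .skip) (Prog.clearCounters l)) with hp'
  -- The last summand pays for the step that resets the register and halts.
  set Q' : Polynomial ℕ := Q + (2 * Polynomial.X + 1 +
    (Polynomial.C l.length * (2 * Q + 1) + 1)) + 1 with hQ'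
  have key : ∀ a, Runs p' ⟨ea a, fun _ => 0, []⟩ ⟨[], fun _ => 0, eb (f a)⟩
      (Q'.eval (ea a).length - 1) := by
    intro a
    obtain ⟨s', ⟨t, ht, hx⟩, hout⟩ := h a
    have h1 := hx.inp_length_le
    have h2 := hx.sum_ctr_le
    simp only [Finset.sum_const_zero, zero_add] at h1 h2
    have h3 := (Runs.seq ⟨t, le_rfl, hx⟩
      ((Prog.runs_drain s').seq (Prog.runs_clearCounters l { s' with inp := [] })))
    convert h3.mono (T' := Q'.eval (ea a).length - 1) ?_ using 1
    · ext1
      · rfl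
      · funext c; simp [hl]
      · exact hout.symm
    · simp only [hQ', Polynomial.eval_add, Polynomial.eval_mul, Polynomial.eval_one,
        Polynomial.eval_X, Polynomial.eval_C, Polynomial.eval_ofNat, Nat.add_sub_cancel]
      have h4 := h2.trans ht
      have := Nat.mul_le_mul_left l.length (Nat.add_le_add_right (Nat.mul_le_mul_left 2 h4) 1)
      omega
  refine ⟨{ tm := p'.toFinTM2, inputAlphabet := Equiv.refl α, outputAlphabet := Equiv.refl β,
            time := Q', outputsFun := fun a => ?_ }⟩
  choose t ht hx using key
  refine ⟨⟨t a + 1, ?_⟩, ?_⟩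
  · obtain ⟨v', hv⟩ := (hx a).reachesIn p'.toFinTM2.m some none (fun _ => rfl) (false, none)
    have hfin := hv.trans (ReachesIn.single (M := p'.toFinTM2.m) (l := none) rfl)
    have e1 : Turing.initList p'.toFinTM2 (List.map (Equiv.refl α).invFun (ea a)) =
        ⟨some (some p'.entry), (false, none), Store.stk ⟨ea a, fun _ => 0, []⟩⟩ := by
      unfold Turing.initList
      congr 1
      funext k
      rcases k with c | _ | _
      · rw [dif_neg (by exact Sum.inl_ne_inr)]; rfl
      · rw [dif_pos (by rfl)]; exact List.map_id _
      · rw [dif_neg (fun h => by cases h)]; rfl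
    have e2 : Turing.haltList p'.toFinTM2 (List.map (Equiv.refl β).invFun (eb (f a))) =
        ⟨none, (false, none), Store.stk ⟨[], fun _ => 0, eb (f a)⟩⟩ := by
      unfold Turing.haltList
      congr 1
      funext k
      rcases k with c | _ | _
      · rw [dif_neg (by exact Sum.inl_ne_inr)]; rfl
      · rw [dif_neg (fun h => by cases h)]; rfl
      · rw [dif_pos (by rfl)]; exact List.map_id _
    have hgoal : (flip bind p'.toFinTM2.step)^[t a + 1]
        (some (Turing.initList p'.toFinTM2 (List.map (Equiv.refl α).invFun (ea a)))) =
        some (Turing.haltList p'.toFinTM2 (List.map (Equiv.refl β).invFun (eb (f a)))) := by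
      rw [e1, e2]
      exact hfin
    exact hgoal
  · have h1 := ht a
    have h2 : 1 ≤ Q'.eval (ea a).length := by
      simp only [hQ', Polynomial.eval_add, Polynomial.eval_one]
      omega
    change t a + 1 ≤ _
    omega

/-! ### Polynomials and gate lists -/

/-- The counters of the programs below. -/
inductive Ctr : Type
  | len | cur | prev | del | acc | t1 | t2
  deriving DecidableEq

instance : Fintype Ctr :=
  ⟨{.len, .cur, .prev, .del, .acc, .t1, .t2}, fun c => by cases c <;> decide⟩

namespace Prog

variable {α β : Type}

theorem runs_move {ι : Type} [DecidableEq ι] {c d : ι} (h : c ≠ d) (s : Store α β ι) :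
    Runs (whileDec c (inc d)) s ((s.set c 0).set d (s.ctr d + s.ctr c)) (s.ctr c * 2 + 1) := by
  have H := Runs.whileDec (c := c) (p := inc d) (T := 1) (s.ctr c)
    (fun i => (s.set c (s.ctr c - i)).set d (s.ctr d + i))
    (by intro i _; simp [Store.ctr_set, h])
    (by
      intro i _
      refine (Runs.inc d _).of_eq rfl ?_ le_rfl
      ext1
      · rfl
      · funext e
        by_cases h1 : e = d <;> by_cases h2 : e = c <;>
          simp_all [Store.ctr_set, Nat.sub_sub, add_assoc]
      · rfl)
  refine H.of_eq ?_ (by simp) le_rfl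
  ext1
  · rfl
  · funext e
    by_cases h1 : e = d <;> by_cases h2 : e = c <;> simp_all [Store.ctr_set]
  · rfl

/-- Multiply the counter `acc` by `len`. -/
def mulLen : Prog α β Ctr :=
  seq (whileDec .acc (seq (whileDec .len (seq (inc .t1) (inc .t2))) (whileDec .t2 (inc .len))))
    (whileDec .t1 (inc .acc))

/-- For each unit of `acc`, the counter `len` is emptied into both `t1` and `t2` and then restored
from `t2`. The product accumulates in `t1` and is moved to `acc` at the end. -/
theorem runs_mulLen (s : Store α β Ctr) (h1 : s.ctr .t1 = 0) (h2 : s.ctr .t2 = 0) :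
    Runs mulLen s (s.set .acc (s.ctr .acc * s.ctr .len))
      (s.ctr .acc * (s.ctr .len * 7 + 3) + 2) := by
  set N := s.ctr .len with hN
  set m := s.ctr .acc with hm
  have inner : ∀ s' : Store α β Ctr, s'.ctr .t2 = 0 → s'.ctr .len = N →
      Runs (seq (whileDec .len (seq (inc .t1) (inc .t2))) (whileDec .t2 (inc .len))) s'
        (s'.set .t1 (s'.ctr .t1 + N)) (N * 5 + 2) := by
    intro s' h2' hN'
    have H := Runs.whileDec (c := .len) (p := seq (inc .t1) (inc .t2)) (T := 2) N
      (fun i => ((s'.set .len (N - i)).set .t1 (s'.ctr .t1 + i)).set .t2 i)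
      (by intro i _; simp [Store.ctr_set])
      (by
        intro i _
        refine ((Runs.inc Ctr.t1 _).seq (Runs.inc Ctr.t2 _)).of_eq rfl ?_ le_rfl
        ext1
        · rfl
        · funext e; cases e <;> simp [Store.ctr_set, Nat.sub_sub, add_assoc]
        · rfl)
    have H' := H.seq (runs_move (c := .t2) (d := .len) (by decide) _)
    refine H'.of_eq ?_ ?_ ?_
    · ext1
      · rfl
      · funext e; cases e <;> simp [Store.ctr_set, h2', hN']
      · rfl
    · ext1
      · rfl
      · funext e; cases e <;> simp [Store.ctr_set, h2', hN']
      · rfl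
    · simp [Store.ctr_set]; omega
  have H := Runs.whileDec (c := .acc)
    (p := seq (whileDec .len (seq (inc .t1) (inc .t2))) (whileDec .t2 (inc .len)))
    (T := N * 5 + 2) m (fun i => (s.set .acc (m - i)).set .t1 (i * N))
    (by intro i _; simp [Store.ctr_set])
    (by
      intro i _
      refine (inner _ ?_ ?_).of_eq rfl ?_ le_rfl
      rotate_left 2
      · ext1
        · rfl
        · funext e; cases e <;> simp [Store.ctr_set, Nat.sub_sub, Nat.succ_mul]
        · rfl
      · simp [Store.ctr_set, h2]
      · simp [Store.ctr_set, hN])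
  have H' := H.seq (runs_move (c := .t1) (d := .acc) (by decide) _)
  refine H'.of_eq ?_ ?_ ?_
  · ext1
    · rfl
    · funext e; cases e <;> simp [Store.ctr_set, h1, hm]
    · rfl
  · ext1
    · rfl
    · funext e; cases e <;> simp [Store.ctr_set, h1]
    · rfl
  · simp [Store.ctr_set]; ring_nf; omega

/-- Run a program `n` times. -/
def rep {ι : Type} (p : Prog α β ι) : ℕ → Prog α β ι
  | 0 => skip
  | n + 1 => seq p (rep p n)

theorem runs_rep_inc {ι : Type} [DecidableEq ι] (c : ι) (n : ℕ) (s : Store α β ι) :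
    Runs (rep (inc c) n) s (s.set c (s.ctr c + n)) (n + 1) := by
  induction n generalizing s with
  | zero => simpa [rep, Store.set] using Runs.skip s
  | succ n ih =>
    refine ((Runs.inc c s).seq (ih _)).of_eq rfl ?_ (by omega)
    simp [Store.set, add_assoc, add_comm 1 n]

theorem runs_rep_out {ι : Type} [DecidableEq ι] (b : β) (n : ℕ) (s : Store α β ι) :
    Runs (rep (out b) n) s { s with out := List.replicate n b ++ s.out } (n + 1) := by
  induction n generalizing s with
  | zero => simpa [rep] using Runs.skip s
  | succ n ih =>
    refine ((Runs.out b s).seq (ih _)).of_eq rfl ?_ (by omega)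
    simp [List.replicate_succ']

/-- Polynomials can be evaluated at the counter `len` in polynomial time. -/
theorem exists_runs_eval (q : Polynomial ℕ) : ∃ (p : Prog α β Ctr) (T : Polynomial ℕ),
    ∀ s : Store α β Ctr, s.ctr .acc = 0 → s.ctr .t1 = 0 → s.ctr .t2 = 0 →
      Runs p s (s.set .acc (q.eval (s.ctr .len))) (T.eval (s.ctr .len)) := by
  -- Horner's scheme: a constant is added by a fixed number of increments, and a factor `X` is one
  -- multiplication by `len`.
  induction q using Polynomial.recOnHorner with
  | M0 =>
    refine ⟨skip, 1, fun s h _ _ => ?_⟩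
    have : s.set .acc 0 = s := by simp [Store.set, ← h]
    simpa [this] using Runs.skip s
  | MC q a _ _ ih =>
    obtain ⟨p, T, hp⟩ := ih
    refine ⟨seq p (rep (inc .acc) a), T + Polynomial.C (a + 1), fun s h h1 h2 => ?_⟩
    have H := (hp s h h1 h2).seq (runs_rep_inc .acc a _)
    simpa [Store.ctr_set, Store.set] using H
  | MX q _ ih =>
    obtain ⟨p, T, hp⟩ := ih
    refine ⟨seq p mulLen, T + (q * (Polynomial.X * 7 + 3) + 2), fun s h h1 h2 => ?_⟩
    have H := (hp s h h1 h2).seq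
      (runs_mulLen _ (by simp [Store.ctr_set, h1]) (by simp [Store.ctr_set, h2]))
    simpa [Store.ctr_set, Store.set] using H

end Prog

/-- A gate `T` or `CZ` on qubits labelled by `κ`. -/
inductive QGate (κ : Type) : Type
  | T (j : κ) : QGate κ
  | CZ (j k : κ) : QGate κ

/-- Relabel the qubits of a gate. -/
def QGate.map {κ κ' : Type} (f : κ → κ') : QGate κ → QGate κ'
  | T j => T (f j)
  | CZ j k => CZ (f j) (f k)

/-- The description of a gate on numbered qubits. -/
def QGate.encode : QGate ℕ → List CircuitSymbol
  | T j => CircuitSymbol.gateT :: encodeUnary j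
  | CZ j k => CircuitSymbol.gateCZ :: (encodeUnary j ++ encodeUnary k)

/-- The position of a block of qubits relative to the current block: the current block, the one
before it, or the one a fixed delay before it. -/
inductive Shift : Type
  | cur | prev | del

/-- The counter that holds the number of a block. -/
def Shift.toCtr : Shift → Ctr
  | cur => .cur
  | prev => .prev
  | del => .del

/-- The number of a qubit, given by its block and its place in the block. Blocks consist of `B`
qubits, and `pos` gives the numbers of the blocks. -/
def qubitIndex (B : ℕ) (pos : Shift → ℕ) (l : Shift × ℕ) : ℕ := l.2 + B * pos l.1

namespace Prog

variable {α : Type}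

/-- Output the number of a qubit in unary. -/
def emitUnary (B : ℕ) (l : Shift × ℕ) : Prog α CircuitSymbol Ctr :=
  seq (out .sep) (seq (rep (out .tally) l.2)
    (seq (whileDec l.1.toCtr (seq (inc .t2) (rep (out .tally) B)))
      (whileDec .t2 (inc l.1.toCtr))))

/-- The output is a stack, so every word is written from right to left, the separator first. The
loop destroys the block counter, and `t2` keeps a copy from which it is restored. -/
theorem runs_emitUnary (B : ℕ) (l : Shift × ℕ) (s : Store α CircuitSymbol Ctr)
    (h2 : s.ctr .t2 = 0) :
    Runs (emitUnary B l) s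
      { s with out := encodeUnary (qubitIndex B (fun i => s.ctr i.toCtr) l) ++ s.out }
      ((B + l.2 + 10) * (s.ctr l.1.toCtr + 1)) := by
  obtain ⟨sh, o⟩ := l
  have hne : Ctr.t2 ≠ sh.toCtr := by cases sh <;> decide
  have hne' : sh.toCtr ≠ Ctr.t2 := hne.symm
  set n := s.ctr sh.toCtr with hn
  set w : List CircuitSymbol := List.replicate o .tally ++ .sep :: s.out with hw
  have H := Runs.whileDec (c := sh.toCtr) (p := seq (inc .t2) (rep (out .tally) B))
    (T := 1 + (B + 1)) n
    (fun i => { (s.set sh.toCtr (n - i)).set .t2 i with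
      out := List.replicate (B * i) .tally ++ w })
    (by intro i _; simp only; rw [Store.ctr_set, if_neg hne', Store.ctr_set, if_pos rfl])
    (by
      intro i _
      refine ((Runs.inc Ctr.t2 _).seq (runs_rep_out CircuitSymbol.tally B _)).of_eq rfl ?_ le_rfl
      ext1
      · rfl
      · funext e
        by_cases h3 : e = .t2 <;> by_cases h4 : e = sh.toCtr <;>
          simp_all [Store.set, Nat.sub_sub]
      · simp only [mul_add, mul_one, add_comm (B * i) B, List.replicate_add, List.append_assoc,
          Store.out_set])
  have H' := (Runs.out .sep s).seq ((runs_rep_out .tally o _).seq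
    ((H.of_eq ?_ rfl le_rfl).seq (runs_move hne _)))
  refine H'.of_eq rfl ?_ ?_
  · ext1
    · rfl
    · funext e
      by_cases h3 : e = .t2 <;> by_cases h4 : e = sh.toCtr <;>
        simp_all [Store.set]
    · simp only [encodeUnary, qubitIndex, hw, Store.out_set, ← hn, add_comm o, List.replicate_add,
        List.append_assoc, List.singleton_append]
  · simp only [Store.ctr_set]
    simp
    nlinarith
  · ext1
    · rfl
    · funext e
      by_cases h3 : e = .t2 <;> by_cases h4 : e = sh.toCtr <;>
        simp_all [Store.set]
    · simp [hw]

/-- Output a gate. -/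
def emitGate (B : ℕ) : QGate (Shift × ℕ) → Prog α CircuitSymbol Ctr
  | .T j => seq (emitUnary B j) (out .gateT)
  | .CZ j k => seq (emitUnary B k) (seq (emitUnary B j) (out .gateCZ))

/-- The block size and the gate do not depend on the input of the reduction. They go into the
constant `K`, and only the block numbers, bounded by `V`, vary. -/
theorem exists_runs_emitGate (B : ℕ) (g : QGate (Shift × ℕ)) :
    ∃ K, ∀ (s : Store α CircuitSymbol Ctr) (V : ℕ), s.ctr .t2 = 0 →
      (∀ i : Shift, s.ctr i.toCtr ≤ V) →
      Runs (emitGate B g) s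
        { s with out := (g.map (qubitIndex B fun i => s.ctr i.toCtr)).encode ++ s.out }
        (K * (V + 1)) := by
  cases g with
  | T j =>
    refine ⟨B + j.2 + 10 + 1, fun s V h2 hV => ?_⟩
    have H := (runs_emitUnary B j s h2).seq (Runs.out .gateT _)
    refine H.mono ?_
    have := Nat.mul_le_mul_left (B + j.2 + 10) (Nat.add_le_add_right (hV j.1) 1)
    rw [add_mul _ 1]
    omega
  | CZ j k =>
    refine ⟨(B + k.2 + 10) + ((B + j.2 + 10) + 1), fun s V h2 hV => ?_⟩
    have H := (runs_emitUnary B k s h2).seq ((runs_emitUnary B j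
      { s with out := encodeUnary (qubitIndex B (fun i => s.ctr i.toCtr) k) ++ s.out } h2).seq
        (Runs.out .gateCZ _))
    refine H.of_eq rfl ?_ ?_
    · simp [QGate.map, QGate.encode]
    · have h3 := Nat.mul_le_mul_left (B + j.2 + 10) (Nat.add_le_add_right (hV j.1) 1)
      have h4 := Nat.mul_le_mul_left (B + k.2 + 10) (Nat.add_le_add_right (hV k.1) 1)
      rw [add_mul (B + k.2 + 10), add_mul _ 1]
      simp only
      omega

/-- Output a list of gates. -/
def emitGates (B : ℕ) : List (QGate (Shift × ℕ)) → Prog α CircuitSymbol Ctr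
  | [] => skip
  | g :: l => seq (emitGates B l) (emitGate B g)

theorem exists_runs_emitGates (B : ℕ) (l : List (QGate (Shift × ℕ))) :
    ∃ K, ∀ (s : Store α CircuitSymbol Ctr) (V : ℕ), s.ctr .t2 = 0 →
      (∀ i : Shift, s.ctr i.toCtr ≤ V) →
      Runs (emitGates B l) s
        { s with
          out := (l.map (QGate.map (qubitIndex B fun i => s.ctr i.toCtr))).flatMap QGate.encode ++
            s.out }
        (K * (V + 1)) := by
  induction l with
  | nil => exact ⟨1, fun s V _ _ => by simpa [emitGates] using (Runs.skip s).mono (by omega)⟩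
  | cons g l ih =>
    obtain ⟨K, hK⟩ := ih
    obtain ⟨K', hK'⟩ := exists_runs_emitGate (α := α) B g
    refine ⟨K + K', fun s V h2 hV => ?_⟩
    have H := (hK s V h2 hV).seq (hK' _ V h2 hV)
    rw [add_mul]
    simpa [emitGates] using H

end Prog

/-! ### Generating a sequence of blocks of gates -/

/-- The role of a cell in the sequence of cells. -/
inductive CellStage : Type
  | first | inp (b : Bool) | sep | free | blank | later

/-- The role of the cell `k`: a first cell, the cells that hold the string `x`, a separator, `q`
free cells, and blank cells are initial cells; the remaining cells start at `D`. -/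
def cellStage (x : List Bool) (q D k : ℕ) : CellStage :=
  if k = 0 then .first
  else if h : k - 1 < x.length then .inp x[k - 1]
  else if k = x.length + 1 then .sep
  else if k < x.length + 2 + q then .free
  else if k < D then .blank
  else .later

/-- The blocks to which the gates of the block `k` refer. -/
def blockPos (D k : ℕ) : Shift → ℕ
  | .cur => k
  | .prev => k - 1
  | .del => k - D

/-- The gates of the first blocks, the last block first. -/
def blockGates (B D : ℕ) (τ : ℕ → List (QGate (Shift × ℕ))) : ℕ → List (QGate ℕ)
  | 0 => []
  | k + 1 => (τ k).map (QGate.map (qubitIndex B (blockPos D k))) ++ blockGates B D τ k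

namespace Prog

variable {α : Type}

/-- The memory after the first `k` blocks have been written. -/
def blockStore (B D : ℕ) (τ : ℕ → List (QGate (Shift × ℕ))) (k N a : ℕ) (l : List α) :
    Store α CircuitSymbol Ctr where
  inp := l
  ctr := fun c => match c with
    | .len => N
    | .cur => k
    | .prev => k - 1
    | .del => k - D
    | .acc => a
    | .t1 => 0
    | .t2 => 0
  out := (blockGates B D τ k).flatMap QGate.encode

theorem exists_runs_emit_blockStore (B : ℕ) (l : List (QGate (Shift × ℕ))) :
    ∃ K, ∀ (D : ℕ) (τ : ℕ → List (QGate (Shift × ℕ))) (k N a : ℕ) (w : List α),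
      Runs (emitGates B l) (blockStore B D τ k N a w)
        { blockStore B D τ k N a w with
          out := (l.map (QGate.map (qubitIndex B (blockPos D k))) ++ blockGates B D τ k).flatMap
            QGate.encode }
        (K * (k + 1)) := by
  obtain ⟨K, hK⟩ := exists_runs_emitGates (α := α) B l
  refine ⟨K, fun D τ k N a w => ?_⟩
  refine (hK (blockStore B D τ k N a w) k rfl ?_).of_eq rfl ?_ le_rfl
  · rintro (_ | _ | _) <;> simp [blockStore, Shift.toCtr]
  · have : (fun i : Shift => (blockStore B D τ k N a w).ctr i.toCtr) = blockPos D k := by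
      funext i
      cases i <;> rfl
    rw [this, List.flatMap_append]
    rfl

/-- Write a block of gates and advance the given counters. -/
def writeBlock (B : ℕ) (l : List (QGate (Shift × ℕ))) : List Ctr → Prog α CircuitSymbol Ctr
  | [] => emitGates B l
  | c :: cs => seq (writeBlock B l cs) (inc c)

/-- The counters `prev` and `del` hold the truncated differences k - 1 and k - D. Truncation means
that they start to advance only at k = 1 and at k = D, respectively, which is what the three lists
of counters express. -/
theorem exists_runs_writeBlock (B : ℕ) (l : List (QGate (Shift × ℕ))) :
    ∃ K, ∀ (D : ℕ) (τ : ℕ → List (QGate (Shift × ℕ))) (k N a : ℕ) (w : List α) (cs : List Ctr),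
      τ k = l →
      cs = (if k = 0 then [.cur] else if k < D then [.prev, .cur] else [.del, .prev, .cur]) →
      0 < D →
      Runs (writeBlock B l cs) (blockStore B D τ k N a w) (blockStore B D τ (k + 1) N a w)
        (K * (k + 1) + 3) := by
  obtain ⟨K, hK⟩ := exists_runs_emit_blockStore (α := α) B l
  refine ⟨K, fun D τ k N a w cs hl hcs hD => ?_⟩
  have H := hK D τ k N a w
  have e : l.map (QGate.map (qubitIndex B (blockPos D k))) ++ blockGates B D τ k =
      blockGates B D τ (k + 1) := by
    rw [← hl]; rfl
  rw [e] at H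
  by_cases hk : k = 0
  · rw [if_pos hk] at hcs
    subst hcs
    refine (H.seq (Runs.inc Ctr.cur _)).of_eq rfl ?_ ?_
    rotate_left
    · omega
    ext1
    · rfl
    · funext c
      cases c <;> simp [Store.ctr_set, blockStore] <;> omega
    · rfl
  rw [if_neg hk] at hcs
  by_cases hk' : k < D
  · rw [if_pos hk'] at hcs
    subst hcs
    refine ((H.seq (Runs.inc Ctr.cur _)).seq (Runs.inc Ctr.prev _)).of_eq rfl ?_ ?_
    rotate_left
    · omega
    ext1
    · rfl
    · funext c
      cases c <;> simp [Store.ctr_set, blockStore] <;> omega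
    · rfl
  · rw [if_neg hk'] at hcs
    subst hcs
    refine (((H.seq (Runs.inc Ctr.cur _)).seq (Runs.inc Ctr.prev _)).seq
      (Runs.inc Ctr.del _)).of_eq rfl ?_ ?_
    rotate_left
    · omega
    ext1
    · rfl
    · funext c
      cases c <;> simp [Store.ctr_set, blockStore] <;> omega
    · rfl

/-- The program that writes a circuit made of blocks. -/
def generator (B : ℕ) (tpl : CellStage → List (QGate (Shift × ℕ)))
    (fin : List (QGate (Shift × ℕ))) (pq pR pZ pn : Prog Bool CircuitSymbol Ctr) :
    Prog Bool CircuitSymbol Ctr :=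
  seq (writeBlock B (tpl .first) [.cur]) <|
  seq (forInput fun b => seq (writeBlock B (tpl (.inp b)) [.prev, .cur]) (inc .len)) <|
  seq (writeBlock B (tpl .sep) [.prev, .cur]) <|
  seq pq <|
  seq (whileDec .acc (writeBlock B (tpl .free) [.prev, .cur])) <|
  seq pR <|
  seq (whileDec .acc (writeBlock B (tpl .blank) [.prev, .cur])) <|
  seq pZ <|
  seq (whileDec .acc (writeBlock B (tpl .later) [.del, .prev, .cur])) <|
  seq (emitGates B fin) <|
  seq (out .sep) <|
  seq pn (whileDec .acc (out .tally))

theorem runs_while_writeBlock {B D : ℕ} {τ : ℕ → List (QGate (Shift × ℕ))} {k m N V K : ℕ}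
    {w : List α} {l : List (QGate (Shift × ℕ))} {cs : List Ctr}
    (hK : ∀ i a, k ≤ i → i < k + m →
      Runs (writeBlock B l cs) (blockStore B D τ i N a w) (blockStore B D τ (i + 1) N a w)
        (K * (i + 1) + 3)) (hV : k + m ≤ V) :
    Runs (whileDec .acc (writeBlock B l cs)) (blockStore B D τ k N m w)
      (blockStore B D τ (k + m) N 0 w) (V * (K * (V + 1) + 4) + 1) := by
  have H := Runs.whileDec (c := .acc) (p := writeBlock B l cs) (T := K * (V + 1) + 3) m
    (fun i => blockStore B D τ (k + i) N (m - i) w) (fun i _ => rfl)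
    (by
      intro i hi
      refine (hK (k + i) (m - i - 1) (by omega) (by omega)).of_eq ?_ ?_ ?_
      · ext1
        · rfl
        · funext c
          cases c <;> simp [Store.ctr_set, blockStore]
        · rfl
      · rw [Nat.sub_sub]; rfl
      · have := Nat.mul_le_mul_left K (show k + i + 1 ≤ V + 1 by omega)
        omega)
  refine H.of_eq rfl (by simp) ?_
  have := Nat.mul_le_mul_right (K * (V + 1) + 4) (show m ≤ V by omega)
  simpa using this

theorem exists_runs_eval_blockStore (q : Polynomial ℕ) :
    ∃ (p : Prog α CircuitSymbol Ctr) (T : Polynomial ℕ),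
      ∀ (B D : ℕ) (τ : ℕ → List (QGate (Shift × ℕ))) (k N : ℕ) (w : List α) (v : List _),
        Runs p { blockStore B D τ k N 0 w with out := v }
          { blockStore B D τ k N (q.eval N) w with out := v } (T.eval N) := by
  obtain ⟨p, T, hp⟩ := exists_runs_eval (α := α) (β := CircuitSymbol) q
  refine ⟨p, T, fun B D τ k N w v => (hp _ rfl rfl rfl).of_eq rfl ?_ le_rfl⟩
  ext1
  · rfl
  · funext c
    cases c <;> simp [Store.ctr_set, blockStore]
  · rfl

/-- A block depends on its position only through its stage and the numbers of the blocks it refers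
to, so a loop per stage suffices. The loop over the input also counts the input in `len`; afterwards
the lengths of the other loops are polynomials in `len`. Since the output grows at its front, the
final gates follow the blocks and the number of qubits is written last. -/
theorem exists_generator (B : ℕ) (tpl : CellStage → List (QGate (Shift × ℕ)))
    (fin : List (QGate (Shift × ℕ))) (q R Z n : Polynomial ℕ) :
    ∃ (p : Prog Bool CircuitSymbol Ctr) (Q : Polynomial ℕ), ∀ (x : List Bool) (D P : ℕ),
      D = x.length + 2 + q.eval x.length + R.eval x.length → P = D + Z.eval x.length →
      ∃ s', Runs p ⟨x, fun _ => 0, []⟩ s' (Q.eval x.length) ∧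
        s'.out = encodeUnary (n.eval x.length) ++
          (fin.map (QGate.map (qubitIndex B (blockPos D P))) ++
            blockGates B D (fun k => tpl (cellStage x (q.eval x.length) D k)) P).flatMap
              QGate.encode := by
  obtain ⟨pq, Tq, hq⟩ := exists_runs_eval_blockStore (α := Bool) q
  obtain ⟨pR, TR, hR⟩ := exists_runs_eval_blockStore (α := Bool) R
  obtain ⟨pZ, TZ, hZ⟩ := exists_runs_eval_blockStore (α := Bool) Z
  obtain ⟨pn, Tn, hn⟩ := exists_runs_eval_blockStore (α := Bool) n
  choose K hK using fun st => exists_runs_writeBlock (α := Bool) B (tpl st)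
  obtain ⟨Kf, hf⟩ := exists_runs_emit_blockStore (α := Bool) B fin
  set Ki := K (.inp true) + K (.inp false) with hKi
  -- The total number of blocks as a polynomial in the input length; it bounds every block number in
  -- the time estimate.
  let P' : Polynomial ℕ := Polynomial.X + 2 + q + R + Z
  refine ⟨generator B tpl fin pq pR pZ pn,
    Polynomial.C (K .first + 3) + (Polynomial.X * (Polynomial.C Ki * (P' + 1) + 4 + 1) + 1 +
      (Polynomial.C (K .sep) * (P' + 1) + 3 + (Tq + (P' * (Polynomial.C (K .free) * (P' + 1) + 4) + 1
      + (TR + (P' * (Polynomial.C (K .blank) * (P' + 1) + 4) + 1 + (TZ +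
      (P' * (Polynomial.C (K .later) * (P' + 1) + 4) + 1 + (Polynomial.C Kf * (P' + 1) +
      (1 + (Tn + (n * 2 + 1)))))))))))), fun x D P hD hP => ?_⟩
  set N := x.length with hN
  set τ := fun k => tpl (cellStage x (q.eval N) D k) with hτ
  set V := P'.eval N with hVdef
  have hV : V = P := by
    simp only [hVdef, P', Polynomial.eval_add, Polynomial.eval_X, Polynomial.eval_ofNat, hP, hD]
  have hD0 : 0 < D := by omega
  -- the first cell
  have h1 := hK .first D τ 0 0 0 x [.cur] rfl rfl hD0
  -- the cells that hold the input
  have h2 := Runs.forInput (b := fun b => seq (writeBlock B (tpl (.inp b)) [.prev, .cur])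
      (inc .len)) (T := Ki * (V + 1) + 4) x
    (fun i => blockStore B D τ (1 + i) i 0 (x.drop i)) (fun i _ => rfl)
    (by
      intro i hi
      have hst : cellStage x (q.eval N) D (1 + i) = .inp x[i] := by
        simp [cellStage, hi]
      have H := (hK (.inp x[i]) D τ (1 + i) i 0 (x.drop (i + 1)) [.prev, .cur]
        (by rw [hτ]; simp only [hst]) (by rw [if_neg (by omega), if_pos (by omega)]) hD0).seq
          (Runs.inc Ctr.len _)
      refine H.of_eq rfl ?_ ?_
      · ext1
        · rfl
        · funext c
          cases c <;> simp [Store.ctr_set, blockStore] <;> omega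
        · simp [blockStore, add_assoc]
      · have hle : K (.inp x[i]) ≤ Ki := by
          cases x[i] <;> omega
        have := Nat.mul_le_mul hle (show 1 + i + 1 ≤ V + 1 by omega)
        omega)
  rw [List.drop_length, ← hN] at h2
  -- the separator
  have h3 := hK .sep D τ (1 + N) N 0 [] [.prev, .cur]
    (by simp [hτ, cellStage, hN, add_comm]) (by rw [if_neg (by omega), if_pos (by omega)]) hD0
  -- the free cells
  have h4 := hq B D τ (1 + N + 1) N [] (blockStore (α := Bool) B D τ (1 + N + 1) N 0 []).out
  have h5 := runs_while_writeBlock (B := B) (D := D) (τ := τ) (k := 1 + N + 1) (m := q.eval N)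
    (N := N) (V := V) (K := K .free) (w := ([] : List Bool)) (l := tpl .free)
    (cs := [.prev, .cur]) (fun i a hi hi' => hK .free D τ i N a [] _
      (by
        have : cellStage x (q.eval N) D i = .free := by
          rw [cellStage, if_neg (by omega), dif_neg (by omega), if_neg (by omega),
            if_pos (by omega)]
        simp only [hτ, this]) (by rw [if_neg (by omega), if_pos (by omega)]) hD0) (by omega)
  -- the blank cells
  have h6 := hR B D τ (1 + N + 1 + q.eval N) N []
    (blockStore (α := Bool) B D τ (1 + N + 1 + q.eval N) N 0 []).out
  have h7 := runs_while_writeBlock (B := B) (D := D) (τ := τ) (k := 1 + N + 1 + q.eval N)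
    (m := R.eval N) (N := N) (V := V) (K := K .blank) (w := ([] : List Bool)) (l := tpl .blank)
    (cs := [.prev, .cur]) (fun i a hi hi' => hK .blank D τ i N a [] _
      (by
        have : cellStage x (q.eval N) D i = .blank := by
          rw [cellStage, if_neg (by omega), dif_neg (by omega), if_neg (by omega),
            if_neg (by omega), if_pos (by omega)]
        simp only [hτ, this]) (by rw [if_neg (by omega), if_pos (by omega)]) hD0) (by omega)
  have hDD : 1 + N + 1 + q.eval N + R.eval N = D := by omega
  rw [hDD] at h7
  -- the remaining cells
  have h8 := hZ B D τ D N [] (blockStore (α := Bool) B D τ D N 0 []).out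
  have h9 := runs_while_writeBlock (B := B) (D := D) (τ := τ) (k := D)
    (m := Z.eval N) (N := N) (V := V) (K := K .later) (w := ([] : List Bool)) (l := tpl .later)
    (cs := [.del, .prev, .cur]) (fun i a hi hi' => hK .later D τ i N a [] _
      (by
        have : cellStage x (q.eval N) D i = .later := by
          rw [cellStage, if_neg (by omega), dif_neg (by omega), if_neg (by omega),
            if_neg (by omega), if_neg (by omega)]
        simp only [hτ, this]) (by rw [if_neg (by omega), if_neg (by omega)]) hD0) (by omega)
  rw [← hP] at h9
  -- the end
  have h10 := hf D τ P N 0 []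
  set v := (fin.map (QGate.map (qubitIndex B (blockPos D P))) ++ blockGates B D τ P).flatMap
    QGate.encode with hv
  have h11 := Runs.out .sep { blockStore (α := Bool) B D τ P N 0 [] with out := v }
  have h12 := hn B D τ P N [] (.sep :: v)
  have h13 := Runs.whileDec (c := .acc) (p := out (α := Bool) .tally) (T := 1) (n.eval N)
    (fun i => { blockStore B D τ P N (n.eval N - i) [] with
      out := List.replicate i .tally ++ .sep :: v }) (fun i _ => rfl)
    (by
      intro i hi
      refine (Runs.out CircuitSymbol.tally _).of_eq rfl ?_ le_rfl
      ext1
      · rfl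
      · funext c
        cases c <;> simp [Store.ctr_set, blockStore, Nat.sub_sub]
      · rfl)
  refine ⟨_, (h1.seq (h2.seq (h3.seq (h4.seq (h5.seq (h6.seq (h7.seq (h8.seq (h9.seq (h10.seq
    (h11.seq (h12.seq h13)))))))))))).of_eq ?_ rfl ?_, ?_⟩
  · ext1
    · rfl
    · funext c
      cases c <;> simp [blockStore]
    · rfl
  · have e3 := Nat.mul_le_mul_left (K .sep) (show 1 + N + 1 ≤ V + 1 by omega)
    have e10 := Nat.mul_le_mul_left Kf (show P + 1 ≤ V + 1 by omega)
    simp only [Polynomial.eval_add, Polynomial.eval_mul, Polynomial.eval_C, Polynomial.eval_X,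
      Polynomial.eval_one, Polynomial.eval_ofNat, ← hVdef]
    clear_value V
    omega
  · simp [encodeUnary]

end Prog

/-! ### Scanning a prefix of a string -/

theorem polynomial_eval_mono (p : Polynomial ℕ) {m n : ℕ} (h : m ≤ n) :
    p.eval m ≤ p.eval n := by
  rw [Polynomial.eval_eq_sum, Polynomial.eval_eq_sum]
  exact Finset.sum_le_sum fun i _ => Nat.mul_le_mul_left _ (Nat.pow_le_pow_left h i)

theorem Runs.input_nil {α β ι : Type} [DecidableEq ι] {b : α → Prog α β ι} {s : Store α β ι}
    (h : s.inp = []) : Runs (.forInput b) s s 1 := ⟨1, le_rfl, .input_nil h⟩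

theorem Runs.input_cons {α β ι : Type} [DecidableEq ι] {b : α → Prog α β ι}
    {s s' s'' : Store α β ι} {a : α} {l : List α} {T T' : ℕ} (h : s.inp = a :: l)
    (h1 : Runs (b a) { s with inp := l } s' T) (h2 : Runs (.forInput b) s' s'' T') :
    Runs (.forInput b) s s'' (T + T' + 1) :=
  let ⟨t, ht, hx⟩ := h1
  let ⟨t', ht', hx'⟩ := h2
  ⟨t + t' + 1, by omega, .input_cons h hx hx'⟩

namespace Prog

/-- One step of the scanner: before the separator it counts the symbols, at the separator it
runs `p`, and after the separator it counts the symbols `true` as long as `acc` is positive. -/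
def scanStep (p : Prog (Option Bool) Bool Ctr) : Option Bool → Prog (Option Bool) Bool Ctr
  | none => seq p (inc .cur)
  | some b => ifz .cur (inc .len)
      (seq (inc .cur) (ifz .acc skip (if b then inc .prev else skip)))

/-- The memory of the scanner. -/
def scanStore (l : List (Option Bool)) (N c f a : ℕ) : Store (Option Bool) Bool Ctr where
  inp := l
  ctr := fun r => match r with
    | .len => N
    | .cur => c
    | .prev => f
    | .acc => a
    | _ => 0
  out := []

/-- After the separator, `acc` is the number of symbols that still matter, and each test of it
removes one. The flag `cur` is also lowered by its test, so it has to be raised again. -/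
theorem runs_scan_suffix (p : Prog (Option Bool) Bool Ctr) (s : List Bool) (N f a : ℕ) :
    Runs (forInput (scanStep p)) (scanStore (s.map some) N 1 f a)
      (scanStore [] N 1 (f + (s.take a).count true) (a - s.length)) (s.length * 6 + 1) := by
  induction s generalizing f a with
  | nil => exact (Runs.input_nil rfl).of_eq rfl (by simp) (by simp)
  | cons b s ih =>
    have h1 : Runs (scanStep p (some b)) (scanStore (s.map some) N 1 f a)
        (scanStore (s.map some) N 1 (f + ([b].take a).count true) (a - 1)) 5 := by
      have e : ((scanStore (s.map some) N 1 f a).set .cur 0).set .cur 1 =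
          scanStore (s.map some) N 1 f a := by
        ext1
        · rfl
        · funext c; cases c <;> simp [Store.ctr_set, scanStore]
        · rfl
      have h2 : Runs (ifz .acc skip (if b then inc .prev else skip))
          (scanStore (s.map some) N 1 f a)
          (scanStore (s.map some) N 1 (f + ([b].take a).count true) (a - 1)) 2 := by
        rcases a with _ | a
        · exact (Runs.ifz_zero (by rfl) (Runs.skip _)).of_eq rfl (by simp) le_rfl
        · refine Runs.ifz_succ (n := a) rfl ?_
          cases b
          · refine (Runs.skip _).of_eq rfl ?_ le_rfl
            ext1
            · rfl
            · funext c; cases c <;> simp [Store.ctr_set, scanStore]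
            · rfl
          · refine (Runs.inc Ctr.prev _).of_eq rfl ?_ le_rfl
            ext1
            · rfl
            · funext c; cases c <;> simp [Store.ctr_set, scanStore]
            · rfl
      have h3 := (Runs.inc .cur ((scanStore (s.map some) N 1 f a).set .cur 0)).seq
        (h2.of_eq e.symm rfl le_rfl)
      exact (Runs.ifz_succ (p := inc .len) (n := 0) rfl h3).mono (T' := 5) (by omega)
    refine (Runs.input_cons (l := s.map some) (by rfl) h1 (ih _ _)).of_eq rfl ?_ ?_
    · rcases a with _ | a
      · simp
      · simp [List.count_cons, add_comm, add_left_comm]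
    · simp; omega

theorem runs_scan (p : Prog (Option Bool) Bool Ctr) (K T : Polynomial ℕ)
    (hp : ∀ s : Store (Option Bool) Bool Ctr, s.ctr .acc = 0 → s.ctr .t1 = 0 → s.ctr .t2 = 0 →
      Runs p s (s.set .acc (K.eval (s.ctr .len))) (T.eval (s.ctr .len)))
    (x s : List Bool) (N : ℕ) :
    Runs (forInput (scanStep p)) (scanStore (x.map some ++ none :: s.map some) N 0 0 0)
      (scanStore [] (N + x.length) 1 ((s.take (K.eval (N + x.length))).count true)
        (K.eval (N + x.length) - s.length))
      (x.length * 3 + (T.eval (N + x.length) + s.length * 6 + 3)) := by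
  induction x generalizing N with
  | nil =>
    have h1 := (hp (scanStore (s.map some) N 0 0 0) rfl rfl rfl).seq (Runs.inc .cur _)
    refine (Runs.input_cons rfl (h1.of_eq rfl ?_ le_rfl)
      (runs_scan_suffix p s N 0 (K.eval N))).of_eq rfl ?_ ?_
    · ext1
      · rfl
      · funext c; cases c <;> simp [Store.ctr_set, scanStore]
      · rfl
    · simp
    · simp [scanStore]; omega
  | cons b x ih =>
    have h1 : Runs (scanStep p (some b)) (scanStore (x.map some ++ none :: s.map some) N 0 0 0)
        (scanStore (x.map some ++ none :: s.map some) (N + 1) 0 0 0) 2 := by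
      refine (Runs.ifz_zero rfl (Runs.inc Ctr.len _)).of_eq rfl ?_ le_rfl
      ext1
      · rfl
      · funext c; cases c <;> simp [Store.ctr_set, scanStore]
      · rfl
    refine (Runs.input_cons (by rfl) h1 (ih (N + 1))).of_eq rfl ?_ ?_
    · simp [add_assoc, add_comm 1]
    · simp only [List.length_cons, add_assoc, add_comm 1]
      omega

end Prog

/-- Whether a polynomial-length prefix of a string contains `true` can be decided in polynomial
time. -/
theorem polyTimeComputable_any_take (K : Polynomial ℕ) :
    PolyTimeComputable encodePair encodeBit
      (fun p : List Bool × List Bool => (p.2.take (K.eval p.1.length)).any id) := by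
  obtain ⟨p, T, hp⟩ := Prog.exists_runs_eval (α := Option Bool) (β := Bool) K
  refine polyTimeComputable_of_runs encodePair encodeBit _
    (.seq (.forInput (Prog.scanStep p)) (.ifz .prev (.out false) (.out true)))
    (Polynomial.X * 6 + T + 3 + 2) fun ⟨x, s⟩ => ?_
  have h1 := Prog.runs_scan p K T hp x s 0
  rw [zero_add] at h1
  have hT : T.eval x.length ≤ T.eval (encodePair (x, s)).length :=
    polynomial_eval_mono T (by simp [encodePair])
  have hstart : (⟨encodePair (x, s), fun _ => 0, []⟩ : Store (Option Bool) Bool Ctr) =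
      Prog.scanStore (x.map some ++ none :: s.map some) 0 0 0 0 := by
    ext1
    · rfl
    · funext c; cases c <;> rfl
    · rfl
  have htime : x.length * 3 + (T.eval x.length + s.length * 6 + 3) + 2 ≤
      (Polynomial.X * 6 + T + 3 + 2 : Polynomial ℕ).eval (encodePair (x, s)).length := by
    simp only [Polynomial.eval_add, Polynomial.eval_mul, Polynomial.eval_X, Polynomial.eval_ofNat]
    have : (encodePair (x, s)).length = x.length + (s.length + 1) := by simp [encodePair]
    omega
  rcases hc : (s.take (K.eval x.length)).count true with _ | c
  · rw [hc] at h1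
    refine ⟨_, (h1.seq (Runs.ifz_zero rfl (Runs.out false _))).of_eq hstart.symm rfl htime, ?_⟩
    have : (s.take (K.eval x.length)).any id = false := by
      rw [List.count_eq_zero] at hc
      simpa using hc
    simp only [this]
    rfl
  · rw [hc] at h1
    refine ⟨_, (h1.seq (Runs.ifz_succ rfl (Runs.out true _))).of_eq hstart.symm rfl htime, ?_⟩
    have : (s.take (K.eval x.length)).any id = true := by
      have h : 0 < (s.take (K.eval x.length)).count true := by omega
      rw [List.count_pos_iff] at h
      simpa using h
    simp only [this]
    rfl

/-! ## Turing machines as sequences with a delay -/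

namespace StackMachine

variable {K : Type} [DecidableEq K] {Γ : K → Type} {Λ σ : Type}

/-- A configuration in the course of a step of a stack machine: the statement to be executed, the
internal state, and the stacks. -/
structure MicroCfg (Γ : K → Type) (Λ σ : Type) : Type where
  q : Option (Turing.TM2.Stmt Γ Λ σ)
  v : σ
  S : ∀ k, List (Γ k)

/-- The statement and the state after the execution of one elementary statement, given the top
symbols of the stacks. -/
def nextCtrl (m : Λ → Turing.TM2.Stmt Γ Λ σ) :
    Option (Turing.TM2.Stmt Γ Λ σ) × σ → (∀ k, Option (Γ k)) →
      Option (Turing.TM2.Stmt Γ Λ σ) × σ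
  | (none, v), _ => (none, v)
  | (some (.push _ _ q), v), _ => (some q, v)
  | (some (.peek k f q), v), a => (some q, f v (a k))
  | (some (.pop k f q), v), a => (some q, f v (a k))
  | (some (.load f q), v), _ => (some q, f v)
  | (some (.branch f q q'), v), _ => (some (cond (f v) q q'), v)
  | (some (.goto f), v), _ => (some (m (f v)), v)
  | (some .halt, v), _ => (none, v)

/-- The stacks after the execution of one elementary statement. -/
def nextStk : Option (Turing.TM2.Stmt Γ Λ σ) × σ → (∀ k, List (Γ k)) → ∀ k, List (Γ k)
  | (some (.push k f _), v), S => Function.update S k (f v :: S k)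
  | (some (.pop k _ _), _), S => Function.update S k (S k).tail
  | _, S => S

/-- The symbols at a given depth after the execution of one elementary statement, given the symbols
at this depth and at the depths one less and one more; `top` tells whether the depth is zero. -/
def nextSyms (c : Option (Turing.TM2.Stmt Γ Λ σ) × σ) (top : Bool)
    (above here below : ∀ k, Option (Γ k)) : ∀ k, Option (Γ k) :=
  match c with
  | (some (.push k f _), v) => Function.update here k (if top then some (f v) else above k)
  | (some (.pop k _ _), _) => Function.update here k (below k)
  | _ => here

/-- The symbols at depth `i` of the stacks. -/
def symsAt (S : ∀ k, List (Γ k)) (i : ℕ) : ∀ k, Option (Γ k) := fun k => (S k)[i]?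

/-- A push or a pop shifts a stack by one place, so the new symbols at a given depth depend only on
the control and on the old symbols at this depth and the two adjacent ones. This locality is what
makes the tableau below work. -/
theorem symsAt_nextStk_zero (c : Option (Turing.TM2.Stmt Γ Λ σ) × σ) (S : ∀ k, List (Γ k))
    (above : ∀ k, Option (Γ k)) :
    symsAt (nextStk c S) 0 = nextSyms c true above (symsAt S 0) (symsAt S 1) := by
  obtain ⟨_ | q, v⟩ := c
  · rfl
  cases q with
  | push k f q =>
    funext k'
    by_cases h : k' = k
    · subst h; simp [symsAt, nextStk, nextSyms]
    · simp [symsAt, nextStk, nextSyms, h]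
  | pop k f q =>
    funext k'
    by_cases h : k' = k
    · subst h; simp [symsAt, nextStk, nextSyms]
    · simp [symsAt, nextStk, nextSyms, h]
  | _ => rfl

theorem symsAt_nextStk_succ (c : Option (Turing.TM2.Stmt Γ Λ σ) × σ) (S : ∀ k, List (Γ k))
    (i : ℕ) :
    symsAt (nextStk c S) (i + 1) =
      nextSyms c false (symsAt S i) (symsAt S (i + 1)) (symsAt S (i + 2)) := by
  obtain ⟨_ | q, v⟩ := c
  · rfl
  cases q with
  | push k f q =>
    funext k'
    by_cases h : k' = k
    · subst h; simp [symsAt, nextStk, nextSyms]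
    · simp [symsAt, nextStk, nextSyms, h]
  | pop k f q =>
    funext k'
    by_cases h : k' = k
    · subst h; simp [symsAt, nextStk, nextSyms]
    · simp [symsAt, nextStk, nextSyms, h]
  | _ => rfl

/-- Execute one elementary statement. -/
def micro (m : Λ → Turing.TM2.Stmt Γ Λ σ) (c : MicroCfg Γ Λ σ) : MicroCfg Γ Λ σ where
  q := (nextCtrl m (c.q, c.v) (symsAt c.S 0)).1
  v := (nextCtrl m (c.q, c.v) (symsAt c.S 0)).2
  S := nextStk (c.q, c.v) c.S

/-- A configuration between two steps. -/
def ofCfg (m : Λ → Turing.TM2.Stmt Γ Λ σ) (c : Turing.TM2.Cfg Γ Λ σ) : MicroCfg Γ Λ σ :=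
  ⟨c.l.map m, c.var, c.stk⟩

/-- The maximal number of elementary statements executed by a statement. -/
def depth : Turing.TM2.Stmt Γ Λ σ → ℕ
  | .push _ _ q => depth q + 1
  | .peek _ _ q => depth q + 1
  | .pop _ _ q => depth q + 1
  | .load _ q => depth q + 1
  | .branch _ q q' => max (depth q) (depth q') + 1
  | .goto _ => 1
  | .halt => 1

/-- One step of the machine runs a whole statement up to its jump or halt, which can change a stack
in several places. Split into elementary statements, each change is local. -/
theorem exists_micro_iterate_stepAux (m : Λ → Turing.TM2.Stmt Γ Λ σ)
    (q : Turing.TM2.Stmt Γ Λ σ) (v : σ) (S : ∀ k, List (Γ k)) :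
    ∃ j ≤ depth q, (micro m)^[j] ⟨some q, v, S⟩ = ofCfg m (Turing.TM2.stepAux q v S) := by
  have head : ∀ k, (S k).head? = (S k)[0]? := fun k => by cases S k <;> rfl
  induction q generalizing v S with
  | push k f q ih =>
    obtain ⟨j, hj, h⟩ := ih v (Function.update S k (f v :: S k)) (fun k => by
      cases Function.update S _ _ k <;> rfl)
    exact ⟨j + 1, Nat.succ_le_succ hj, h⟩
  | peek k f q ih =>
    obtain ⟨j, hj, h⟩ := ih (f v (S k).head?) S head
    rw [head k] at h
    exact ⟨j + 1, Nat.succ_le_succ hj, by rw [Turing.TM2.stepAux, head k]; exact h⟩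
  | pop k f q ih =>
    obtain ⟨j, hj, h⟩ := ih (f v (S k).head?) (Function.update S k (S k).tail) (fun k => by
      cases Function.update S _ _ k <;> rfl)
    rw [head k] at h
    exact ⟨j + 1, Nat.succ_le_succ hj, by rw [Turing.TM2.stepAux, head k]; exact h⟩
  | load f q ih =>
    obtain ⟨j, hj, h⟩ := ih (f v) S head
    exact ⟨j + 1, Nat.succ_le_succ hj, h⟩
  | branch f q q' ih ih' =>
    rw [Turing.TM2.stepAux]
    cases hf : f v with
    | true =>
      obtain ⟨j, hj, h⟩ := ih v S head
      refine ⟨j + 1, Nat.succ_le_succ (hj.trans (le_max_left _ _)), ?_⟩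
      rw [cond_true, ← h, Function.iterate_succ_apply]
      simp [micro, nextCtrl, nextStk, hf]
    | false =>
      obtain ⟨j, hj, h⟩ := ih' v S head
      refine ⟨j + 1, Nat.succ_le_succ (hj.trans (le_max_right _ _)), ?_⟩
      rw [cond_false, ← h, Function.iterate_succ_apply]
      simp [micro, nextCtrl, nextStk, hf]
  | goto f => exact ⟨1, le_rfl, rfl⟩
  | halt => exact ⟨1, le_rfl, rfl⟩

theorem exists_micro_iterate (m : Λ → Turing.TM2.Stmt Γ Λ σ) {d : ℕ} (hd : ∀ l, depth (m l) ≤ d)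
    (n : ℕ) (c c' : Turing.TM2.Cfg Γ Λ σ)
    (h : (flip bind (Turing.TM2.step m))^[n] (some c) = some c') :
    ∃ j ≤ n * d, (micro m)^[j] (ofCfg m c) = ofCfg m c' := by
  induction n generalizing c with
  | zero =>
    have : c = c' := by simpa using h
    exact ⟨0, by simp, by rw [this]; rfl⟩
  | succ n ih =>
    rw [Function.iterate_succ_apply] at h
    obtain ⟨_ | l, v, S⟩ := c
    · have : flip bind (Turing.TM2.step m)
          (some (⟨none, v, S⟩ : Turing.TM2.Cfg Γ Λ σ)) = none := rfl
      rw [this] at h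
      have h2 : ∀ n, (flip bind (Turing.TM2.step m))^[n] none = none := fun n =>
        Function.iterate_fixed rfl n
      rw [h2] at h
      cases h
    · obtain ⟨j, hj, hx⟩ := ih _ h
      obtain ⟨j', hj', hx'⟩ := exists_micro_iterate_stepAux m (m l) v S
      refine ⟨j + j', ?_, ?_⟩
      · rw [Nat.succ_mul]
        have := hd l
        omega
      · rw [Function.iterate_add_apply, ← hx, ← hx']
        rfl

/-- A halted configuration is stationary, so the tableau may have more rows than the computation has
steps. -/
theorem micro_iterate_none (m : Λ → Turing.TM2.Stmt Γ Λ σ) (v : σ) (S : ∀ k, List (Γ k))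
    (j : ℕ) : (micro m)^[j] ⟨none, v, S⟩ = ⟨none, v, S⟩ :=
  Function.iterate_fixed rfl j

/-! ### The computation tableau as a sequence -/

/-- A column of the computation tableau: the statement and the state in the first column, and the
symbols at some depth of the stacks in the other columns. -/
abbrev Col (Γ : K → Type) (Λ σ : Type) : Type :=
  Option (Option (Turing.TM2.Stmt Γ Λ σ) × σ) × (∀ k, Option (Γ k))

/-- The columns of a configuration. -/
def colAt (c : MicroCfg Γ Λ σ) : ℕ → Col Γ Λ σ
  | 0 => (some (c.q, c.v), fun _ => none)
  | i + 1 => (none, symsAt c.S i)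

/-- A cell holds its column, the last two columns read, and the first two columns of the
configuration whose successor is being written. -/
structure Cell (Γ : K → Type) (Λ σ : Type) : Type where
  out : Col Γ Λ σ
  last : Col Γ Λ σ
  prev : Col Γ Λ σ
  act : Col Γ Λ σ × Col Γ Λ σ

/-- The column written when the columns `above`, `here` and `below` have been read. -/
def nextCol (m : Λ → Turing.TM2.Stmt Γ Λ σ) (act : Col Γ Λ σ × Col Γ Λ σ)
    (above here below : Col Γ Λ σ) : Col Γ Λ σ :=
  match here.1, act.1.1 with
  | some _, some c => (some (nextCtrl m c act.2.2), fun _ => none)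
  | none, some c => (none, nextSyms c above.1.isSome above.2 here.2 below.2)
  | _, none => here

/-- The cell after the cell `a` that reads the cell `b`. -/
def nextCell (m : Λ → Turing.TM2.Stmt Γ Λ σ) (a b : Cell Γ Λ σ) : Cell Γ Λ σ :=
  let act := if a.last.1.isSome then (a.last, b.out) else a.act
  ⟨nextCol m act a.prev a.last b.out, b.out, a.last, act⟩

theorem nextCol_colAt_zero (m : Λ → Turing.TM2.Stmt Γ Λ σ) (c : MicroCfg Γ Λ σ)
    (above below : Col Γ Λ σ) :
    nextCol m (colAt c 0, colAt c 1) above (colAt c 0) below = colAt (micro m c) 0 := rfl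

theorem nextCol_colAt_succ (m : Λ → Turing.TM2.Stmt Γ Λ σ) (c : MicroCfg Γ Λ σ) (i : ℕ) :
    nextCol m (colAt c 0, colAt c 1) (colAt c i) (colAt c (i + 1)) (colAt c (i + 2)) =
      colAt (micro m c) (i + 1) := by
  cases i with
  | zero =>
    change (none, _) = (none, _)
    rw [micro, symsAt_nextStk_zero _ _ (colAt c 0).2]
    rfl
  | succ i =>
    change (none, _) = (none, _)
    rw [micro, symsAt_nextStk_succ]
    rfl

/-- If each cell from the cell `D` on is determined by the cell before it and the cell `D` cells
before it, then the cells contain the successive configurations in rows of length `D + 1`. -/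
theorem cell_eq (m : Λ → Turing.TM2.Stmt Γ Λ σ) (c₀ : MicroCfg Γ Λ σ) {D : ℕ}
    (c : ℕ → Cell Γ Λ σ) (h0 : ∀ i < D, (c i).out = colAt c₀ i)
    (hc : ∀ p, D ≤ p → c p = nextCell m (c (p - 1)) (c (p - D))) (t i : ℕ) (h : i + t < D) :
    (c (t * (D + 1) + i)).out = colAt ((micro m)^[t] c₀) i ∧
      (0 < t → (c (t * (D + 1) + i)).act =
        (colAt ((micro m)^[t - 1] c₀) 0, colAt ((micro m)^[t - 1] c₀) 1)) := by
  -- Rows have length `D + 1` and the delay is `D`, so column `i` of a row reads column `i + 1` of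
  -- the row before. Columns `i` and `i - 1` were read by the two preceding cells and are kept in
  -- `last` and `prev`. A cell needs a correct right neighbour in the row before, so each row loses
  -- one correct column at its end; hence the condition `i + t < D`.
  induction t generalizing i with
  | zero => simpa using h0 i (by omega)
  | succ t ih =>
    set C := (micro m)^[t] c₀ with hC
    rw [Function.iterate_succ_apply', ← hC, Nat.add_sub_cancel]
    have hmul : (t + 1) * (D + 1) = t * (D + 1) + D + 1 := by ring
    have hlast : ∀ i, i + (t + 1) < D →
        (c ((t + 1) * (D + 1) + i - 1)).last = colAt C i := by
      intro i hi
      rw [hc _ (by omega)]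
      change (c _).out = _
      rw [show (t + 1) * (D + 1) + i - 1 - D = t * (D + 1) + i by omega]
      exact (ih i (by omega)).1
    have hbelow : ∀ i, i + (t + 1) < D →
        (c ((t + 1) * (D + 1) + i - D)).out = colAt C (i + 1) := by
      intro i hi
      rw [show (t + 1) * (D + 1) + i - D = t * (D + 1) + (i + 1) by omega]
      exact (ih (i + 1) (by omega)).1
    have hprev : ∀ i, i + 1 + (t + 1) < D →
        (c ((t + 1) * (D + 1) + (i + 1) - 1)).prev = colAt C i := by
      intro i hi
      rw [hc _ (by omega)]
      change (c _).last = _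
      rw [show (t + 1) * (D + 1) + (i + 1) - 1 - 1 = (t + 1) * (D + 1) + i - 1 by omega]
      exact hlast i (by omega)
    -- In column 0 the last column read is the control column, and `act` is renewed with it and the
    -- tops of the stacks. In the other columns no control column has just been read, and `act` is
    -- inherited.
    have hact : ∀ i, i + (t + 1) < D →
        (c ((t + 1) * (D + 1) + i)).act = (colAt C 0, colAt C 1) := by
      intro i
      induction i with
      | zero =>
        intro hi
        rw [hc _ (by omega)]
        simp only [nextCell]
        rw [hlast 0 hi, hbelow 0 hi]
        rfl
      | succ i ih' =>
        intro hi
        rw [hc _ (by omega)]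
        simp only [nextCell]
        rw [hlast (i + 1) hi, hbelow (i + 1) hi,
          show (t + 1) * (D + 1) + (i + 1) - 1 = (t + 1) * (D + 1) + i by omega,
          ih' (by omega)]
        rfl
    refine ⟨?_, fun _ => hact i h⟩
    have e := hact i h
    rw [hc _ (by omega)] at e ⊢
    change nextCol m _ _ _ _ = _
    change (nextCell m _ _).act = _ at e
    simp only [nextCell] at e
    rw [e, hlast i h, hbelow i h]
    cases i with
    | zero => exact nextCol_colAt_zero m C _ _
    | succ i =>
      rw [hprev i h]
      exact nextCol_colAt_succ m C i

end StackMachine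

/-! ### Finiteness of the set of cells that occur -/

namespace StackMachine

variable {K : Type} {Γ : K → Type} {Λ σ : Type}

/-- The statements that can occur in a computation. -/
def stmtSet (m : Λ → Turing.TM2.Stmt Γ Λ σ) : Set (Turing.TM2.Stmt Γ Λ σ) :=
  ⋃ l, (↑(Turing.TM2.stmts₁ (m l)) : Set (Turing.TM2.Stmt Γ Λ σ))

theorem finite_stmtSet [Finite Λ] (m : Λ → Turing.TM2.Stmt Γ Λ σ) : (stmtSet m).Finite :=
  Set.finite_iUnion fun _ => Finset.finite_toSet _

theorem mem_stmtSet_of_mem {m : Λ → Turing.TM2.Stmt Γ Λ σ} {q q' : Turing.TM2.Stmt Γ Λ σ}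
    (hq : q ∈ stmtSet m) (h : q' ∈ Turing.TM2.stmts₁ q) : q' ∈ stmtSet m := by
  obtain ⟨l, hl⟩ := Set.mem_iUnion.1 hq
  exact Set.mem_iUnion.2 ⟨l, Turing.TM2.stmts₁_trans hl h⟩

/-- The symbols that a statement pushes on the stack `k`. -/
def pushed (q : Turing.TM2.Stmt Γ Λ σ) (k : K) : Set (Γ k) :=
  {γ | ∃ f q' v, q = .push k f q' ∧ γ = f v}

theorem finite_pushed [Finite σ] (q : Turing.TM2.Stmt Γ Λ σ) (k : K) : (pushed q k).Finite := by
  by_cases h : ∃ f q', q = .push k f q'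
  · obtain ⟨f, q', rfl⟩ := h
    refine (Set.finite_range f).subset ?_
    rintro γ ⟨f', q'', v, h, rfl⟩
    cases h
    exact ⟨v, rfl⟩
  · refine Set.finite_empty.subset ?_
    rintro γ ⟨f, q', v, h', -⟩
    exact h ⟨f, q', h'⟩

/-- The symbols that can occur on the stack `k` in a computation with input on the stack `k₀`. -/
def symSet (m : Λ → Turing.TM2.Stmt Γ Λ σ) (k₀ k : K) : Set (Γ k) :=
  (⋃ q ∈ stmtSet m, pushed q k) ∪ {_γ | k = k₀}

/-- Among the stack alphabets only that of the input stack is assumed to be finite. On the others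
nothing occurs but pushed symbols, and a push statement has at most one symbol for each of the
finitely many internal states. -/
theorem finite_symSet [Finite Λ] [Finite σ] (m : Λ → Turing.TM2.Stmt Γ Λ σ) (k₀ : K)
    [Finite (Γ k₀)] (k : K) : (symSet m k₀ k).Finite := by
  refine ((finite_stmtSet m).biUnion fun q _ => finite_pushed q k).union ?_
  by_cases h : k = k₀
  · subst h
    exact Set.toFinite _
  · simp [h]

/-- Columns that can occur in a computation. -/
def colSet (m : Λ → Turing.TM2.Stmt Γ Λ σ) (k₀ : K) : Set (Col Γ Λ σ) :=
  {c | ∀ q v, c.1 = some (some q, v) → q ∈ stmtSet m} ∩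
    {c | ∀ k γ, c.2 k = some γ → γ ∈ symSet m k₀ k}

theorem finite_colSet [Finite K] [Finite Λ] [Finite σ] (m : Λ → Turing.TM2.Stmt Γ Λ σ) (k₀ : K)
    [Finite (Γ k₀)] : (colSet m k₀).Finite := by
  have h1 : (insert none (some '' ((insert none (some '' stmtSet m)) ×ˢ (Set.univ : Set σ))) :
      Set (Option (Option (Turing.TM2.Stmt Γ Λ σ) × σ))).Finite :=
    (((((finite_stmtSet m).image _).insert _).prod Set.finite_univ).image _).insert _
  have h2 : {a : ∀ k, Option (Γ k) | ∀ k, a k ∈ insert none (some '' symSet m k₀ k)}.Finite :=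
    Set.Finite.pi' fun k => ((finite_symSet m k₀ k).image _).insert _
  refine (h1.prod h2).subset ?_
  rintro ⟨c, a⟩ ⟨hc, ha⟩
  refine ⟨?_, fun k => ?_⟩
  · rcases c with _ | ⟨_ | q, v⟩
    · simp
    · simp
    · simpa using hc q v rfl
  · rcases h : a k with _ | γ
    · exact Or.inl h
    · exact Or.inr ⟨γ, ha k γ h, h.symm⟩

theorem nextCtrl_mem {m : Λ → Turing.TM2.Stmt Γ Λ σ} {q : Turing.TM2.Stmt Γ Λ σ} {v : σ}
    (hq : q ∈ stmtSet m) (a : ∀ k, Option (Γ k)) (q' : Turing.TM2.Stmt Γ Λ σ)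
    (h : (nextCtrl m (some q, v) a).1 = some q') : q' ∈ stmtSet m := by
  cases q with
  | push k f q =>
    obtain rfl : q = q' := by simpa [nextCtrl] using h
    exact mem_stmtSet_of_mem hq (by simp [Turing.TM2.stmts₁, Turing.TM2.stmts₁_self])
  | peek k f q =>
    obtain rfl : q = q' := by simpa [nextCtrl] using h
    exact mem_stmtSet_of_mem hq (by simp [Turing.TM2.stmts₁, Turing.TM2.stmts₁_self])
  | pop k f q =>
    obtain rfl : q = q' := by simpa [nextCtrl] using h
    exact mem_stmtSet_of_mem hq (by simp [Turing.TM2.stmts₁, Turing.TM2.stmts₁_self])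
  | load f q =>
    obtain rfl : q = q' := by simpa [nextCtrl] using h
    exact mem_stmtSet_of_mem hq (by simp [Turing.TM2.stmts₁, Turing.TM2.stmts₁_self])
  | branch f q₁ q₂ =>
    obtain h : cond (f v) q₁ q₂ = q' := by simpa [nextCtrl] using h
    cases hf : f v
    · rw [hf, cond_false] at h
      subst h
      exact mem_stmtSet_of_mem hq (by simp [Turing.TM2.stmts₁, Turing.TM2.stmts₁_self])
    · rw [hf, cond_true] at h
      subst h
      exact mem_stmtSet_of_mem hq (by simp [Turing.TM2.stmts₁, Turing.TM2.stmts₁_self])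
  | goto f =>
    obtain rfl : m (f v) = q' := by simpa [nextCtrl] using h
    exact Set.mem_iUnion.2 ⟨_, Turing.TM2.stmts₁_self⟩
  | halt => simp [nextCtrl] at h

/-- Cells that can occur in a computation. -/
def cellSet (m : Λ → Turing.TM2.Stmt Γ Λ σ) (k₀ : K) : Set (Cell Γ Λ σ) :=
  {c | c.out ∈ colSet m k₀ ∧ c.last ∈ colSet m k₀ ∧ c.prev ∈ colSet m k₀ ∧
    c.act.1 ∈ colSet m k₀ ∧ c.act.2 ∈ colSet m k₀}

theorem finite_cellSet [Finite K] [Finite Λ] [Finite σ] (m : Λ → Turing.TM2.Stmt Γ Λ σ) (k₀ : K)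
    [Finite (Γ k₀)] : (cellSet m k₀).Finite := by
  have h := finite_colSet m k₀
  refine ((h.prod (h.prod (h.prod (h.prod h)))).image
    fun c => (⟨c.1, c.2.1, c.2.2.1, c.2.2.2⟩ : Cell Γ Λ σ)).subset ?_
  rintro ⟨a, b, c, d, e⟩ ⟨h1, h2, h3, h4, h5⟩
  exact ⟨(a, b, c, d, e), ⟨h1, h2, h3, h4, h5⟩, rfl⟩

variable [DecidableEq K]

theorem nextSyms_mem {m : Λ → Turing.TM2.Stmt Γ Λ σ} {k₀ : K} {q : Turing.TM2.Stmt Γ Λ σ}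
    {v : σ} (hq : q ∈ stmtSet m) (top : Bool) {above here below : ∀ k, Option (Γ k)}
    (ha : ∀ k γ, above k = some γ → γ ∈ symSet m k₀ k)
    (hh : ∀ k γ, here k = some γ → γ ∈ symSet m k₀ k)
    (hb : ∀ k γ, below k = some γ → γ ∈ symSet m k₀ k) (k : K) (γ : Γ k)
    (h : nextSyms (some q, v) top above here below k = some γ) : γ ∈ symSet m k₀ k := by
  cases q with
  | push k' f q' =>
    by_cases hk : k = k'
    · subst hk
      simp only [nextSyms, Function.update_self] at h
      split_ifs at h with htop
      · exact Or.inl (Set.mem_biUnion hq ⟨f, q', v, rfl, by simpa using h.symm⟩)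
      · exact ha _ _ h
    · exact hh _ _ (by simpa [nextSyms, hk] using h)
  | pop k' f q' =>
    by_cases hk : k = k'
    · subst hk
      exact hb _ _ (by simpa [nextSyms] using h)
    · exact hh _ _ (by simpa [nextSyms, hk] using h)
  | _ => exact hh _ _ h

theorem nextCol_mem {m : Λ → Turing.TM2.Stmt Γ Λ σ} {k₀ : K} {act : Col Γ Λ σ × Col Γ Λ σ}
    {above here below : Col Γ Λ σ} (h1 : act.1 ∈ colSet m k₀)
    (ha : above ∈ colSet m k₀) (hh : here ∈ colSet m k₀) (hb : below ∈ colSet m k₀) :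
    nextCol m act above here below ∈ colSet m k₀ := by
  obtain ⟨⟨a1, a2⟩, b⟩ := act
  obtain ⟨h, s⟩ := here
  rcases a1 with _ | ⟨_ | q, v⟩
  · cases h <;> exact hh
  · rcases h with _ | c
    · exact ⟨fun q v h => by simp [nextCol] at h, hh.2⟩
    · exact ⟨fun q v h => by simp [nextCol, nextCtrl] at h, fun k γ h => by simp [nextCol] at h⟩
  · have hq : q ∈ stmtSet m := h1.1 q v rfl
    rcases h with _ | c
    · exact ⟨fun q v h => by simp [nextCol] at h,
        fun k γ h => nextSyms_mem hq _ ha.2 hh.2 hb.2 k γ h⟩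
    · refine ⟨fun q' v' h => ?_, fun k γ h => by simp [nextCol] at h⟩
      simp only [nextCol, Option.some.injEq] at h
      exact nextCtrl_mem hq _ _ (congrArg Prod.fst h)

/-- By this closure property `nextCell` restricts to an operation on a finite alphabet. -/
theorem nextCell_mem {m : Λ → Turing.TM2.Stmt Γ Λ σ} {k₀ : K} {a b : Cell Γ Λ σ}
    (ha : a ∈ cellSet m k₀) (hb : b ∈ cellSet m k₀) : nextCell m a b ∈ cellSet m k₀ := by
  have hact : (nextCell m a b).act.1 ∈ colSet m k₀ ∧ (nextCell m a b).act.2 ∈ colSet m k₀ := by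
    simp only [nextCell]
    split_ifs
    · exact ⟨ha.2.1, hb.1⟩
    · exact ha.2.2.2
  exact ⟨nextCol_mem hact.1 ha.2.2.1 ha.2.1 hb.1, hb.1, ha.2.1, hact⟩

end StackMachine

open StackMachine in
/-- The computations of a polynomial-time function with values in `{1, -1}` are described by
sequences over a finite alphabet in which each term from the term `D` on is determined by the term
before it and the term `D` terms before it. -/
theorem exists_delay_sequence {f : List Bool × List Bool → ℤˣ}
    (hf : PolyTimeComputable encodePair encodeSign f) :
    ∃ (A : Type) (_ : Fintype A) (_ : DecidableEq A) (F : A → A → A) (c₀ : A)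
      (sym : Option (Option Bool) → A) (bad : A → Bool) (τ : Polynomial ℕ),
      sym (some (some true)) ≠ sym (some (some false)) ∧
      ∀ (x y : List Bool) (D : ℕ) (c : ℕ → A), τ.eval (encodePair (x, y)).length ≤ D → c 0 = c₀ →
        (∀ i, i + 1 < D → c (i + 1) = sym ((encodePair (x, y))[i]?)) →
        (∀ p, D ≤ p → c p = F (c (p - 1)) (c (p - D))) →
        (bad (c (D * D - 1)) = true ↔ f (x, y) = -1) := by
  classical
  obtain ⟨⟨⟨tm, ia, oa⟩, time, hout⟩⟩ := hf
  have : Fintype tm.K := tm.kFin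
  have : Fintype tm.Λ := tm.ΛFin
  have : Fintype tm.σ := tm.σFin
  have : Fintype (tm.Γ tm.k₀) := tm.Γk₀Fin
  let m : tm.Λ → Turing.TM2.Stmt tm.Γ tm.Λ tm.σ := tm.m
  have hfin := finite_cellSet m tm.k₀
  have : Finite (cellSet m tm.k₀) := hfin
  let blank : Col tm.Γ tm.Λ tm.σ := (none, fun _ => none)
  have hblank : blank ∈ colSet m tm.k₀ :=
    ⟨fun q v h => by simp [blank] at h, fun k γ h => by simp [blank] at h⟩
  let cellOf (o : Col tm.Γ tm.Λ tm.σ) : Cell tm.Γ tm.Λ tm.σ := ⟨o, blank, blank, blank, blank⟩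
  have hcellOf : ∀ o ∈ colSet m tm.k₀, cellOf o ∈ cellSet m tm.k₀ := fun o ho =>
    ⟨ho, hblank, hblank, hblank, hblank⟩
  let first : Col tm.Γ tm.Λ tm.σ := (some (some (m tm.main), tm.initialState), fun _ => none)
  have hfirst : first ∈ colSet m tm.k₀ := by
    refine ⟨fun q v h => ?_, fun k γ h => by simp [first] at h⟩
    simp only [first, Option.some.injEq, Prod.mk.injEq] at h
    rw [← h.1]
    exact Set.mem_iUnion.2 ⟨_, Turing.TM2.stmts₁_self⟩
  let syms (o : Option (Option Bool)) : ∀ k, Option (tm.Γ k) :=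
    Function.update (fun _ => none) tm.k₀ (o.map ia.symm)
  have hsyms : ∀ o, ((none, syms o) : Col tm.Γ tm.Λ tm.σ) ∈ colSet m tm.k₀ := by
    refine fun o => ⟨fun q v h => by simp at h, fun k γ h => ?_⟩
    by_cases hk : k = tm.k₀
    · exact Or.inr hk
    · simp [syms, hk] at h
  let d : ℕ := Finset.univ.sup fun l => depth (m l)
  refine ⟨cellSet m tm.k₀, Fintype.ofFinite _, inferInstance,
    fun a b => ⟨nextCell m a b, nextCell_mem a.2 b.2⟩, ⟨cellOf first, hcellOf _ hfirst⟩,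
    fun o => ⟨cellOf (none, syms o), hcellOf _ (hsyms o)⟩,
    -- The second column in `act` has depth zero, so it shows the top of the output stack.
    fun a => decide (a.1.act.2.2 tm.k₁ = some (oa.symm false)),
    -- Each step of the machine takes at most `d` elementary ones. The summand 2 is there because
    -- `act` in row `D - 1` describes the configuration after `D - 2` elementary steps.
    time * Polynomial.C d + 2, ?_, ?_⟩
  · intro h
    have h1 := congrFun (congrArg (fun a => a.1.out.2) h) tm.k₀
    simp [cellOf, syms] at h1
  · intro x y D c hD h0 hi hc
    set w := encodePair (x, y) with hw
    obtain ⟨⟨n, hn⟩, hle⟩ := hout (x, y)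
    have hn' : (flip bind (Turing.TM2.step m))^[n]
        (some (Turing.initList tm (List.map ia.invFun w))) =
        some (Turing.haltList tm (List.map oa.invFun (encodeSign (f (x, y))))) := hn
    obtain ⟨j, hj, hx⟩ := exists_micro_iterate m
      (fun l => Finset.le_sup (f := fun l => depth (m l)) (Finset.mem_univ l)) n _ _ hn'
    change j ≤ n * d at hj
    simp only [Polynomial.eval_add, Polynomial.eval_mul, Polynomial.eval_C,
      Polynomial.eval_ofNat] at hD
    have hjD : j + 2 ≤ D := by
      have := Nat.mul_le_mul_right d (show n ≤ time.eval w.length from hle)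
      omega
    set C₀ : MicroCfg tm.Γ tm.Λ tm.σ := ofCfg m (Turing.initList tm (List.map ia.invFun w)) with hC₀
    have hstart : ∀ i < D, (c i).1.out = colAt C₀ i := by
      intro i hiD
      cases i with
      | zero => rw [h0]; rfl
      | succ i =>
        rw [hi i hiD]
        change (none, syms w[i]?) = (none, symsAt C₀.S i)
        congr 1
        funext k
        by_cases hk : k = tm.k₀
        · subst hk
          simp [syms, symsAt, hC₀, ofCfg, Turing.initList, List.getElem?_map]
        · simp [syms, symsAt, hC₀, ofCfg, Turing.initList, hk]
    -- Row `D - 1` is the last one with a correct cell, its column 0, which has the position (D -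
    -- 1)(D + 1) = D² - 1.
    have hmain := (cell_eq m C₀ (fun i => (c i).1) hstart
      (fun p hp => congrArg Subtype.val (hc p hp)) (D - 1) 0 (by omega)).2 (by omega)
    have hpos : (D - 1) * (D + 1) + 0 = D * D - 1 := by
      obtain ⟨D, rfl⟩ : ∃ D', D = D' + 2 := ⟨D - 2, by omega⟩
      have : (D + 2) * (D + 2) = (D + 1) * (D + 3) + 1 := by ring
      rw [this]
      rfl
    rw [hpos] at hmain
    have hhalt : (micro m)^[D - 1 - 1] C₀ =
        ofCfg m (Turing.haltList tm (List.map oa.invFun (encodeSign (f (x, y))))) := by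
      rw [show D - 1 - 1 = (D - 2 - j) + j by omega, Function.iterate_add_apply, hx]
      exact micro_iterate_none m _ _ _
    rw [hhalt] at hmain
    have hact : (c (D * D - 1)).1.act.2.2 tm.k₁ = some (oa.symm (decide (f (x, y) = 1))) := by
      rw [hmain]
      simp [colAt, symsAt, ofCfg, Turing.haltList, encodeSign]
    simp only [hact, decide_eq_true_eq, Option.some.injEq, EmbeddingLike.apply_eq_iff_eq,
      decide_eq_false_iff_not]
    rcases Int.units_eq_one_or (f (x, y)) with h | h <;> simp [h]

/-! ## The amplitude of the outcome zero -/

theorem prod_univ_sum_eq {ι κ R : Type*} [Fintype ι] [DecidableEq ι] [Fintype κ]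
    [CommSemiring R] (f : ι → κ → R) : ∏ i, ∑ b, f i b = ∑ p : ι → κ, ∏ i, f i (p i) := by
  rw [Finset.prod_univ_sum, Fintype.piFinset_univ]

/-- The sign `(-1)^b`. -/
def boolSign (b : Bool) : ℂ := if b then -1 else 1

/-- The characters of the group of bit strings. -/
noncomputable def character (n : ℕ) : Matrix (Bits n) (Bits n) ℂ :=
  Matrix.of fun z s => ∏ k, boolSign (z k && s k)

theorem character_mul_self (n : ℕ) : character n * character n = (2 ^ n : ℂ) • 1 := by
  ext z w
  have h : (character n * character n) z w =
      ∏ k, ∑ b : Bool, boolSign (z k && b) * boolSign (b && w k) := by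
    rw [prod_univ_sum_eq, Matrix.mul_apply]
    simp [character, Finset.prod_mul_distrib]
  have h2 : ∀ b c : Bool, ∑ d : Bool, boolSign (b && d) * boolSign (d && c) =
      if b = c then 2 else 0 := by
    intro b c
    cases b <;> cases c <;> (simp [boolSign]; try norm_num)
  rw [h, Matrix.smul_apply, Matrix.one_apply]
  simp only [h2]
  by_cases hzw : z = w
  · simp [hzw]
  · obtain ⟨k, hk⟩ := Function.ne_iff.1 hzw
    rw [Finset.prod_eq_zero (Finset.mem_univ k) (if_neg hk), if_neg hzw, smul_zero]

/-- Flipping a bit of the argument changes a character by a sign, so the characters are common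
eigenvectors of all the operators `sigmaX k`. -/
theorem sigmaX_mul_character {n : ℕ} (k : Fin n) :
    sigmaX k * character n = character n * Matrix.diagonal fun s => boolSign (s k) := by
  ext z s
  rw [Matrix.mul_diagonal, Matrix.mul_apply, Finset.sum_eq_single (Function.update z k (!z k))]
  · have h1 : sigmaX k z (Function.update z k (!z k)) = 1 := by
      simp [sigmaX]
    rw [h1, one_mul]
    simp only [character, Matrix.of_apply]
    rw [← Finset.mul_prod_erase _ _ (Finset.mem_univ k),
      ← Finset.mul_prod_erase _ (fun j => boolSign (z j && s j)) (Finset.mem_univ k),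
      Finset.prod_congr rfl (g := fun j => boolSign (z j && s j))]
    · rw [Function.update_self]
      cases z k <;> cases s k <;> simp [boolSign]
    · intro j hj
      rw [Function.update_of_ne (Finset.ne_of_mem_erase hj)]
  · intro w _ hw
    have : ¬ z = Function.update w k (!w k) := by
      intro h
      apply hw
      rw [h]
      simp
    simp [sigmaX, this]
  · simp

/-- The first row of the X-basis unitary. -/
theorem mixer_zero_apply {n : ℕ} (β : Fin n → ℝ) (z : Bits n) :
    mixer β (fun _ => false) z =
      ∏ k, if z k then Complex.I * Complex.sin (β k) else Complex.cos (β k) := by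
  set lam : Bits n → ℂ := fun s => ∑ k, Complex.I * (β k : ℂ) * boolSign (s k) with hlam
  set V : Matrix (Bits n) (Bits n) ℂ := ((2 : ℂ) ^ n)⁻¹ • character n with hV
  have h2 : (2 : ℂ) ^ n ≠ 0 := pow_ne_zero _ two_ne_zero
  have hUV : character n * V = 1 := by
    rw [hV, Matrix.mul_smul, character_mul_self, smul_smul, inv_mul_cancel₀ h2, one_smul]
  have hinv : (character n)⁻¹ = V := Matrix.inv_eq_right_inv hUV
  have hunit : IsUnit (character n) := by
    rw [Matrix.isUnit_iff_isUnit_det]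
    exact Matrix.isUnit_det_of_right_inverse hUV
  have hA : (∑ k, (Complex.I * (β k : ℂ)) • sigmaX k) =
      character n * Matrix.diagonal lam * (character n)⁻¹ := by
    have h : (∑ k, (Complex.I * (β k : ℂ)) • sigmaX k) * character n =
        character n * Matrix.diagonal lam := by
      rw [Finset.sum_mul]
      simp only [Matrix.smul_mul, sigmaX_mul_character]
      simp only [← Matrix.mul_smul]
      rw [← Finset.mul_sum]
      congr 1
      ext s t
      by_cases hst : s = t
      · subst hst
        simp [Matrix.sum_apply, hlam]
      · simp [Matrix.sum_apply, hst]
    rw [← h, Matrix.mul_assoc, hinv, hUV, Matrix.mul_one]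
  rw [mixer, hA, Matrix.exp_conj _ _ hunit, Matrix.exp_diagonal, hinv, hV, Matrix.mul_apply]
  have hexp : ∀ s, NormedSpace.exp lam s =
      ∏ k, Complex.exp (Complex.I * (β k : ℂ) * boolSign (s k)) := by
    intro s
    rw [Pi.coe_exp, ← Complex.exp_sum, hlam, Complex.exp_eq_exp_ℂ]
  -- The row of `character` at the zero string is constantly 1, so what remains is an average over
  -- `s` of an exponential times a character, and both factor over the qubits.
  have hterm : ∀ s : Bits n,
      (character n * Matrix.diagonal (NormedSpace.exp lam)) (fun _ => false) s *
        (((2 : ℂ) ^ n)⁻¹ • character n) s z =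
      ∏ k, (2 : ℂ)⁻¹ * (Complex.exp (Complex.I * (β k : ℂ) * boolSign (s k)) *
        boolSign (s k && z k)) := by
    intro s
    rw [Matrix.mul_diagonal, hexp, Finset.prod_mul_distrib, Finset.prod_mul_distrib]
    simp [character, boolSign]
    ring
  simp only [hterm]
  rw [← prod_univ_sum_eq
    (fun k b => (2 : ℂ)⁻¹ * (Complex.exp (Complex.I * (β k : ℂ) * boolSign b) *
        boolSign (b && z k)))]
  refine Finset.prod_congr rfl fun k _ => ?_
  rw [Complex.sin, Complex.cos]
  have hI := Complex.I_mul_I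
  cases z k
  · simp [boolSign, mul_comm Complex.I]
    ring
  · simp [boolSign, mul_comm Complex.I]
    linear_combination (-(2 : ℂ)⁻¹) * (Complex.exp (-(↑(β k) * Complex.I)) -
      Complex.exp (↑(β k) * Complex.I)) * hI

/-- At π/4 sine and cosine agree, so a qubit in the state 1 differs from one in the state 0 only by
the factor i. The common factor 2^{-1/2} per qubit and the amplitude 2^{-n/2} of the uniform
superposition give 2^{-n}. -/
theorem qaoaProbZero_diagonal {n : ℕ} (d : Bits n → ℂ) :
    qaoaProbZero (Matrix.diagonal d) (fun _ => Real.pi / 4) =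
      ‖∑ z, (∏ k, if z k then Complex.I else 1) * d z‖ ^ 2 / 4 ^ n := by
  have hs : (1 / (Real.sqrt 2 : ℂ)) = ((Real.sqrt 2 / 2 : ℝ) : ℂ) := by
    rw [← Complex.ofReal_one, ← Complex.ofReal_div]
    congr 1
    have := Real.sqrt_pos.2 (zero_lt_two (α := ℝ))
    rw [div_eq_div_iff this.ne' two_ne_zero, Real.mul_self_sqrt zero_le_two, one_mul]
  have hr : ∀ z : Bits n, (∏ k, if z k then Complex.I * Complex.sin ((Real.pi / 4 : ℝ) : ℂ)
      else Complex.cos ((Real.pi / 4 : ℝ) : ℂ)) =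
      ((Real.sqrt 2 / 2 : ℝ) : ℂ) ^ n * ∏ k, if z k then Complex.I else 1 := by
    intro z
    rw [← Complex.ofReal_sin, ← Complex.ofReal_cos, Real.sin_pi_div_four, Real.cos_pi_div_four]
    have : ((Real.sqrt 2 / 2 : ℝ) : ℂ) ^ n = ∏ _k : Fin n, ((Real.sqrt 2 / 2 : ℝ) : ℂ) := by
      rw [Finset.prod_const, Finset.card_univ, Fintype.card_fin]
    rw [this, ← Finset.prod_mul_distrib]
    refine Finset.prod_congr rfl fun k _ => ?_
    split_ifs
    · ring
    · ring
  have hq : ((Real.sqrt 2 / 2 : ℝ) : ℂ) * ((Real.sqrt 2 / 2 : ℝ) : ℂ) = 2⁻¹ := by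
    rw [← Complex.ofReal_mul, div_mul_div_comm, Real.mul_self_sqrt zero_le_two]
    norm_num
  have hst : qaoaState (Matrix.diagonal d) (fun _ : Fin n => Real.pi / 4) (fun _ => false) =
      (2⁻¹ : ℂ) ^ n * ∑ z, (∏ k, if z k then Complex.I else 1) * d z := by
    rw [qaoaState, Matrix.mulVec, dotProduct, Finset.mul_sum]
    refine Finset.sum_congr rfl fun z _ => ?_
    rw [Matrix.mul_diagonal, mixer_zero_apply, hr, plusState, hs, ← hq, mul_pow]
    ring
  rw [qaoaProbZero, hst, norm_mul, norm_pow, mul_pow, norm_inv, Complex.norm_ofNat, ← pow_mul,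
    mul_comm n 2, pow_mul, inv_pow, inv_pow, div_eq_inv_mul]
  norm_num

theorem qaoaProbZero_phaseOracle (n : ℕ) (f : Bits n → ℤˣ) :
    qaoaProbZero (phaseOracle f) (fun _ => Real.pi / 4) =
      ((∑ z, ((f z : ℤˣ) : ℤ) : ℤ) : ℝ) ^ 2 / 2 ^ (2 * n) := by
  have h : ∀ z : Bits n, (∏ k, if z k then Complex.I else 1) *
      ((-Complex.I) ^ hammingWeight z * (((f z : ℤˣ) : ℤ) : ℂ)) = (((f z : ℤˣ) : ℤ) : ℂ) := by
    intro z
    rw [Finset.prod_ite, Finset.prod_const, Finset.prod_const_one, mul_one, ← mul_assoc,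
      hammingWeight, ← mul_pow]
    simp
  rw [phaseOracle, qaoaProbZero_diagonal, Finset.sum_congr rfl fun z _ => h z, pow_mul]
  norm_num
  rw [← Int.cast_sum, Complex.norm_intCast, sq_abs]
  push_cast
  rfl

/-! ## Circuits from lists of gates -/

/-- The eighth root of unity `e^{iπ/4}`. -/
noncomputable def omega8 : ℂ := Complex.exp (Complex.I * (Real.pi / 4 : ℝ))

/-- The phase `e^{iπb/4}`. -/
noncomputable def boolPhase (b : Bool) : ℂ := if b then omega8 else 1

/-- The phase of a gate on a basis state. -/
noncomputable def QGate.weight {κ : Type} (ζ : κ → Bool) : QGate κ → ℂ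
  | T j => boolPhase (ζ j)
  | CZ j k => boolSign (ζ j && ζ k)

/-- The phase of a list of gates on a basis state. -/
noncomputable def gatesWeight {κ : Type} (ζ : κ → Bool) (l : List (QGate κ)) : ℂ :=
  (l.map (QGate.weight ζ)).prod

/-- A gate acts on the first `n` qubits, and on two different ones if it is a `CZ` gate. -/
def QGate.Valid (n : ℕ) : QGate ℕ → Prop
  | T j => j < n
  | CZ j k => j < n ∧ k < n ∧ j ≠ k

/-- A valid gate as a gate of a circuit. -/
def QGate.toTCZ (n : ℕ) : QGate ℕ → Option (TCZGate n)
  | T j => if h : j < n then some (.T ⟨j, h⟩) else none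
  | CZ j k => if h : j < n ∧ k < n ∧ j ≠ k then
      some (.CZ ⟨j, h.1⟩ ⟨k, h.2.1⟩ fun e => h.2.2 (congrArg Fin.val e)) else none

/-- The circuit made of the valid gates of a list. -/
def TCZCircuit.ofGates (n : ℕ) (l : List (QGate ℕ)) : TCZCircuit :=
  ⟨n, l.filterMap (QGate.toTCZ n)⟩

/-- A bit string as an infinite sequence. -/
def extendBits {n : ℕ} (z : Bits n) (j : ℕ) : Bool := if h : j < n then z ⟨j, h⟩ else false

theorem encodeCircuit_ofGates {n : ℕ} {l : List (QGate ℕ)} (h : ∀ g ∈ l, g.Valid n) :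
    encodeCircuit (TCZCircuit.ofGates n l) = encodeUnary n ++ l.flatMap QGate.encode := by
  refine congrArg (encodeUnary n ++ ·) ?_
  induction l with
  | nil => rfl
  | cons g l ih =>
    have hl := ih fun g hg => h g (List.mem_cons_of_mem _ hg)
    have hg := h g List.mem_cons_self
    simp only [TCZCircuit.ofGates] at hl ⊢
    cases g with
    | T j =>
      simp only [QGate.Valid] at hg
      simp [QGate.toTCZ, hg, hl, QGate.encode, TCZGate.encode]
    | CZ j k =>
      simp only [QGate.Valid] at hg
      simp [QGate.toTCZ, hg, hl, QGate.encode, TCZGate.encode]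

theorem exists_toTCZ {n : ℕ} {g : QGate ℕ} (h : g.Valid n) :
    ∃ g', g.toTCZ n = some g' ∧
      g'.toZGate.toMatrix = Matrix.diagonal fun z => g.weight (extendBits z) := by
  cases g with
  | T j =>
    have h : j < n := h
    refine ⟨.T ⟨j, h⟩, dif_pos h, congrArg Matrix.diagonal (funext fun z => ?_)⟩
    simp only [QGate.weight, extendBits, dif_pos h, boolPhase]
    split_ifs
    · rw [omega8]
    · simp
  | CZ j k =>
    have h : j < n ∧ k < n ∧ j ≠ k := h
    refine ⟨.CZ ⟨j, h.1⟩ ⟨k, h.2.1⟩ fun e => h.2.2 (congrArg Fin.val e), dif_pos h,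
      congrArg Matrix.diagonal (funext fun z => ?_)⟩
    simp only [QGate.weight, extendBits, dif_pos h.1, dif_pos h.2.1, boolSign]
    split_ifs
    · rw [mul_comm, Complex.exp_pi_mul_I]
    · simp

theorem prod_toMatrix_filterMap {n : ℕ} {l : List (QGate ℕ)} (h : ∀ g ∈ l, g.Valid n) :
    (((l.filterMap (QGate.toTCZ n)).map TCZGate.toZGate).map ZGate.toMatrix).prod =
      Matrix.diagonal fun z : Bits n => gatesWeight (extendBits z) l := by
  induction l with
  | nil => exact Matrix.diagonal_one.symm
  | cons g l ih =>
    have hl := ih fun g hg => h g (List.mem_cons_of_mem _ hg)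
    obtain ⟨g', h1, h2⟩ := exists_toTCZ (h g List.mem_cons_self)
    rw [List.filterMap_cons_some h1, List.map_cons, List.map_cons, List.prod_cons, hl, h2,
      Matrix.diagonal_mul_diagonal]
    rfl

theorem zUnitary_ofGates {n : ℕ} {l : List (QGate ℕ)} (h : ∀ g ∈ l, g.Valid n) :
    (TCZCircuit.ofGates n l).toQAOA.zUnitary =
      Matrix.diagonal fun z : Bits n => gatesWeight (extendBits z) l :=
  prod_toMatrix_filterMap h

theorem probZero_ofGates {n : ℕ} {l : List (QGate ℕ)} (h : ∀ g ∈ l, g.Valid n) :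
    (TCZCircuit.ofGates n l).probZero =
      ‖∑ z : Bits n, (∏ k, if z k then Complex.I else 1) * gatesWeight (extendBits z) l‖ ^ 2 /
        4 ^ n := by
  rw [← qaoaProbZero_diagonal, ← zUnitary_ofGates h]
  rfl

/-! ## Blocks of qubits that check one step of a sequence -/

theorem omega8_pow_two : omega8 ^ 2 = Complex.I := by
  rw [omega8, ← Complex.exp_nat_mul]
  convert Complex.exp_pi_div_two_mul_I using 2
  push_cast
  ring

theorem omega8_pow_four : omega8 ^ 4 = -1 := by
  rw [show 4 = 2 * 2 from rfl, pow_mul, omega8_pow_two, Complex.I_sq]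

theorem omega8_pow_eight : omega8 ^ 8 = 1 := by
  rw [show 8 = 4 * 2 from rfl, pow_mul, omega8_pow_four]
  norm_num

theorem boolSign_eq (b : Bool) : boolSign b = 1 ∨ boolSign b = -1 := by
  cases b <;> simp [boolSign]

section Weight

variable {κ : Type} (ζ : κ → Bool)

@[simp] theorem gatesWeight_nil : gatesWeight ζ [] = 1 := rfl

@[simp] theorem gatesWeight_cons (g : QGate κ) (l : List (QGate κ)) :
    gatesWeight ζ (g :: l) = g.weight ζ * gatesWeight ζ l := by
  simp [gatesWeight]

@[simp] theorem gatesWeight_append (l l' : List (QGate κ)) :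
    gatesWeight ζ (l ++ l') = gatesWeight ζ l * gatesWeight ζ l' := by
  simp [gatesWeight]

theorem gatesWeight_flatMap_univ {ι : Type} [Fintype ι] (f : ι → List (QGate κ)) :
    gatesWeight ζ (Finset.univ.toList.flatMap f) = ∏ i, gatesWeight ζ (f i) := by
  rw [← Finset.prod_map_toList]
  generalize (Finset.univ : Finset ι).toList = l
  induction l with
  | nil => rfl
  | cons i l ih => simp [ih]

@[simp] theorem gatesWeight_replicate (n : ℕ) (g : QGate κ) :
    gatesWeight ζ (List.replicate n g) = g.weight ζ ^ n := by
  simp [gatesWeight]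

theorem gatesWeight_map {κ' : Type} (f : κ' → κ) (l : List (QGate κ')) :
    gatesWeight ζ (l.map (QGate.map f)) = gatesWeight (fun j => ζ (f j)) l := by
  rw [gatesWeight, List.map_map, gatesWeight]
  congr 2
  funext g
  cases g <;> rfl

end Weight

/-- The qubits of a block: for every letter a qubit that indicates whether the cell holds this
letter and a qubit whose sum checks this value, and for every pair of letters four pairs of qubits
that compute parities. -/
abbrev BlockQubit (A : Type) : Type := (A ⊕ A) ⊕ ((A × A × Fin 4) ⊕ (A × A × Fin 4))

/-- What the cell of a block has to contain: a given letter, one of two given letters, or the letter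
determined by the two cells it depends on. -/
inductive CellKind (A : Type) : Type
  | const (a : A)
  | free (a a' : A)
  | later

namespace Block

variable {A : Type}

/-- The qubit that indicates a letter. -/
def qw (s : Shift) (a : A) : Shift × BlockQubit A := (s, Sum.inl (Sum.inl a))

/-- The qubit that checks the value of the indicator of a letter. -/
def qu (a : A) : Shift × BlockQubit A := (.cur, Sum.inl (Sum.inr a))

/-- A qubit that holds a parity. -/
def qv (p : A × A) (i : Fin 4) : Shift × BlockQubit A := (.cur, Sum.inr (Sum.inl (p.1, p.2, i)))

/-- A qubit that checks a parity. -/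
def qm (p : A × A) (i : Fin 4) : Shift × BlockQubit A := (.cur, Sum.inr (Sum.inr (p.1, p.2, i)))

/-- The qubits whose parities are computed. -/
def parityInputs (F : A → A → A) (p : A × A) : Fin 4 → List (Shift × BlockQubit A) :=
  ![[qu (F p.1 p.2), qw .prev p.1], [qu (F p.1 p.2), qw .del p.2], [qw .prev p.1, qw .del p.2],
    [qu (F p.1 p.2), qw .prev p.1, qw .del p.2]]

/-- The multiples of `π/4` by which the parities are rotated. -/
def parityAngle : Fin 4 → ℕ := ![7, 7, 7, 1]

/-- Gates that multiply by the sign `(-1)^{uxy}`, where `u` checks a letter and `x` and `y`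
indicate two letters by which it can be determined. -/
noncomputable def cubicGates (F : A → A → A) (p : A × A) : List (QGate (Shift × BlockQubit A)) :=
  [.T (qu (F p.1 p.2)), .T (qw .prev p.1), .T (qw .del p.2)] ++
    (Finset.univ : Finset (Fin 4)).toList.flatMap fun i =>
      List.replicate (parityAngle i) (.T (qv p i)) ++
        .CZ (qm p i) (qv p i) :: (parityInputs F p i).map (.CZ (qm p i))

variable [Fintype A]

/-- Gates that cancel the phases of the X-rotations. -/
noncomputable def phaseGates : List (QGate (Shift × BlockQubit A)) :=
  Finset.univ.toList.flatMap fun q => List.replicate 6 (.T (.cur, q))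

/-- The auxiliary qubits of a block. -/
abbrev Aux (A : Type) : Type := (A → Bool) × ((A × A × Fin 4 → Bool) × (A × A × Fin 4 → Bool))

/-- The values of the qubits of a block, given those of the indicators and of the auxiliary
qubits. -/
def joinAux (w : A → Bool) (r : Aux A) : BlockQubit A → Bool :=
  Sum.elim (Sum.elim w r.1) (Sum.elim r.2.1 r.2.2)

/-- The values of the qubits of three blocks. -/
def joinShift (z x y : BlockQubit A → Bool) : Shift × BlockQubit A → Bool
  | (.cur, q) => z q
  | (.prev, q) => x q
  | (.del, q) => y q

theorem phaseGates_weight (z x y : BlockQubit A → Bool) :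
    (∏ q, if z q then Complex.I else 1) * gatesWeight (joinShift z x y) phaseGates = 1 := by
  rw [phaseGates, gatesWeight_flatMap_univ, ← Finset.prod_mul_distrib]
  refine Finset.prod_eq_one fun q _ => ?_
  rw [gatesWeight_replicate]
  change _ * boolPhase (z q) ^ 6 = 1
  cases z q
  · simp [boolPhase]
  · simp only [if_true, boolPhase]
    rw [← omega8_pow_two, ← pow_add, omega8_pow_eight]

/-- A single wrong sign annihilates the product. This is how sums over check qubits enforce
constraints. -/
theorem prod_one_add_sign (s : A → ℂ) (hs : ∀ a, s a = 1 ∨ s a = -1) :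
    ∏ a, (1 + s a) = if ∀ a, s a = 1 then 2 ^ Fintype.card A else 0 := by
  split_ifs with h
  · simp only [h, one_add_one_eq_two, Finset.prod_const, Finset.card_univ]
  · push Not at h
    obtain ⟨a, ha⟩ := h
    exact Finset.prod_eq_zero (Finset.mem_univ a) (by rw [(hs a).resolve_left ha]; norm_num)

variable [DecidableEq A]

/-- Gates that check the content of the cell. -/
noncomputable def checkGates (F : A → A → A) : CellKind A → List (QGate (Shift × BlockQubit A))
  | .const a₀ => Finset.univ.toList.flatMap fun a =>
      .CZ (qu a) (qw .cur a) :: if a = a₀ then List.replicate 4 (.T (qu a)) else []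
  | .free t f => Finset.univ.toList.flatMap fun a =>
      if a = t then [] else
        .CZ (qu a) (qw .cur a) ::
          if a = f then .CZ (qu a) (qw .cur t) :: List.replicate 4 (.T (qu a)) else []
  | .later => (Finset.univ.toList.flatMap fun a => [.CZ (qu a) (qw .cur a)]) ++
      Finset.univ.toList.flatMap (cubicGates F)

/-- The gates of a block. -/
noncomputable def gates (F : A → A → A) (c : CellKind A) : List (QGate (Shift × BlockQubit A)) :=
  phaseGates ++ checkGates F c

/-- The sign `1` if the indicator of a letter has the required value, and `-1` otherwise. -/
noncomputable def checkSign (F : A → A → A) (w x y : A → Bool) : CellKind A → A → ℂ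
  | .const a₀, a => boolSign (w a) * if a = a₀ then -1 else 1
  | .free t f, a => if a = t then 1 else boolSign (w a) * if a = f then -boolSign (w t) else 1
  | .later, a => boolSign (w a) * ∏ p : A × A with F p.1 p.2 = a, boolSign (x p.1 && y p.2)

theorem checkSign_eq (F : A → A → A) (w x y : A → Bool) (c : CellKind A) (a : A) :
    checkSign F w x y c a = 1 ∨ checkSign F w x y c a = -1 := by
  have hmul : ∀ {s t : ℂ}, (s = 1 ∨ s = -1) → (t = 1 ∨ t = -1) → (s * t = 1 ∨ s * t = -1) := by
    rintro s t (rfl | rfl) (rfl | rfl) <;> simp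
  cases c with
  | const a₀ =>
    refine hmul (boolSign_eq _) ?_
    split_ifs <;> simp
  | free t f =>
    simp only [checkSign]
    split_ifs
    · simp
    · refine hmul (boolSign_eq _) ?_
      rcases boolSign_eq (w t) with h | h <;> simp [h]
    · exact hmul (boolSign_eq _) (by simp)
  | later =>
    refine hmul (boolSign_eq _) ?_
    exact Finset.prod_induction _ (fun s : ℂ => s = 1 ∨ s = -1) (fun _ _ => hmul) (by simp)
      fun _ _ => boolSign_eq _

/-- The sum over the checking qubits. -/
theorem sum_prod_check (s : A → ℂ) (hs : ∀ a, s a = 1 ∨ s a = -1) :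
    ∑ U : A → Bool, ∏ a, (if U a then s a else 1) =
      if ∀ a, s a = 1 then 2 ^ Fintype.card A else 0 := by
  rw [← prod_one_add_sign s hs]
  have h : ∀ a, 1 + s a = ∑ b : Bool, if b then s a else 1 := fun a => by simp [add_comm]
  simp only [h]
  rw [prod_univ_sum_eq]

/-- The sum over `m` vanishes unless `v = b`. Hence `v` acts as a register for a parity `b`,
although diagonal gates cannot compute anything into a qubit. -/
theorem sum_parity (e : ℕ) (b : Bool) :
    ∑ v : Bool, ∑ m : Bool, boolPhase v ^ e * (boolSign (m && v) * boolSign (m && b))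
      = 2 * boolPhase b ^ e := by
  cases b <;> simp [boolSign, boolPhase] <;> ring

/-- For bits, 4uxy = u + x + y - (u⊕x) - (u⊕y) - (x⊕y) + (u⊕x⊕y), and `omega8 ^ 4 = -1`. The
exponent 7 stands for -1 modulo 8. -/
theorem cubic_phase (u x y : Bool) :
    boolPhase u * (boolPhase x * boolPhase y) *
      (boolPhase (u ^^ x) ^ 7 * boolPhase (u ^^ y) ^ 7 *
        boolPhase (x ^^ y) ^ 7 * boolPhase (u ^^ x ^^ y) ^ 1) =
      boolSign (u && x && y) := by
  have h4 := omega8_pow_four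
  have h8 := omega8_pow_eight
  have h16 : omega8 ^ 16 = 1 := by rw [show 16 = 8 * 2 from rfl, pow_mul, h8, one_pow]
  cases u <;> cases x <;> cases y <;> simp [boolSign, boolPhase] <;> ring_nf <;> assumption

/-- Every pair of letters has its own four parity registers, so the sum factors. Each register
contributes a factor 2 besides its phase, which makes 16 per pair. -/
theorem sum_cubicGates (F : A → A → A) (w U x y : A → Bool) (xr yr : Aux A) :
    ∑ r : (A × A × Fin 4 → Bool) × (A × A × Fin 4 → Bool), ∏ p,
      gatesWeight (joinShift (joinAux w (U, r)) (joinAux x xr) (joinAux y yr)) (cubicGates F p) =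
    ∏ p : A × A, (16 * boolSign (U (F p.1 p.2) && x p.1 && y p.2)) := by
  set par : A × A × Fin 4 → Bool := fun j =>
    ![U (F j.1 j.2.1) ^^ x j.1, U (F j.1 j.2.1) ^^ y j.2.1, x j.1 ^^ y j.2.1,
      U (F j.1 j.2.1) ^^ x j.1 ^^ y j.2.1] j.2.2 with hpar
  set lin : A × A → ℂ := fun p => boolPhase (U (F p.1 p.2)) *
    (boolPhase (x p.1) * boolPhase (y p.2)) with hlin
  set h : A × A × Fin 4 → Bool → Bool → ℂ := fun j v m =>
    boolPhase v ^ parityAngle j.2.2 * (boolSign (m && v) * boolSign (m && par j))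
    with hh
  have e1 : ∀ V M : A × A × Fin 4 → Bool, ∏ p,
      gatesWeight (joinShift (joinAux w (U, V, M)) (joinAux x xr) (joinAux y yr))
        (cubicGates F p) = (∏ p, lin p) * ∏ j, h j (V j) (M j) := by
    intro V M
    have hassoc : ∏ j, h j (V j) (M j) =
        ∏ p : A × A, ∏ i : Fin 4, h (p.1, p.2, i) (V (p.1, p.2, i)) (M (p.1, p.2, i)) := by
      rw [Fintype.prod_prod_type, Fintype.prod_prod_type]
      refine Finset.prod_congr rfl fun a _ => ?_
      rw [Fintype.prod_prod_type]
    rw [hassoc, ← Finset.prod_mul_distrib]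
    refine Finset.prod_congr rfl fun p _ => ?_
    rw [cubicGates, gatesWeight_append, gatesWeight_flatMap_univ]
    congr 1
    · simp [QGate.weight, hlin, joinShift, joinAux, qu, qw]
    · refine Finset.prod_congr rfl fun i _ => ?_
      rw [gatesWeight_append, gatesWeight_replicate, gatesWeight_cons]
      have hb : ∀ m b c : Bool, boolSign (m && b) * boolSign (m && c) = boolSign (m && (b ^^ c)) := by
        intro m b c
        cases m <;> cases b <;> cases c <;> simp [boolSign]
      fin_cases i <;>
        simp [QGate.weight, hh, hpar, joinShift, joinAux, qu, qw, qv, qm, parityInputs, hb]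
  rw [Fintype.sum_prod_type]
  have e0 : ∑ V : A × A × Fin 4 → Bool, ∑ M : A × A × Fin 4 → Bool,
      (∏ p, lin p) * ∏ j, h j (V j) (M j) = (∏ p, lin p) *
        ∑ V : A × A × Fin 4 → Bool, ∑ M : A × A × Fin 4 → Bool, ∏ j, h j (V j) (M j) := by
    rw [Finset.mul_sum]
    refine Finset.sum_congr rfl fun V _ => ?_
    rw [Finset.mul_sum]
  rw [(Finset.sum_congr rfl fun V _ => Finset.sum_congr rfl fun M _ => e1 V M), e0]
  have e2 : ∑ V : A × A × Fin 4 → Bool, ∑ M : A × A × Fin 4 → Bool, ∏ j, h j (V j) (M j) =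
      ∏ j, (2 * boolPhase (par j) ^ parityAngle j.2.2) := by
    rw [Finset.sum_congr rfl fun V _ => (prod_univ_sum_eq fun j m => h j (V j) m).symm,
      ← prod_univ_sum_eq fun j v => ∑ m, h j v m]
    exact Finset.prod_congr rfl fun j _ => sum_parity _ _
  have e3 : ∏ j, (2 * boolPhase (par j) ^ parityAngle j.2.2 : ℂ) =
      ∏ p : A × A, ∏ i : Fin 4,
        (2 * boolPhase (par (p.1, p.2, i)) ^ parityAngle i : ℂ) := by
    rw [Fintype.prod_prod_type, Fintype.prod_prod_type]
    refine Finset.prod_congr rfl fun a _ => ?_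
    rw [Fintype.prod_prod_type]
  rw [e2, e3, ← Finset.prod_mul_distrib]
  refine Finset.prod_congr rfl fun p _ => ?_
  rw [← cubic_phase, Fin.prod_univ_four]
  simp [hpar, hlin, parityAngle]
  ring

/-- The sum over the auxiliary qubits of a block checks the content of its cell. -/
theorem exists_sum_aux [Nonempty A] (F : A → A → A) (c : CellKind A) :
    ∃ C : ℕ, 2 ≤ C ∧ ∀ (w x y : A → Bool) (xr yr : Aux A),
      ∑ r : Aux A, (∏ q, if joinAux w r q then Complex.I else 1) *
        gatesWeight (joinShift (joinAux w r) (joinAux x xr) (joinAux y yr)) (gates F c) =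
      if ∀ a, checkSign F w x y c a = 1 then (C : ℂ) else 0 := by
  -- The bound 2, rather than positivity, is what later raises the gap from 2^{-2n} to 4 · 2^{-2n}.
  have hcard : 2 ≤ 2 ^ Fintype.card A :=
    (Nat.le_self_pow Fintype.card_ne_zero 2)
  have hle : ∀ k : ℕ, 0 < k → 2 ≤ 2 ^ Fintype.card A * k := fun k hk =>
    hcard.trans (Nat.le_mul_of_pos_right _ hk)
  have hg : ∀ (w x y : A → Bool) (r xr yr : Aux A),
      (∏ q, if joinAux w r q then Complex.I else 1) *
        gatesWeight (joinShift (joinAux w r) (joinAux x xr) (joinAux y yr)) (gates F c) =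
      gatesWeight (joinShift (joinAux w r) (joinAux x xr) (joinAux y yr)) (checkGates F c) := by
    intro w x y r xr yr
    rw [gates, gatesWeight_append, ← mul_assoc, phaseGates_weight, one_mul]
  simp only [hg]
  have hmul : omega8 * (omega8 * (omega8 * omega8)) = -1 := by
    rw [← omega8_pow_four]
    ring
  -- Without cubic gates the parity registers are idle and contribute only the number of their
  -- states.
  have simple : ∀ (w x y : A → Bool) (xr yr : Aux A),
      (∀ r : Aux A, gatesWeight (joinShift (joinAux w r) (joinAux x xr) (joinAux y yr))
        (checkGates F c) = ∏ a, if r.1 a then checkSign F w x y c a else 1) →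
      ∑ r : Aux A, gatesWeight (joinShift (joinAux w r) (joinAux x xr) (joinAux y yr))
        (checkGates F c) =
      if ∀ a, checkSign F w x y c a = 1 then
        ((2 ^ Fintype.card A * Fintype.card ((A × A × Fin 4 → Bool) × (A × A × Fin 4 → Bool)) : ℕ)
          : ℂ) else 0 := by
    intro w x y xr yr h
    simp only [h]
    rw [Fintype.sum_prod_type]
    have e : ∀ U : A → Bool,
        ∑ _r : (A × A × Fin 4 → Bool) × (A × A × Fin 4 → Bool),
          ∏ a, (if U a then checkSign F w x y c a else 1) =
        (Fintype.card ((A × A × Fin 4 → Bool) × (A × A × Fin 4 → Bool)) : ℂ) *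
          ∏ a, (if U a then checkSign F w x y c a else 1) := fun U => by
      rw [Finset.sum_const, Finset.card_univ, nsmul_eq_mul]
    simp only [e]
    rw [← Finset.mul_sum, sum_prod_check _ (checkSign_eq F w x y c)]
    split_ifs
    · rw [Nat.cast_mul, mul_comm]
      push_cast
      rfl
    · simp
  cases c with
  | const a₀ =>
    refine ⟨_, hle _ Fintype.card_pos, fun w x y xr yr => simple w x y xr yr fun r => ?_⟩
    rw [checkGates, gatesWeight_flatMap_univ]
    refine Finset.prod_congr rfl fun a _ => ?_
    rcases eq_or_ne a a₀ with rfl | ha <;> cases hr : r.1 a <;>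
      simp [*, QGate.weight, joinShift, joinAux, qu, qw, checkSign, boolSign, boolPhase]
  | free t f =>
    refine ⟨_, hle _ Fintype.card_pos, fun w x y xr yr => simple w x y xr yr fun r => ?_⟩
    rw [checkGates, gatesWeight_flatMap_univ]
    refine Finset.prod_congr rfl fun a _ => ?_
    by_cases ht : a = t
    · simp [ht, checkSign]
    · rcases eq_or_ne a f with rfl | hf <;> cases hr : r.1 a <;>
        simp [*, QGate.weight, joinShift, joinAux, qu, qw, checkSign, boolSign, boolPhase]
  | later =>
    refine ⟨2 ^ Fintype.card A * 16 ^ Fintype.card (A × A), hle _ (by positivity),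
      fun w x y xr yr => ?_⟩
    rw [Fintype.sum_prod_type]
    have e : ∀ U : A → Bool, ∑ r : (A × A × Fin 4 → Bool) × (A × A × Fin 4 → Bool),
        gatesWeight (joinShift (joinAux w (U, r)) (joinAux x xr) (joinAux y yr))
          (checkGates F .later) =
        16 ^ Fintype.card (A × A) *
          ∏ a, if U a then checkSign F w x y .later a else 1 := by
      intro U
      simp only [checkGates, gatesWeight_append, gatesWeight_flatMap_univ]
      have e1 : ∀ r : (A × A × Fin 4 → Bool) × (A × A × Fin 4 → Bool), ∏ a,
          gatesWeight (joinShift (joinAux w (U, r)) (joinAux x xr) (joinAux y yr))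
            [QGate.CZ (qu a) (qw .cur a)] = ∏ a, boolSign (U a && w a) := by
        intro r
        simp [QGate.weight, joinShift, joinAux, qu, qw]
      simp only [e1]
      -- The pairs are grouped by their value under `F`, since all pairs with the value `a` share
      -- the check qubit of `a`.
      rw [← Finset.mul_sum, sum_cubicGates, Finset.prod_mul_distrib, Finset.prod_const,
        Finset.card_univ, mul_left_comm,
        ← Finset.prod_fiberwise Finset.univ (fun p : A × A => F p.1 p.2)
          (fun p => boolSign (U (F p.1 p.2) && x p.1 && y p.2)), ← Finset.prod_mul_distrib]
      congr 1
      refine Finset.prod_congr rfl fun a _ => ?_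
      have e2 : ∏ p : A × A with F p.1 p.2 = a, boolSign (U (F p.1 p.2) && x p.1 && y p.2) =
          ∏ p : A × A with F p.1 p.2 = a, boolSign (U a && x p.1 && y p.2) :=
        Finset.prod_congr rfl fun p hp => by rw [(Finset.mem_filter.1 hp).2]
      rw [e2]
      cases U a
      · simp [boolSign]
      · simp [checkSign]
    simp only [e]
    rw [← Finset.mul_sum, sum_prod_check _ (checkSign_eq F w x y .later)]
    split_ifs
    · push_cast
      ring
    · simp

end Block

/-! ## Chains of blocks -/

/-- A finite sequence, continued by a default value. -/
def extendFin {X : Type} [Inhabited X] {n : ℕ} (g : Fin n → X) (k : ℕ) : X :=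
  if h : k < n then g ⟨k, h⟩ else default

@[simp] theorem extendFin_val {X : Type} [Inhabited X] {n : ℕ} (g : Fin n → X) (k : Fin n) :
    extendFin g k = g k := by
  simp [extendFin]

theorem extendFin_of_lt {X : Type} [Inhabited X] {n : ℕ} (g : Fin n → X) {k : ℕ} (h : k < n) :
    extendFin g k = g ⟨k, h⟩ := by
  simp [extendFin, h]

namespace Block

variable {A : Type}

/-- The sequence of letters that satisfies all checks, given the choices of the free letters. -/
def cellSeq (F : A → A → A) (kind : ℕ → CellKind A) (D : ℕ) (c₀ : A) (v : ℕ → Bool) : ℕ → A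
  | 0 => c₀
  | k + 1 => match kind (k + 1) with
    | .const a => a
    | .free t f => if v (k + 1) then t else f
    -- For `1 ≤ D` the second index is `k + 1 - D`. In this form it is at most `k` for every `D`, as
    -- the recursion requires.
    | .later => F (cellSeq F kind D c₀ v k) (cellSeq F kind D c₀ v (k - (D - 1)))

/-- The roles of the cells of a chain: the first cell holds the letter `c₀`, and the free cells,
which hold `t` or `f`, are the `q` cells from `s` on. -/
structure IsChain (kind : ℕ → CellKind A) (c₀ t f : A) (s q : ℕ) : Prop where
  zero : kind 0 = .const c₀
  free : ∀ i < q, kind (s + i) = .free t f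
  of_free : ∀ k t' f', kind k = .free t' f' → t' = t ∧ f' = f ∧ s ≤ k ∧ k < s + q
  ne : t ≠ f

variable {kind : ℕ → CellKind A} {c₀ t f : A} {s q : ℕ}

theorem cellSeq_free (h : IsChain kind c₀ t f s q) (F : A → A → A) (D : ℕ) (v : ℕ → Bool) {i : ℕ}
    (hi : i < q) : cellSeq F kind D c₀ v (s + i) = if v (s + i) then t else f := by
  have hk := h.free i hi
  obtain ⟨k, hs⟩ : ∃ k, s + i = k + 1 := by
    refine Nat.exists_eq_succ_of_ne_zero fun h0 => ?_
    rw [h0, h.zero] at hk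
    cases hk
  rw [hs] at hk ⊢
  rw [cellSeq, hk]

variable [DecidableEq A]

/-- The indicator of a letter. -/
def ind (a : A) (b : A) : Bool := decide (b = a)

theorem ind_injective : Function.Injective (ind : A → A → Bool) := fun a b h => by
  simpa [ind] using congrFun h a

variable [Fintype A]

theorem checkSign_const (F : A → A → A) (w x y : A → Bool) (a₀ : A) :
    (∀ a, checkSign F w x y (.const a₀) a = 1) ↔ w = ind a₀ := by
  rw [funext_iff]
  refine forall_congr' fun a => ?_
  rcases eq_or_ne a a₀ with rfl | ha <;> cases hw : w a <;>
    simp [checkSign, boolSign, ind, *] <;> norm_num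

/-- The letter `t` is not checked and carries the free bit. The sign of `f` demands that `w f` and
`w t` differ, and every other letter must be absent. -/
theorem checkSign_free (F : A → A → A) (w x y : A → Bool) {t f : A} (h : t ≠ f) :
    (∀ a, checkSign F w x y (.free t f) a = 1) ↔ w = ind (if w t then t else f) := by
  rw [funext_iff]
  refine forall_congr' fun a => ?_
  rcases eq_or_ne a t with rfl | ht
  · cases w a <;> simp [checkSign, ind, h]
  · rcases eq_or_ne a f with rfl | hf
    · cases hw : w a <;> cases hv : w t <;> simp [checkSign, boolSign, ind, hw, hv, ht] <;> norm_num
    · cases hw : w a <;> cases w t <;>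
        simp [checkSign, boolSign, ind, hw, ht, hf] <;> norm_num

/-- If both neighbours are indicators, only the pair `(b, c)` contributes a factor -1, and it does
so exactly in the product belonging to the letter `F b c`. -/
theorem checkSign_later (F : A → A → A) (w : A → Bool) (b c : A) :
    (∀ a, checkSign F w (ind b) (ind c) .later a = 1) ↔ w = ind (F b c) := by
  rw [funext_iff]
  refine forall_congr' fun a => ?_
  have h : ∏ p : A × A with F p.1 p.2 = a, boolSign (ind b p.1 && ind c p.2) =
      if F b c = a then -1 else 1 := by
    have e : ∀ p : A × A, boolSign (ind b p.1 && ind c p.2) = if p = (b, c) then -1 else 1 := by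
      intro p
      simp [boolSign, ind, Prod.ext_iff]
    simp only [e]
    rw [Finset.prod_ite_eq']
    simp
  rw [checkSign, h]
  by_cases ha : a = F b c
  · cases w a <;> simp [boolSign, ind, ha.symm]
    norm_num
  · cases w a <;> simp [boolSign, ind, ha, Ne.symm ha]
    norm_num

/-- The checks hold for a step if and only if the cell holds the letter of the sequence. -/
theorem checkSign_cellSeq (h : IsChain kind c₀ t f s q) (F : A → A → A) {D : ℕ} (hD : 1 ≤ D)
    (v : ℕ → Bool) (w : A → Bool) (k : ℕ) (hv : ∀ t f, kind k = .free t f → v k = w t) :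
    (∀ a, checkSign F w (ind (cellSeq F kind D c₀ v (k - 1)))
      (ind (cellSeq F kind D c₀ v (k - D))) (kind k) a = 1) ↔
      w = ind (cellSeq F kind D c₀ v k) := by
  cases k with
  | zero => rw [h.zero, checkSign_const, cellSeq]
  | succ k =>
    cases hk : kind (k + 1) with
    | const a => rw [checkSign_const, cellSeq, hk]
    | free t' f' =>
      have ht := h.of_free _ _ _ hk
      rw [checkSign_free _ _ _ _ (ht.1 ▸ ht.2.1 ▸ h.ne), cellSeq, hk, hv _ _ hk]
    | later =>
      rw [checkSign_later, cellSeq, hk]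
      have e : k + 1 - D = k - (D - 1) := by omega
      rw [e, Nat.add_sub_cancel]

/-- The choices of the free letters given by a string. -/
def choice (s : ℕ) {q : ℕ} (y : Bits q) (k : ℕ) : Bool := extendBits y (k - s)

theorem choice_add (s : ℕ) {q : ℕ} (y : Bits q) (i : Fin q) : choice s y (s + i) = y i := by
  simp [choice, extendBits]

/-- The checks determine the cells one after another from the earlier ones, except for the free
cells, whose indicators of `t` are the bits of `y`. -/
theorem checks_iff (h : IsChain kind c₀ t f s q) (F : A → A → A) {D : ℕ} (hD : 1 ≤ D)
    {P : ℕ} (W : ℕ → A → Bool) :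
    (∀ k < P, ∀ a, checkSign F (W k) (W (k - 1)) (W (k - D)) (kind k) a = 1) ↔
      ∃ y : Bits q, ∀ k < P, W k = ind (cellSeq F kind D c₀ (choice s y) k) := by
  have hlt : ∀ k < P, k - 1 < P ∧ k - D < P := fun k hk => ⟨by omega, by omega⟩
  constructor
  · intro hW
    refine ⟨fun i => W (s + i) t, fun k => ?_⟩
    induction k using Nat.strong_induction_on with
    | _ k ih =>
      intro hk
      rw [← checkSign_cellSeq h F hD]
      · intro a
        have := hW k hk a
        -- For `k = 0` the truncated indices `k - 1` and `k - D` are 0 again, where the induction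
        -- hypothesis says nothing; but the check of a constant ignores them.
        rcases Nat.eq_zero_or_pos k with rfl | h0
        · rw [h.zero] at this ⊢
          exact this
        · rwa [ih (k - 1) (by omega) (hlt k hk).1, ih (k - D) (by omega) (hlt k hk).2] at this
      · intro t' f' hf
        obtain ⟨rfl, -, h1, h2⟩ := h.of_free _ _ _ hf
        obtain ⟨i, rfl⟩ := Nat.exists_eq_add_of_le h1
        exact choice_add s _ ⟨i, by omega⟩
  · rintro ⟨y, hy⟩ k hk
    rw [hy _ (hlt k hk).1, hy _ (hlt k hk).2, checkSign_cellSeq h F hD]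
    · exact hy k hk
    · intro t' f' hf
      obtain ⟨rfl, rfl, h1, h2⟩ := h.of_free _ _ _ hf
      obtain ⟨i, rfl⟩ := Nat.exists_eq_add_of_le h1
      rw [hy _ hk, cellSeq_free h F D _ (by omega : i < q)]
      cases choice s y (s + i) <;> simp [ind, h.ne]

/-- The surviving assignments are those of the chains given by the strings `y`. They are different
for different `y`, because `t ≠ f` and all free cells lie within the first `P` cells. -/
theorem sum_checks (h : IsChain kind c₀ t f s q) (F : A → A → A) {D : ℕ} (hD : 1 ≤ D)
    {P : ℕ} (hP : s + q ≤ P) (G : (Fin P → A → Bool) → ℂ) (C : Fin P → ℂ) :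
    ∑ W : Fin P → A → Bool, G W * ∏ k : Fin P,
      (if ∀ a, checkSign F (extendFin W k) (extendFin W (k - 1)) (extendFin W (k - D))
        (kind k) a = 1 then C k else 0) =
    (∏ k, C k) * ∑ y : Bits q, G fun k => ind (cellSeq F kind D c₀ (choice s y) k) := by
  classical
  set Φ : Bits q → Fin P → A → Bool := fun y k => ind (cellSeq F kind D c₀ (choice s y) k) with hΦ
  have hinj : Function.Injective Φ := by
    intro y y' hy
    funext i
    have := ind_injective (congrFun hy ⟨s + i, by omega⟩)
    rw [cellSeq_free h F D _ i.2, cellSeq_free h F D _ i.2, choice_add, choice_add] at this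
    have hne := h.ne
    cases hi : y i <;> cases hi' : y' i <;> simp_all [hne.symm]
  have hmem : ∀ W : Fin P → A → Bool, (∀ k : Fin P, ∀ a, checkSign F (extendFin W k)
      (extendFin W (k - 1)) (extendFin W (k - D)) (kind k) a = 1) ↔
        W ∈ Finset.univ.image Φ := by
    intro W
    have := checks_iff (P := P) h F hD (extendFin W)
    rw [Finset.mem_image]
    constructor
    · intro hW
      obtain ⟨y, hy⟩ := this.1 fun k hk => hW ⟨k, hk⟩
      refine ⟨y, Finset.mem_univ _, funext fun k => ?_⟩
      rw [← extendFin_val W k, hy k k.2]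
    · rintro ⟨y, -, rfl⟩ k
      exact this.2 ⟨y, fun k hk => extendFin_of_lt _ hk⟩ k k.2
  simp only [Finset.prod_ite_zero, Finset.mem_univ, true_imp_iff, hmem]
  simp only [mul_ite, mul_zero]
  rw [← Finset.sum_filter, Finset.filter_mem_eq_inter, Finset.univ_inter,
    Finset.sum_image hinj.injOn, Finset.mul_sum]
  exact Finset.sum_congr rfl fun _ _ => mul_comm _ _

end Block

/-! ## Gates on blocks of qubits -/

/-- The qubits on which a gate acts. -/
def QGate.qubits {κ : Type} : QGate κ → List κ
  | T j => [j]
  | CZ j k => [j, k]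

theorem gatesWeight_congr {κ : Type} {ζ ζ' : κ → Bool} {l : List (QGate κ)}
    (h : ∀ g ∈ l, ∀ j ∈ g.qubits, ζ j = ζ' j) : gatesWeight ζ l = gatesWeight ζ' l := by
  refine congrArg List.prod (List.map_congr_left fun g hg => ?_)
  have := h g hg
  cases g <;> simp_all [QGate.qubits, QGate.weight]

namespace Block

variable {A : Type}

/-- A gate acts on the current block and on indicators in other blocks; its qubits are at different
places of the blocks. -/
def IsLocal (g : QGate (Shift × BlockQubit A)) : Prop :=
  (∀ j ∈ g.qubits, j.1 = .cur ∨ ∃ a, j.2 = Sum.inl (Sum.inl a)) ∧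
    (g.qubits.map Prod.snd).Nodup

theorem isLocal_T (j : Shift × BlockQubit A) (hj : j.1 = .cur ∨ ∃ a, j.2 = Sum.inl (Sum.inl a)) :
    IsLocal (.T j) := by
  simpa [IsLocal, QGate.qubits] using hj

theorem isLocal_CZ (j k : Shift × BlockQubit A) (hj : j.1 = .cur)
    (hk : k.1 = .cur ∨ ∃ a, k.2 = Sum.inl (Sum.inl a)) (h : j.2 ≠ k.2) : IsLocal (.CZ j k) := by
  simp [IsLocal, QGate.qubits, hj, hk, h]

theorem isLocal_cubicGates (F : A → A → A) (p : A × A) : ∀ g ∈ cubicGates F p, IsLocal g := by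
  have hT : ∀ i, ∀ j ∈ parityInputs F p i, j.1 = .cur ∨ ∃ a, j.2 = Sum.inl (Sum.inl a) := by
    intro i
    fin_cases i <;> simp [parityInputs, qu, qw]
  have hne : ∀ i, ∀ j ∈ parityInputs F p i, (qm p i).2 ≠ j.2 := by
    intro i
    fin_cases i <;> simp [parityInputs, qu, qw, qm]
  intro g hg
  simp only [cubicGates, List.mem_append, List.mem_cons, List.not_mem_nil, or_false,
    List.mem_flatMap, List.mem_replicate, List.mem_map] at hg
  rcases hg with (rfl | rfl | rfl) | ⟨i, -, ⟨-, rfl⟩ | rfl | ⟨j, hj, rfl⟩⟩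
  · exact isLocal_T _ (Or.inl rfl)
  · exact isLocal_T _ (Or.inr ⟨_, rfl⟩)
  · exact isLocal_T _ (Or.inr ⟨_, rfl⟩)
  · exact isLocal_T _ (Or.inl rfl)
  · exact isLocal_CZ _ _ rfl (Or.inl rfl) (by simp [qm, qv])
  · exact isLocal_CZ _ _ rfl (hT i j hj) (hne i j hj)

theorem isLocal_gates [Fintype A] [DecidableEq A] (F : A → A → A) (c : CellKind A) :
    ∀ g ∈ gates F c, IsLocal g := by
  have hT : ∀ a : A, IsLocal (.T (qu a)) := fun a => isLocal_T _ (Or.inl rfl)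
  have hCZ : ∀ a b : A, IsLocal (.CZ (qu a) (qw .cur b)) := fun a b =>
    isLocal_CZ _ _ rfl (Or.inl rfl) (by simp [qu, qw])
  intro g hg
  rw [gates, List.mem_append] at hg
  rcases hg with hg | hg
  · simp only [phaseGates, List.mem_flatMap, List.mem_replicate] at hg
    obtain ⟨q, -, -, rfl⟩ := hg
    exact isLocal_T _ (Or.inl rfl)
  · cases c with
    | const a₀ =>
      simp only [checkGates, List.mem_flatMap, List.mem_cons] at hg
      obtain ⟨a, -, rfl | hg⟩ := hg
      · exact hCZ a a
      · split_ifs at hg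
        · rw [(List.mem_replicate.1 hg).2]
          exact hT a
        · cases hg
    | free t f =>
      simp only [checkGates, List.mem_flatMap] at hg
      obtain ⟨a, -, hg⟩ := hg
      split_ifs at hg
      · cases hg
      · simp only [List.mem_cons, List.mem_replicate] at hg
        rcases hg with rfl | rfl | ⟨-, rfl⟩
        exacts [hCZ _ _, hCZ _ _, hT _]
      · rw [List.mem_singleton.1 hg]
        exact hCZ _ _
    | later =>
      simp only [checkGates, List.mem_append, List.mem_flatMap, List.mem_singleton] at hg
      rcases hg with ⟨a, -, rfl⟩ | ⟨p, -, hg⟩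
      · exact hCZ _ _
      · exact isLocal_cubicGates F p g hg

/-- Of the other blocks only indicators are touched. Once all indicators are fixed, the sums over
the auxiliary qubits of the blocks are therefore independent. -/
theorem gatesWeight_joinShift {l : List (QGate (Shift × BlockQubit A))} (hl : ∀ g ∈ l, IsLocal g)
    (z : BlockQubit A → Bool) (x y : A → Bool) (xr yr xr' yr' : Aux A) :
    gatesWeight (joinShift z (joinAux x xr) (joinAux y yr)) l =
      gatesWeight (joinShift z (joinAux x xr') (joinAux y yr')) l := by
  refine gatesWeight_congr fun g hg j hj => ?_
  obtain ⟨s, q⟩ := j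
  rcases (hl g hg).1 _ hj with h | ⟨a, h⟩
  · simp only at h
    subst h
    rfl
  · simp only at h
    subst h
    cases s <;> rfl

variable {B : ℕ} (e : BlockQubit A ≃ Fin B)

/-- Number the qubits of a block. -/
def number (l : List (QGate (Shift × BlockQubit A))) : List (QGate (Shift × ℕ)) :=
  l.map (QGate.map fun j => (j.1, (e j.2 : ℕ)))

/-- The values of all qubits, given those of the indicators and of the auxiliary qubits. -/
def joinBlocks {P : ℕ} (S : (Fin P → A → Bool) × (Fin P → Aux A)) : Bits (P * B) :=
  fun j => joinAux (S.1 (finProdFinEquiv.symm j).1) (S.2 (finProdFinEquiv.symm j).1)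
    (e.symm (finProdFinEquiv.symm j).2)

theorem joinBlocks_apply {P : ℕ} (S : (Fin P → A → Bool) × (Fin P → Aux A)) (k : Fin P)
    (q : BlockQubit A) :
    joinBlocks e S (finProdFinEquiv (k, e q)) = joinAux (S.1 k) (S.2 k) q := by
  simp [joinBlocks]

theorem joinBlocks_bijective (P : ℕ) :
    Function.Bijective (joinBlocks e (P := P)) := by
  constructor
  · intro S S' h
    have hq : ∀ k q, joinAux (S.1 k) (S.2 k) q = joinAux (S'.1 k) (S'.2 k) q := fun k q => by
      rw [← joinBlocks_apply e, ← joinBlocks_apply e, h]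
    refine Prod.ext ?_ ?_ <;> funext k
    · funext a
      exact hq k (Sum.inl (Sum.inl a))
    · refine Prod.ext ?_ (Prod.ext ?_ ?_) <;> funext i
      · exact hq k (Sum.inl (Sum.inr i))
      · exact hq k (Sum.inr (Sum.inl i))
      · exact hq k (Sum.inr (Sum.inr i))
  · intro z
    refine ⟨(fun k a => z (finProdFinEquiv (k, e (Sum.inl (Sum.inl a)))),
      fun k => (fun a => z (finProdFinEquiv (k, e (Sum.inl (Sum.inr a)))),
        fun i => z (finProdFinEquiv (k, e (Sum.inr (Sum.inl i)))),
        fun i => z (finProdFinEquiv (k, e (Sum.inr (Sum.inr i)))))), ?_⟩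
    funext j
    obtain ⟨⟨k, i⟩, rfl⟩ := finProdFinEquiv.surjective j
    obtain ⟨q, rfl⟩ := e.surjective i
    rw [joinBlocks_apply]
    rcases q with (a | a) | (i | i) <;> rfl

/-- The two qubits of a `CZ` gate lie at different places of their blocks, so their numbers differ
modulo `B`, whichever blocks these are. -/
theorem valid_number {D k n : ℕ} {l : List (QGate (Shift × BlockQubit A))} (hl : ∀ g ∈ l, IsLocal g)
    (hpos : ∀ g ∈ l, ∀ j ∈ g.qubits, blockPos D k j.1 < n) :
    ∀ g ∈ (number e l).map (QGate.map (qubitIndex B (blockPos D k))), g.Valid (n * B) := by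
  have hlt : ∀ (q : BlockQubit A) {p : ℕ}, p < n → (e q : ℕ) + B * p < n * B := fun q p hp =>
    (finProdFinEquiv (⟨p, hp⟩, e q) : Fin (n * B)).is_lt
  intro g hg
  simp only [number, List.map_map, List.mem_map, Function.comp_apply] at hg
  obtain ⟨g, hg, rfl⟩ := hg
  have h1 := hl g hg
  have h2 := hpos g hg
  cases g with
  | T j => exact hlt j.2 (h2 j (by simp [QGate.qubits]))
  | CZ j k' =>
    refine ⟨hlt j.2 (h2 j (by simp [QGate.qubits])), hlt k'.2 (h2 k' (by simp [QGate.qubits])), ?_⟩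
    have h3 : j.2 ≠ k'.2 := by simpa [QGate.qubits] using h1.2
    intro h
    apply h3
    have h4 := congrArg (· % B) h
    simp only [qubitIndex, Nat.add_mul_mod_self_left, Nat.mod_eq_of_lt (Fin.is_lt _)] at h4
    exact e.injective (Fin.ext h4)

theorem prod_joinBlocks [Fintype A] {P : ℕ} (S : (Fin P → A → Bool) × (Fin P → Aux A)) :
    (∏ j, if joinBlocks e S j then Complex.I else 1) =
      ∏ k, ∏ q, if joinAux (S.1 k) (S.2 k) q then Complex.I else 1 := by
  rw [← finProdFinEquiv.prod_comp, Fintype.prod_prod_type]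
  refine Finset.prod_congr rfl fun k _ => ?_
  rw [← e.prod_comp]
  simp only [joinBlocks_apply]

theorem extendBits_joinBlocks {P : ℕ} (S : (Fin P → A → Bool) × (Fin P → Aux A)) {k : ℕ}
    (hk : k < P) (q : BlockQubit A) :
    extendBits (joinBlocks e S) (e q + B * k) = joinAux (extendFin S.1 k) (extendFin S.2 k) q := by
  -- `finProdFinEquiv` numbers pairs in the same way as `qubitIndex`.
  have h : (e q : ℕ) + B * k = finProdFinEquiv (⟨k, hk⟩, e q) := rfl
  rw [h, extendBits, dif_pos (Fin.is_lt _), extendFin_of_lt _ hk, extendFin_of_lt _ hk]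
  exact joinBlocks_apply e S ⟨k, hk⟩ q

/-- The second alternative in `hl` serves the final gates, which are placed at the position `P`
behind the last block and look only at the block before it. -/
theorem gatesWeight_number {P D k : ℕ} (S : (Fin P → A → Bool) × (Fin P → Aux A))
    (hk : k - 1 < P) (hD : k - D < P)
    (l : List (QGate (Shift × BlockQubit A))) (hl : k < P ∨ ∀ g ∈ l, ∀ j ∈ g.qubits, j.1 ≠ .cur) :
    gatesWeight (extendBits (joinBlocks e S))
      ((number e l).map (QGate.map (qubitIndex B (blockPos D k)))) =
    gatesWeight (joinShift (joinAux (extendFin S.1 k) (extendFin S.2 k))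
      (joinAux (extendFin S.1 (k - 1)) (extendFin S.2 (k - 1)))
      (joinAux (extendFin S.1 (k - D)) (extendFin S.2 (k - D)))) l := by
  rw [number, gatesWeight_map, gatesWeight_map]
  refine gatesWeight_congr fun g hg j hj => ?_
  obtain ⟨s, q⟩ := j
  cases s with
  | cur =>
    refine extendBits_joinBlocks e S ?_ q
    rcases hl with hl | hl
    · exact hl
    · exact absurd rfl (hl g hg _ hj)
  | prev => exact extendBits_joinBlocks e S hk q
  | del => exact extendBits_joinBlocks e S hD q

end Block

/-! ## The circuit of a chain -/

namespace Block

variable {A : Type} [Fintype A]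

/-- Gates that multiply by `-1` if the cell before the current one indicates a bad letter. -/
noncomputable def finalGates (bad : A → Bool) : List (QGate (Shift × BlockQubit A)) :=
  Finset.univ.toList.flatMap fun a => if bad a then List.replicate 4 (.T (qw .prev a)) else []

theorem eq_of_mem_finalGates {bad : A → Bool} {g : QGate (Shift × BlockQubit A)}
    (hg : g ∈ finalGates bad) : ∃ a, g = .T (qw .prev a) := by
  simp only [finalGates, List.mem_flatMap] at hg
  obtain ⟨a, -, hg⟩ := hg
  split_ifs at hg
  · exact ⟨a, (List.mem_replicate.1 hg).2⟩
  · cases hg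

theorem gatesWeight_finalGates [DecidableEq A] (bad : A → Bool) (c : A) (z y : BlockQubit A → Bool)
    (r : Aux A) :
    gatesWeight (joinShift z (joinAux (ind c) r) y) (finalGates bad) = if bad c then -1 else 1 := by
  rw [finalGates, gatesWeight_flatMap_univ, Finset.prod_eq_single c]
  · cases h : bad c
    · simp
    · simp only [if_true, gatesWeight_replicate]
      change boolPhase (ind c c) ^ 4 = -1
      simp [ind, boolPhase, omega8_pow_four]
  · intro a _ ha
    split_ifs
    · rw [gatesWeight_replicate]
      change boolPhase (ind c a) ^ 4 = 1
      simp [ind, boolPhase, ha]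
    · rfl
  · simp

variable [DecidableEq A] {B : ℕ} (e : BlockQubit A ≃ Fin B) (F : A → A → A)
  (kind : ℕ → CellKind A) (bad : A → Bool) (D P : ℕ)

/-- The gates that check a chain of `P` cells and test its last letter. -/
noncomputable def chainGates : List (QGate ℕ) :=
  (number e (finalGates bad)).map (QGate.map (qubitIndex B (blockPos D P))) ++
    blockGates B D (fun k => number e (gates F (kind k))) P

variable {D P}

theorem valid_blockGates (n : ℕ) (hn : n ≤ P) :
    ∀ g ∈ blockGates B D (fun k => number e (gates F (kind k))) n, g.Valid (P * B) := by
  induction n with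
  | zero => intro g hg; cases hg
  | succ n ih =>
    intro g hg
    rw [blockGates, List.mem_append] at hg
    rcases hg with hg | hg
    · refine valid_number e (isLocal_gates F (kind n)) (fun g _ j _ => ?_) g hg
      cases j.1 <;> simp only [blockPos] <;> omega
    · exact ih (by omega) g hg

theorem valid_chainGates (hP : 1 ≤ P) : ∀ g ∈ chainGates e F kind bad D P, g.Valid (P * B) := by
  intro g hg
  rw [chainGates, List.mem_append] at hg
  rcases hg with hg | hg
  · refine valid_number e (fun g hg => ?_) (fun g hg j hj => ?_) g hg
    · obtain ⟨a, rfl⟩ := eq_of_mem_finalGates hg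
      exact isLocal_T _ (Or.inr ⟨_, rfl⟩)
    · obtain ⟨a, rfl⟩ := eq_of_mem_finalGates hg
      rw [List.mem_singleton.1 hj]
      simp only [blockPos, qw]
      omega
  · exact valid_blockGates e F kind P le_rfl g hg

theorem gatesWeight_blockGates (S : (Fin P → A → Bool) × (Fin P → Aux A)) (n : ℕ) (hn : n ≤ P) :
    gatesWeight (extendBits (joinBlocks e S))
      (blockGates B D (fun k => number e (gates F (kind k))) n) =
    ∏ k ∈ Finset.range n, gatesWeight (joinShift (joinAux (extendFin S.1 k) (extendFin S.2 k))
      (joinAux (extendFin S.1 (k - 1)) default) (joinAux (extendFin S.1 (k - D)) default))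
      (gates F (kind k)) := by
  induction n with
  | zero => simp [blockGates]
  | succ n ih =>
    rw [blockGates, gatesWeight_append, Finset.prod_range_succ, mul_comm, ih (by omega),
      gatesWeight_number e S (by omega) (by omega) _ (Or.inl (by omega)),
      gatesWeight_joinShift (isLocal_gates F (kind n))]

/-- The sum over all qubits counts the chains with the sign given by their last letters. -/
theorem exists_sum_chainGates [Nonempty A] {c₀ t f : A} {s q : ℕ} (h : IsChain kind c₀ t f s q)
    (hD : 1 ≤ D) (hP : 1 ≤ P) (hq : s + q ≤ P) :
    ∃ C : ℕ, 2 ≤ C ∧ ∑ z : Bits (P * B), (∏ k, if z k then Complex.I else 1) *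
        gatesWeight (extendBits z) (chainGates e F kind bad D P) =
      C * ∑ y : Bits q,
        if bad (cellSeq F kind D c₀ (choice s y) (P - 1)) then (-1 : ℂ) else 1 := by
  choose C hC2 hC using fun k => exists_sum_aux F (kind k)
  refine ⟨∏ k : Fin P, C k, ?_, ?_⟩
  · refine (hC2 0).trans (Finset.single_le_prod' (f := fun k : Fin P => C k) (fun k _ => ?_)
      (Finset.mem_univ (⟨0, hP⟩ : Fin P)))
    exact le_trans (by norm_num) (hC2 k)
  -- The final gates read only the previous block, so the values `false` in the two others are
  -- placeholders.
  set G : (Fin P → A → Bool) → ℂ := fun W =>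
    gatesWeight (joinShift (fun _ => false) (joinAux (extendFin W (P - 1)) default)
      (fun _ => false)) (finalGates bad) with hG
  set T : (Fin P → A → Bool) → Fin P → Aux A → ℂ := fun W k r =>
    (∏ q, if joinAux (W k) r q then Complex.I else 1) *
      gatesWeight (joinShift (joinAux (W k) r) (joinAux (extendFin W (k - 1)) default)
        (joinAux (extendFin W (k - D)) default)) (gates F (kind k)) with hT
  have hterm : ∀ S : (Fin P → A → Bool) × (Fin P → Aux A),
      (∏ k, if joinBlocks e S k then Complex.I else 1) *
        gatesWeight (extendBits (joinBlocks e S)) (chainGates e F kind bad D P) =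
      G S.1 * ∏ k, T S.1 k (S.2 k) := by
    intro S
    have hfin : gatesWeight (extendBits (joinBlocks e S))
        ((number e (finalGates bad)).map (QGate.map (qubitIndex B (blockPos D P)))) = G S.1 := by
      rw [gatesWeight_number e S (by omega) (by omega) _ (Or.inr fun g hg j hj => ?_)]
      · refine gatesWeight_congr fun g hg j hj => ?_
        obtain ⟨a, rfl⟩ := eq_of_mem_finalGates hg
        rw [List.mem_singleton.1 hj]
        rfl
      · obtain ⟨a, rfl⟩ := eq_of_mem_finalGates hg
        rw [List.mem_singleton.1 hj]
        simp [qw]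
    rw [chainGates, gatesWeight_append, hfin, gatesWeight_blockGates e F kind S P le_rfl,
      prod_joinBlocks, Finset.prod_range, mul_left_comm, ← Finset.prod_mul_distrib]
    simp only [hT, extendFin_val]
  rw [← (joinBlocks_bijective e P).sum_comp, Fintype.sum_prod_type]
  simp only [hterm]
  -- For fixed indicators the sum over the auxiliary qubits is a product over the blocks, and each
  -- factor is evaluated by `exists_sum_aux`.
  have hsum : ∀ W : Fin P → A → Bool, ∑ R : Fin P → Aux A, G W * ∏ k, T W k (R k) =
      G W * ∏ k : Fin P, (if ∀ a, checkSign F (extendFin W k) (extendFin W (k - 1))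
        (extendFin W (k - D)) (kind k) a = 1 then (C k : ℂ) else 0) := by
    intro W
    rw [← Finset.mul_sum, ← prod_univ_sum_eq]
    congr 1
    refine Finset.prod_congr rfl fun k _ => ?_
    rw [extendFin_val]
    exact hC k _ _ _ _ _
  simp only [hsum]
  rw [sum_checks h F hD hq G fun k => (C k : ℂ)]
  push_cast
  congr 1
  refine Finset.sum_congr rfl fun y _ => ?_
  simp only [hG]
  rw [extendFin_of_lt _ (by omega)]
  exact gatesWeight_finalGates bad _ _ _ _

end Block

/-! ## The reduction -/

section Stage

variable {A : Type} (c₀ : A) (sym : Option (Option Bool) → A)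

/-- What a cell has to contain, by its role. -/
def CellStage.kind : CellStage → CellKind A
  | .first => .const c₀
  | .inp b => .const (sym (some (some b)))
  | .sep => .const (sym (some none))
  | .free => .free (sym (some (some true))) (sym (some (some false)))
  | .blank => .const (sym none)
  | .later => .later

variable (x : List Bool) (q D : ℕ)

theorem isChain_cellStage (h : sym (some (some true)) ≠ sym (some (some false))) :
    Block.IsChain (fun k => (cellStage x q D k).kind c₀ sym) c₀ (sym (some (some true)))
      (sym (some (some false))) (x.length + 2) q where
  zero := by simp [cellStage, CellStage.kind]
  free i hi := by
    have h1 : ¬ x.length + 2 + i = 0 := by omega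
    have h2 : ¬ x.length + 2 + i - 1 < x.length := by omega
    have h3 : ¬ x.length + 2 + i = x.length + 1 := by omega
    have h4 : x.length + 2 + i < x.length + 2 + q := by omega
    simp only [cellStage, h1, h2, h3, h4, if_true, if_false, dite_false, CellStage.kind]
  of_free k t f hk := by
    unfold cellStage at hk
    split_ifs at hk with h1 h2 h3 h4 h5 <;> simp only [CellStage.kind, reduceCtorEq] at hk
    cases hk
    exact ⟨rfl, rfl, by omega, by omega⟩
  ne := h

variable {c₀ sym x q D}

/-- Cell 0 is the control column, so the symbol `i` of `x # y` belongs to the cell `i + 1`. The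
letters chosen in the free cells spell `y`. -/
theorem cellSeq_cellStage_of_lt (F : A → A → A) (y : Bits q) {i : ℕ} (hi : i + 1 < D) :
    Block.cellSeq F (fun k => (cellStage x q D k).kind c₀ sym) D c₀
      (Block.choice (x.length + 2) y) (i + 1) = sym ((encodePair (x, List.ofFn y))[i]?) := by
  rw [Block.cellSeq, encodePair]
  unfold cellStage
  have h0 : ¬ i + 1 = 0 := by omega
  rw [if_neg h0]
  simp only [Nat.add_sub_cancel]
  by_cases h1 : i < x.length
  · rw [dif_pos h1, List.getElem?_append_left (by simpa using h1)]
    simp [CellStage.kind, h1]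
  · rw [dif_neg h1, List.getElem?_append_right (by simpa using h1), List.length_map]
    by_cases h2 : i + 1 = x.length + 1
    · have h3 : i - x.length = 0 := by omega
      rw [if_pos h2, h3]
      rfl
    · obtain ⟨j, rfl⟩ := Nat.exists_eq_add_of_lt (by omega : x.length < i)
      have h3 : x.length + j + 1 - x.length = j + 1 := by omega
      rw [if_neg h2, h3, List.getElem?_cons_succ]
      by_cases h4 : j < q
      · have h5 : x.length + j + 1 + 1 < x.length + 2 + q := by omega
        have h6 : x.length + j + 1 + 1 - (x.length + 2) = j := by omega
        rw [if_pos h5]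
        simp only [CellStage.kind, Block.choice, h6, extendBits, h4, dite_true]
        rw [List.getElem?_map, List.getElem?_eq_getElem (by simpa using h4)]
        cases hy : y ⟨j, h4⟩ <;> simp [hy]
      · have h5 : ¬ x.length + j + 1 + 1 < x.length + 2 + q := by omega
        rw [if_neg h5, if_pos hi]
        rw [List.getElem?_eq_none (by simpa using h4)]
        rfl

theorem cellSeq_cellStage_of_le (F : A → A → A) (v : ℕ → Bool) (hD : x.length + 2 + q ≤ D) {p : ℕ}
    (hp : D ≤ p) :
    Block.cellSeq F (fun k => (cellStage x q D k).kind c₀ sym) D c₀ v p =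
      F (Block.cellSeq F (fun k => (cellStage x q D k).kind c₀ sym) D c₀ v (p - 1))
        (Block.cellSeq F (fun k => (cellStage x q D k).kind c₀ sym) D c₀ v (p - D)) := by
  obtain ⟨p, rfl⟩ : ∃ k, p = k + 1 := Nat.exists_eq_succ_of_ne_zero (by omega)
  have h : cellStage x q D (p + 1) = .later := by
    have h1 : ¬ p + 1 = 0 := by omega
    have h2 : ¬ p + 1 - 1 < x.length := by omega
    have h3 : ¬ p + 1 = x.length + 1 := by omega
    have h4 : ¬ p + 1 < x.length + 2 + q := by omega
    have h5 : ¬ p + 1 < D := by omega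
    simp only [cellStage, h1, h2, h3, h4, h5, if_false, dite_false]
  have e : p + 1 - D = p - (D - 1) := by omega
  rw [Block.cellSeq, h, Nat.add_sub_cancel, e]
  rfl

end Stage

/-- For every language in coC₌P there is a polynomial-time computable map to circuits for which the
outcome `0ⁿ` is impossible outside the language and has at least the probability `4 · 2^{-2n}` in
it. -/
theorem exists_reduction {L : Set (List Bool)} (hL : L ∈ coCeqP) (n₀ : ℕ) :
    ∃ (r : List Bool → TCZCircuit) (n : Polynomial ℕ),
      PolyTimeComputable encodeString encodeCircuit r ∧
      (∀ x, (r x).n = n.eval x.length) ∧ (∀ x, n₀ ≤ (r x).n) ∧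
      (∀ x ∈ L, 4 / 2 ^ (2 * (r x).n) ≤ (r x).probZero) ∧ ∀ x ∉ L, (r x).probZero = 0 := by
  obtain ⟨q, f, hf, hLf⟩ := hL
  obtain ⟨A, _, _, F, c₀, sym, bad, τ, hne, hseq⟩ := exists_delay_sequence hf
  have : Nonempty A := ⟨c₀⟩
  set B := Fintype.card (BlockQubit A) with hB
  have hB1 : 1 ≤ B := Fintype.card_pos_iff.2 ⟨Sum.inl (Sum.inl c₀)⟩
  let e : BlockQubit A ≃ Fin B := Fintype.equivFin _
  -- The string `x # y` has length N + 1 + q(N). With this many blank cells `D` exceeds both the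
  -- time bound `τ` at that length and `n₀`.
  let R : Polynomial ℕ := τ.comp (Polynomial.X + 1 + q) + Polynomial.C n₀
  let D : Polynomial ℕ := Polynomial.X + 2 + q + R
  -- The second factor is D - 1 without a subtraction, so that D + Z = D² and the last cell is the
  -- one with the verdict.
  let Z : Polynomial ℕ := D * (Polynomial.X + 1 + q + R)
  have hDN : ∀ N, D.eval N = N + 2 + q.eval N + R.eval N := fun N => by simp [D]
  have hZN : ∀ N, D.eval N + Z.eval N = D.eval N * D.eval N := fun N => by
    have h : (Polynomial.X + 1 + q + R : Polynomial ℕ).eval N + 1 = D.eval N := by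
      simp [D]
      ring
    rw [← h]
    simp only [Z, Polynomial.eval_mul, ← h]
    ring
  have hRN : ∀ N, R.eval N = τ.eval (N + 1 + q.eval N) + n₀ := fun N => by simp [R]
  let kind : List Bool → ℕ → CellKind A := fun x k =>
    (cellStage x (q.eval x.length) (D.eval x.length) k).kind c₀ sym
  let n : Polynomial ℕ := D * D * Polynomial.C B
  have hn : ∀ N, n.eval N = D.eval N * D.eval N * B := fun N => by simp [n]
  let l : List Bool → List (QGate ℕ) := fun x =>
    Block.chainGates e F (kind x) bad (D.eval x.length) (D.eval x.length * D.eval x.length)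
  have hD2 : ∀ N, 2 ≤ D.eval N := fun N => by rw [hDN]; omega
  have hle : ∀ N, D.eval N ≤ D.eval N * D.eval N := fun N =>
    Nat.le_mul_of_pos_left _ (by have := hD2 N; omega)
  have hvalid : ∀ x, ∀ g ∈ l x, g.Valid (n.eval x.length) := fun x => by
    rw [hn]
    exact Block.valid_chainGates e F (kind x) bad
      ((by norm_num : 1 ≤ 2).trans ((hD2 _).trans (hle _)))
  let r : List Bool → TCZCircuit := fun x => TCZCircuit.ofGates (n.eval x.length) (l x)
  have hprob : ∀ x, ∃ C : ℕ, 2 ≤ C ∧ (r x).probZero =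
      ((C : ℝ) * ((∑ y : Fin (q.eval x.length) → Bool,
        ((f (x, List.ofFn y) : ℤˣ) : ℤ) : ℤ) : ℝ)) ^ 2 / 4 ^ (r x).n := by
    intro x
    have hDx := hDN x.length
    have hRx := hRN x.length
    have hDx2 := hD2 x.length
    have hlex := hle x.length
    obtain ⟨C, hC2, hC⟩ := Block.exists_sum_chainGates e F (kind x) bad
      (D := D.eval x.length) (P := D.eval x.length * D.eval x.length)
      (isChain_cellStage c₀ sym x (q.eval x.length) (D.eval x.length) hne)
      (by omega) (by omega) (by omega)
    refine ⟨C, hC2, ?_⟩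
    have hsum : ∀ y : Fin (q.eval x.length) → Bool,
        (if bad (Block.cellSeq F (kind x) (D.eval x.length) c₀
          (Block.choice (x.length + 2) y) (D.eval x.length * D.eval x.length - 1))
          then (-1 : ℂ) else 1) = (((f (x, List.ofFn y) : ℤˣ) : ℤ) : ℂ) := by
      intro y
      have h := hseq x (List.ofFn y) (D.eval x.length)
        (Block.cellSeq F (kind x) (D.eval x.length) c₀ (Block.choice (x.length + 2) y)) ?_ (by rw [Block.cellSeq])
        (fun i hi => cellSeq_cellStage_of_lt F y hi)
        (fun p hp => cellSeq_cellStage_of_le F _ (by omega) hp)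
      · rcases Int.units_eq_one_or (f (x, List.ofFn y)) with hu | hu
        · rw [if_neg, hu]
          · simp
          · rw [h, hu]
            decide
        · rw [if_pos (h.2 hu), hu]
          simp
      · have hlen : (encodePair (x, List.ofFn y)).length = x.length + 1 + q.eval x.length := by
          simp [encodePair]
          ring
        rw [hlen]
        omega
    rw [Finset.sum_congr rfl fun y _ => hsum y] at hC
    -- The number of qubits equals `D * D * B` only after evaluating a polynomial, so the type `Bits
    -- m` is transported along a general `m`.
    have hcast : ∀ m, m = D.eval x.length * D.eval x.length * B →
        ∑ z : Bits m, (∏ k, if z k then Complex.I else 1) * gatesWeight (extendBits z) (l x) =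
          ((C * ((∑ y : Fin (q.eval x.length) → Bool,
            ((f (x, List.ofFn y) : ℤˣ) : ℤ) : ℤ) : ℝ) : ℝ) : ℂ) := by
      rintro _ rfl
      refine hC.trans ?_
      push_cast
      rfl
    refine (probZero_ofGates (hvalid x)).trans ?_
    rw [hcast _ (hn _), Complex.norm_real, Real.norm_eq_abs, sq_abs]
    rfl
  refine ⟨r, n, ?_, fun _ => rfl, fun x => ?_, fun x hx => ?_, fun x hx => ?_⟩
  · obtain ⟨p, Q, hp⟩ := Prog.exists_generator B
      (fun st => Block.number e (Block.gates F (st.kind c₀ sym)))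
      (Block.number e (Block.finalGates bad)) q R Z n
    refine polyTimeComputable_of_runs _ _ _ p Q fun x => ?_
    obtain ⟨s', hs, ho⟩ := hp x (D.eval x.length) (D.eval x.length * D.eval x.length)
      (hDN _) (hZN _).symm
    refine ⟨s', hs, ?_⟩
    rw [ho, encodeCircuit_ofGates (hvalid x)]
    rfl
  · change n₀ ≤ n.eval x.length
    rw [hn]
    have h1 : n₀ ≤ D.eval x.length := by rw [hDN, hRN]; omega
    exact h1.trans ((hle _).trans (Nat.le_mul_of_pos_right _ hB1))
  · obtain ⟨C, hC2, hC⟩ := hprob x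
    rw [hC, pow_mul]
    norm_num only
    refine div_le_div_of_nonneg_right ?_ (by positivity)
    have h1 : (1 : ℝ) ≤ ((∑ y : Fin (q.eval x.length) → Bool,
        ((f (x, List.ofFn y) : ℤˣ) : ℤ) : ℤ) : ℝ) ^ 2 := by
      have h := (hLf x).1 hx
      have h2 : (1 : ℤ) ≤ (∑ y : Fin (q.eval x.length) → Bool,
        ((f (x, List.ofFn y) : ℤˣ) : ℤ)) ^ 2 := by
        have := sq_pos_of_ne_zero h
        omega
      exact_mod_cast h2
    have h2 : (2 : ℝ) ≤ C := by exact_mod_cast hC2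
    rw [mul_pow]
    nlinarith
  · obtain ⟨C, -, hC⟩ := hprob x
    have h := not_not.1 (mt (hLf x).2 hx)
    rw [hC, h]
    simp

/-! ## Binary fractions -/

theorem binaryFraction_nonneg (s : List Bool) : 0 ≤ binaryFraction s := by
  induction s with
  | nil => exact le_rfl
  | cons b s ih =>
    rw [binaryFraction]
    split_ifs <;> positivity

theorem binaryFraction_le_two (s : List Bool) : binaryFraction s ≤ 2 := by
  induction s with
  | nil => norm_num [binaryFraction]
  | cons b s ih =>
    rw [binaryFraction]
    split_ifs <;> linarith

/-- The first bit that can be nonzero has the weight 2^{-k}, and all bits from there on sum to at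
most twice that. -/
theorem binaryFraction_le_of_any_take {k : ℕ} {s : List Bool} (h : (s.take k).any id = false) :
    binaryFraction s ≤ 2 / 2 ^ k := by
  induction k generalizing s with
  | zero => simpa using binaryFraction_le_two s
  | succ k ih =>
    cases s with
    | nil =>
      rw [binaryFraction]
      positivity
    | cons b s =>
      simp only [List.take_succ_cons, List.any_cons, id, Bool.or_eq_false_iff] at h
      have := ih h.2
      rw [binaryFraction, h.1, pow_succ, ← div_div]
      simp only [Bool.false_eq_true, if_false, zero_add]
      linarith

theorem le_binaryFraction_of_any_take {k : ℕ} {s : List Bool} (h : (s.take k).any id = true) :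
    2 / 2 ^ k ≤ binaryFraction s := by
  induction k generalizing s with
  | zero => simp at h
  | succ k ih =>
    cases s with
    | nil => simp at h
    | cons b s =>
      rw [binaryFraction, pow_succ, ← div_div]
      have h0 := binaryFraction_nonneg s
      cases b with
      | true =>
        have : (2 : ℝ) / 2 ^ k ≤ 2 := div_le_self (by norm_num) (one_le_pow₀ (by norm_num))
        simp only [if_true]
        linarith
      | false =>
        simp only [List.take_succ_cons, List.any_cons, id, Bool.false_or] at h
        have := ih h
        simp only [Bool.false_eq_true, if_false, zero_add]
        linarith

/-- An approximation separates the circuits for which the outcome `0ⁿ` is impossible from those for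
which it has at least the probability `4 · 2^{-2n}`. -/
theorem ApproximatesProbZero.any_take_iff {C : TCZCircuit} {s : List Bool}
    (h : ApproximatesProbZero C s) {p : Prop} (hp : p → 4 / 2 ^ (2 * C.n) ≤ C.probZero)
    (hnp : ¬ p → C.probZero = 0) : (s.take (2 * C.n)).any id = true ↔ p := by
  -- With ε = 2^{-2n}, an approximation is at most ε/2 if the probability is 0, and at least 7ε/2 if
  -- the probability is at least 4ε. A bit `true` among the first 2n forces a value of at least 2ε,
  -- and its absence a value of at most 2ε.
  have hpos : (0 : ℝ) < 1 / 2 ^ (2 * C.n) := by positivity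
  have e1 : (1 : ℝ) / 2 ^ (2 * C.n + 1) = 1 / 2 ^ (2 * C.n) / 2 := by rw [pow_succ, div_div]
  have e2 : (2 : ℝ) / 2 ^ (2 * C.n) = 2 * (1 / 2 ^ (2 * C.n)) := by ring
  have e4 : (4 : ℝ) / 2 ^ (2 * C.n) = 4 * (1 / 2 ^ (2 * C.n)) := by ring
  obtain ⟨h1, h2⟩ := abs_le.1 h
  rw [e1] at h1 h2
  constructor
  · intro ht
    by_contra hn
    have := le_binaryFraction_of_any_take ht
    have := hnp hn
    linarith
  · intro h'
    by_contra ht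
    have := binaryFraction_le_of_any_take (Bool.eq_false_iff.2 ht)
    have := hp h'
    linarith

theorem mainTheorem6 :
    -- The phase oracle followed by X-rotations with `β = π/4`.
    (∀ (n : ℕ) (f : Bits n → ℤˣ),
      qaoaProbZero (phaseOracle f) (fun _ => Real.pi / 4) =
        ((∑ z, ((f z : ℤˣ) : ℤ) : ℤ) : ℝ) ^ 2 / 2 ^ (2 * n)) ∧
    -- Hardness for circuits with sufficiently many qubits.
    (∀ n₀ : ℕ,
      SearchHard encodeCircuit {C : TCZCircuit | n₀ ≤ C.n} ApproximatesProbZero ∧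
      PromiseHard encodeCircuit
        {C : TCZCircuit | n₀ ≤ C.n ∧ 1 / 2 ^ (2 * C.n) ≤ C.probZero}
        {C : TCZCircuit | n₀ ≤ C.n ∧ C.probZero = 0}) := by
  refine ⟨qaoaProbZero_phaseOracle, fun n₀ => ⟨fun L hL => ?_, fun L hL => ?_⟩⟩
  · obtain ⟨r, n, hr, hn, hn₀, hyes, hno⟩ := exists_reduction hL n₀
    -- The number of qubits is a polynomial in the length of `x`, so the prefix length is found
    -- without constructing the circuit again.
    refine ⟨r, _, hr, polyTimeComputable_any_take (2 * n), hn₀, fun x s hs => ?_⟩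
    rw [← hs.any_take_iff (hyes x) (hno x), hn]
    simp
  · obtain ⟨r, n, hr, hn, hn₀, hyes, hno⟩ := exists_reduction hL n₀
    refine ⟨r, hr, fun x hx => ⟨hn₀ x, le_trans ?_ (hyes x hx)⟩, fun x hx => ⟨hn₀ x, hno x hx⟩⟩
    exact div_le_div_of_nonneg_right (by norm_num) (by positivity)
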